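/- Let $S$ be a surface over an algebraically closed field $k$ of characteristic zero, i.e. an integral separated scheme of finite type over $k$ of dimension $2$. Let $P\in S$ be a smooth closed point, and let $\Delta_1,\Delta_2\subset S$ be two distinct irreducible curves that both pass through $P$, are smooth at $P$ and intersect transversally at $P$. Let $a_1,a_2$ be non-negative rational numbers, and let $\Omega=\sum_i\omega_iC_i$ be an effective $\mathbb{Q}$-divisor on $S$ (a finite sum with $C_i$ irreducible curves and $\omega_i\in\mathbb{Q}_{\geqslant 0}$) whose support contains neither $\Delta_1$ nor $\Delta_2$. Write $I_C\subset\mathcal{O}_{S,P}$ for the ideal of a curve $C$ at $P$ and $\mathfrak{m}_P$ for the maximal ideal. Put $$\mathrm{mult}_P(\Omega)=\sum_i\omega_i\,\mathrm{mult}_P(C_i),\qquad \mathrm{mult}_P(C)=\max\{n\geqslant 0: I_C\subseteq\mathfrak{m}_P^n\},$$ and let $$\mathrm{mult}_P(\Omega\cdot\Delta_j)=\sum_i\omega_i\,\mathrm{length}_{\mathcal{O}_{S,P}}\,\mathcal{O}_{S,P}/(I_{C_i}+I_{\Delta_j})$$ be the local intersection number at $P$ (the sum over the $i$ with $\omega_i\neq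 0$). For a $\mathbb{Q}$-divisor $D$ on $S$, the log pair $(S,D)$ is called log canonical at $P$ if for every proper birational morphism $f\colon Y\to S$ over $k$ from a normal integral scheme $Y$ and every prime divisor $E\subset Y$ with $P\in f(E)$, the coefficient of $E$ in $K_Y-f^*(K_S+D)$ is at least $-1$; here $K_Y$ and $K_S$ are the divisors of one and the same non-zero rational $2$-form, and $f^*(K_S+D)$ is formed near $E$, using that $S$ is smooth near $P$. Suppose that $(S,a_1\Delta_1+a_2\Delta_2+\Omega)$ is not log canonical at $P$ and that $\mathrm{mult}_P(\Omega)\leqslant 1$. Then $$\mathrm{mult}_P(\Omega\cdot\Delta_1)>2(1-a_2)\quad\text{or}\quad \mathrm{mult}_P(\Omega\cdot\Delta_2)>2(1-a_1).$$ -/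

import Mathlib

open AlgebraicGeometry CategoryTheory

universe u

noncomputable section

namespace LocalInequality

/-! ### Two-forms on a field -/

/-- The space `⋀²_K Ω_{K/k}` of two-forms of a field extension `K / k`. -/
abbrev TwoForm (k K : Type u) [Field k] [Field K] [Algebra k K] : Type u :=
  ⋀[K]^2 (KaehlerDifferential k K)

/-- The two-form `da ∧ db`. -/
def dWedge (k : Type u) {K : Type u} [Field k] [Field K] [Algebra k K] (a b : K) : TwoForm k K :=
  exteriorPower.ιMulti K 2 ![KaehlerDifferential.D k K a, KaehlerDifferential.D k K b]

/-- For a ring `A` with a map to `K`, the image of `⋀²_A Ω_{A/k}` in `⋀²_K Ω_{K/k}`: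
the `A`-submodule spanned by the forms `da ∧ db` with `a`, `b` in `A`. -/
def regularTwoForms (k A K : Type u) [Field k] [CommRing A] [Field K] [Algebra k K] [Algebra A K] :
    Submodule A (TwoForm k K) :=
  Submodule.span A
    {η | ∃ a b : A, η = dWedge k (algebraMap A K a) (algebraMap A K b)}

/-- The pullback of two-forms along an embedding of fields over `k`, the additive map with
`h da ∧ db ↦ φ(h) dφ(a) ∧ dφ(b)`. -/
def TwoForm.pullback {k K L : Type u} [Field k] [Field K] [Field L] [Algebra k K] [Algebra k L]
    (φ : K →ₐ[k] L) : TwoForm k K →+ TwoForm k L :=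
  letI : Algebra K L := φ.toRingHom.toAlgebra
  haveI : IsScalarTower k K L := IsScalarTower.of_algebraMap_eq fun x ↦ (φ.commutes x).symm
  let w : (KaehlerDifferential k L) [⋀^Fin 2]→ₗ[K] TwoForm k L :=
    { (exteriorPower.ιMulti L 2 (M := KaehlerDifferential k L)).toMultilinearMap.restrictScalars K
        with
      map_eq_zero_of_eq' := fun v _ _ h hij ↦
        (exteriorPower.ιMulti L 2 (M := KaehlerDifferential k L)).map_eq_zero_of_eq v h hij }
  (exteriorPower.alternatingMapLinearEquiv
    (w.compLinearMap (KaehlerDifferential.map k k K L))).toAddMonoidHom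

theorem TwoForm.pullback_smul_dWedge {k K L : Type u} [Field k] [Field K] [Field L] [Algebra k K]
    [Algebra k L] (φ : K →ₐ[k] L) (h a b : K) :
    TwoForm.pullback φ (h • dWedge k a b) = φ h • dWedge k (φ a) (φ b) := by
  let _ : Algebra K L := φ.toRingHom.toAlgebra
  have _ : IsScalarTower k K L := IsScalarTower.of_algebraMap_eq fun x ↦ (φ.commutes x).symm
  simp only [TwoForm.pullback, dWedge, LinearMap.toAddMonoidHom_coe, map_smul,
    exteriorPower.alternatingMapLinearEquiv_apply_ιMulti]
  rw [← algebraMap_smul L h]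
  change φ h • (exteriorPower.ιMulti L 2) _ = _
  congr 2
  ext i
  fin_cases i
  · exact KaehlerDifferential.map_D k k K L a
  · exact KaehlerDifferential.map_D k k K L b

/-! ### Function fields of schemes over a field -/

section Schemes

variable {k : Type u} [Field k]

/-- The function field of a `k`-scheme is a `k`-algebra, by restricting the scalar functions to the
generic point. -/
instance functionFieldAlgebra (X : Scheme.{u}) [IsIntegral X] [X.Over (Spec (.of k))] :
    Algebra k X.functionField :=
  ((X.presheaf.germ ⊤ (genericPoint X) (TopologicalSpace.Opens.mem_top _)).hom.comp
    ((X ↘ Spec (.of k)).appTop.hom.comp (Scheme.ΓSpecIso (.of k)).inv.hom)).toAlgebra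

theorem specializes_genericPoint {X Y : Scheme.{u}} [IsIntegral X] [IsIntegral Y] (f : Y ⟶ X)
    [IsDominant f] : f (genericPoint Y) ⤳ genericPoint X := by
  have h : closure {f (genericPoint Y)} = Set.univ := by
    have h1 := (genericPoint_spec Y).image (f := f) f.continuous
    rw [Set.image_univ, f.denseRange.closure_range] at h1
    exact h1.def
  rw [specializes_iff_mem_closure, h]
  trivial

/-- Pullback of rational functions along a dominant morphism of integral schemes. -/
def rationalPullback {X Y : Scheme.{u}} [IsIntegral X] [IsIntegral Y] (f : Y ⟶ X) [IsDominant f] :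
    X.functionField →+* Y.functionField :=
  (X.presheaf.stalkSpecializes (specializes_genericPoint f) ≫ f.stalkMap (genericPoint Y)).hom

/-- The pullback of rational functions along a dominant `k`-morphism, as a map of `k`-algebras. -/
def rationalPullbackAlgHom {X Y : Scheme.{u}} [IsIntegral X] [IsIntegral Y]
    [X.Over (Spec (.of k))] [Y.Over (Spec (.of k))] (f : Y ⟶ X) [f.IsOver (Spec (.of k))]
    [IsDominant f] : X.functionField →ₐ[k] Y.functionField :=
  { rationalPullback f with
    commutes' := fun c ↦ by
      have hf : (X ↘ Spec (.of k)).appTop ≫ f.appTop = (Y ↘ Spec (.of k)).appTop := by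
        rw [← Scheme.Hom.comp_appTop, comp_over]
      have hg : X.presheaf.germ ⊤ (genericPoint X) (TopologicalSpace.Opens.mem_top _) ≫
          X.presheaf.stalkSpecializes (specializes_genericPoint f) ≫
            f.stalkMap (genericPoint Y) =
          f.appTop ≫
            Y.presheaf.germ ⊤ (genericPoint Y) (TopologicalSpace.Opens.mem_top _) := by
        rw [TopCat.Presheaf.germ_stalkSpecializes_assoc, Scheme.Hom.germ_stalkMap]
        rfl
      have h := congrArg (fun φ ↦ ((X ↘ Spec (.of k)).appTop ≫ φ).hom
        ((Scheme.ΓSpecIso (.of k)).inv.hom c)) hg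
      simp only [← Category.assoc, hf] at h
      simp only [Category.assoc] at h
      exact h }

variable {X Y S : Scheme.{u}}

/-- A dominant morphism of integral schemes is birational if it induces an isomorphism of function
fields. -/
def IsBirational [IsIntegral X] [IsIntegral Y] (f : Y ⟶ X) [IsDominant f] : Prop :=
  Function.Bijective (rationalPullback f)

/-- All local rings are integrally closed domains. -/
def IsNormal (X : Scheme.{u}) [IsIntegral X] : Prop :=
  ∀ x : X, IsIntegrallyClosed (X.presheaf.stalk x)

/-! ### Canonical divisors and discrepancies

A prime divisor on an integral scheme is represented by its generic point, a point `z` with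
`Order.coheight z = 1`; it passes through a point `x` exactly when `z ⤳ x`. -/

/-- The form `η` is a generator of the canonical sheaf at `x`: the two-forms that are regular
at `x` are the multiples of `η` by regular functions at `x`. -/
def IsLocalGenerator [IsIntegral X] [X.Over (Spec (.of k))] (x : X)
    (η : TwoForm k X.functionField) : Prop :=
  regularTwoForms k (X.presheaf.stalk x) X.functionField =
    Submodule.span (X.presheaf.stalk x) {η}

open Classical in
/-- The coefficient at the prime divisor `z` of the canonical divisor `div ω`: the order at `z`
of a rational function `g` such that `ω = g • η` with `η` a local generator of the canonical sheaf
at `z`. The value is `0` if the canonical sheaf is not free at `z`, which does not happen when the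
surface is regular at `z`. -/
def canonicalCoeff [IsIntegral X] [IsLocallyNoetherian X] [X.Over (Spec (.of k))]
    (ω : TwoForm k X.functionField) (z : X) : ℤ :=
  if h : ∃ g : X.functionField, ∃ η, IsLocalGenerator (k := k) z η ∧ ω = g • η then
    X.ord h.choose z
  else 0

/-- For a morphism `f : Y ⟶ S`, a `ℚ`-divisor `D` on `S` and a prime divisor `y` on `Y`, the number
`a` is the discrepancy of `y` with respect to `(S, D)`. Let `ω` be a non-zero rational two-form,
let `K_S = div ω`, `K_Y = div f^* ω`, and let `g` be a local equation near `f y` of the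
multiple `m (K_S + D)`, with `m > 0`. Then `a` is the coefficient of `y` in
`K_Y - f^* (K_S + D)`, where `f^* (K_S + D)` is given by `div (f^* g) / m`. -/
def IsDiscrepancy (k : Type u) [Field k] [IsIntegral S] [IsIntegral Y] [IsLocallyNoetherian S]
    [IsLocallyNoetherian Y] [S.Over (Spec (.of k))] [Y.Over (Spec (.of k))] (f : Y ⟶ S)
    [f.IsOver (Spec (.of k))] [IsDominant f] (D : AlgebraicCycle S ℚ) (y : Y) (a : ℚ) : Prop :=
  ∃ (ω : TwoForm k S.functionField) (m : ℕ) (g : S.functionField), ω ≠ 0 ∧ 0 < m ∧ g ≠ 0 ∧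
    (∀ z : S, Order.coheight z = 1 → z ⤳ f y →
      (S.ord g z : ℚ) = m * (canonicalCoeff ω z + D z)) ∧
    a = canonicalCoeff (ω.pullback (rationalPullbackAlgHom f)) y -
      (Y.ord (rationalPullback f g) y : ℚ) / m

/-- The log pair `(S, D)` is log canonical at the point `P`: every prime divisor over `S` (that is,
on a normal variety with a proper birational morphism to `S`) whose centre on `S` contains `P` has
discrepancy at least `-1`. This is meant for points `P` where `K_S + D` is `ℚ`-Cartier, for instance
smooth points. -/
def IsLogCanonicalAt (k : Type u) [Field k] [IsIntegral S] [S.Over (Spec (.of k))]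
    [LocallyOfFiniteType (S ↘ Spec (.of k))] (D : AlgebraicCycle S ℚ) (P : S) : Prop :=
  haveI : IsLocallyNoetherian S := LocallyOfFiniteType.isLocallyNoetherian (S ↘ Spec (.of k))
  ∀ (Y : Scheme.{u}) [IsIntegral Y] [Y.Over (Spec (.of k))] (f : Y ⟶ S)
    [f.IsOver (Spec (.of k))] [IsProper f] [IsDominant f],
    haveI : IsLocallyNoetherian Y := LocallyOfFiniteType.isLocallyNoetherian f
    IsNormal Y → IsBirational f →
      ∀ y : Y, Order.coheight y = 1 → f y ⤳ P → ∀ a : ℚ, IsDiscrepancy k f D y a → -1 ≤ a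

/-! ### Smoothness, transversality and multiplicities -/

/-- The `k`-scheme `S` is smooth over `k` at `P`. -/
def IsSmoothPoint (k : Type u) [Field k] (S : Scheme.{u}) [S.Over (Spec (.of k))] (P : S) : Prop :=
  ∃ U : S.Opens, P ∈ U ∧ Smooth (U.ι ≫ (S ↘ Spec (.of k)))

/-- The ideal in the local ring `𝒪_{S,P}` of the integral closed subscheme of `S` with
generic point `z`; the unit ideal if that subscheme does not pass through `P`. -/
def idealAt (z P : S) : Ideal (S.presheaf.stalk P) :=
  open Classical in
  if h : z ⤳ P then
    (IsLocalRing.maximalIdeal (S.presheaf.stalk z)).comap (S.presheaf.stalkSpecializes h).hom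
  else ⊤

/-- The curve with generic point `z` passes through `P` and is smooth there. (Over an algebraically
closed field a curve is smooth at a closed point exactly when its local ring is regular.) -/
def IsSmoothCurveAt (z P : S) : Prop :=
  Order.coheight z = 1 ∧ z ⤳ P ∧ IsRegularLocalRing (S.presheaf.stalk P ⧸ idealAt z P)

/-- Two different curves meet transversally at `P`: their local equations generate the maximal
ideal of `P`. -/
def MeetTransversallyAt (z₁ z₂ P : S) : Prop :=
  z₁ ≠ z₂ ∧ idealAt z₁ P ⊔ idealAt z₂ P = IsLocalRing.maximalIdeal (S.presheaf.stalk P)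

/-- The multiplicity at `P` of the curve with generic point `z`: the largest `n` such that its
local equation at `P` lies in the `n`-th power of the maximal ideal. -/
def curveMult (z P : S) : ℕ :=
  sSup {n : ℕ | idealAt z P ≤ IsLocalRing.maximalIdeal (S.presheaf.stalk P) ^ n}

/-- The local intersection number at `P` of two curves without a common component: the length
of `𝒪_{S,P} / (I₁ + I₂)`. -/
def localInter (z₁ z₂ P : S) : ℕ :=
  (Module.length (S.presheaf.stalk P) (S.presheaf.stalk P ⧸ (idealAt z₁ P ⊔ idealAt z₂ P))).toNat

/-- A `ℚ`-divisor: a cycle all of whose components have codimension one. -/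
def IsQDivisor (D : AlgebraicCycle S ℚ) : Prop :=
  ∀ z : S, D z ≠ 0 → Order.coheight z = 1

open Classical in
/-- The cycle `a Δ`, where `Δ` has generic point `z`. -/
def multipleOf (a : ℚ) (z : S) : AlgebraicCycle S ℚ :=
  Function.locallyFinsuppWithin.single z a

/-- The multiplicity `mult_P D` of a `ℚ`-divisor `D`. -/
def divisorMult (D : AlgebraicCycle S ℚ) (P : S) : ℚ :=
  ∑ᶠ z : S, D z * curveMult z P

/-- The local intersection number `mult_P (D · Δ)` of a `ℚ`-divisor `D` and a curve `Δ` that is not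
contained in the support of `D`. -/
def divisorInter (D : AlgebraicCycle S ℚ) (Δ P : S) : ℚ :=
  ∑ᶠ z : S, D z * localInter z Δ P

end Schemes

end LocalInequality
end

/-! Fix a prime divisor `E` over `S` and let `ord` be its order function. If the centre of `E` is
`P`, let `u`, `v` be local equations of `Δ₁`, `Δ₂`, put `p = ord u`, `q = ord v`, and let `A` be the
log discrepancy of `E` over `S`, that is, one plus the order of the Jacobian of `(u, v)` along `E`.
Always `A ≥ p + q`, because logarithmic forms have at most simple poles. The heart of the proof is a
bound for the local equation `e` of a curve `C` different from both `Δⱼ`: `2 ord e ≤ 2 (A - p - q)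
mult_P C + q (C · Δ₁)_P + p (C · Δ₂)_P`. Sum it over the components of `Ω` and insert `mult_P Ω ≤ 1`
and the negations `(Ω · Δ₁)_P ≤ 2 (1 - a₂)`, `(Ω · Δ₂)_P ≤ 2 (1 - a₁)` of the conclusion. The terms
`p` and `q` cancel and leave `a₁ p + a₂ q + ord Ω ≤ A`: the discrepancy of `E` is at least `-1`. If
the centre is not `P`, then `E` is a curve on `S`, and its coefficient in the boundary is at most
one.

The bound (`two_mul_ord_le`) is proved by quadratic transformations, but no scheme is blown up:
everything happens in the function field of `Y`. Replacing `(x, y)` by `(x, y / x)` divides the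
Jacobian by `x`, so induction on its order terminates. When `ord x = ord y`, the next centre need
not lie on a proper transform of an axis; there `ord_le_of_coeff_ne_zero`, a form of inversion of
adjunction, takes over. The Jacobian is encoded by a bracket `B` with `da ∧ db = B a b • η`, where
`η` generates the regular two-forms at `E`. The substitutions are made in polynomials, which
approximate elements of the local ring modulo high powers of the maximal ideal
(`two_mul_ord_le_of_notMem`).

The remaining work connects this with schemes. Smoothness makes the maximal ideal at `P`
two-generated, the two curves then give parameters, and the local ring is factorial. Hence
`IsDiscrepancy.exists_eq` expresses any discrepancy through the order of the bracket and the orders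
of local equations of curves through `P`. -/

noncomputable section

namespace LocalInequality

/-! ### Discrete orders and brackets on a field -/

section Bracket

variable {k L : Type*} [Field k] [Field L] [Algebra k L]

/-- `ord` is the order function of a discrete valuation of `L` that is trivial on `k`, with the
convention `ord 0 = 0`. -/
structure IsDiscreteOrder (k : Type*) {L : Type*} [Field k] [Field L] [Algebra k L]
    (ord : L → ℤ) : Prop where
  mul : ∀ {a b : L}, a ≠ 0 → b ≠ 0 → ord (a * b) = ord a + ord b
  add : ∀ {a b : L}, a + b ≠ 0 → min (ord a) (ord b) ≤ ord (a + b)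
  const : ∀ c : k, ord (algebraMap k L c) = 0
  uniformizer : ∃ π : L, ord π = 1

/-- Either `a` is zero or its order is at least `n`. -/
def OrdGE (ord : L → ℤ) (n : ℤ) (a : L) : Prop := a ≠ 0 → n ≤ ord a

namespace IsDiscreteOrder

variable {ord : L → ℤ} (h : IsDiscreteOrder k ord)

include h

theorem zero : ord 0 = 0 := by simpa using h.const 0

theorem one : ord 1 = 0 := by simpa using h.const 1

theorem pow {a : L} (ha : a ≠ 0) (n : ℕ) : ord (a ^ n) = n * ord a := by
  induction n with
  | zero => simpa using h.one
  | succ n ih => rw [pow_succ, h.mul (pow_ne_zero _ ha) ha, ih]; push_cast; ring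

theorem neg (a : L) : ord (-a) = ord a := by
  rcases eq_or_ne a 0 with rfl | ha
  · simp
  have h1 : ord (-1) = 0 := by simpa using h.const (-1)
  rw [← neg_one_mul, h.mul (by simp) ha, h1, zero_add]

theorem inv {a : L} (ha : a ≠ 0) : ord a⁻¹ = -ord a := by
  have := h.mul ha (inv_ne_zero ha)
  rw [mul_inv_cancel₀ ha, h.one] at this
  omega

theorem div {a b : L} (ha : a ≠ 0) (hb : b ≠ 0) : ord (a / b) = ord a - ord b := by
  rw [div_eq_mul_inv, h.mul ha (inv_ne_zero hb), h.inv hb]; ring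

theorem ordGE_add {n : ℤ} {a b : L} (ha : OrdGE ord n a) (hb : OrdGE ord n b) :
    OrdGE ord n (a + b) := by
  intro hab
  rcases eq_or_ne a 0 with rfl | ha0
  · simpa using hb (by simpa using hab)
  rcases eq_or_ne b 0 with rfl | hb0
  · simpa using ha ha0
  exact (le_min (ha ha0) (hb hb0)).trans (h.add hab)

theorem ordGE_neg {n : ℤ} {a : L} (ha : OrdGE ord n a) : OrdGE ord n (-a) := by
  intro ha0
  rw [h.neg]
  exact ha (by simpa using ha0)

theorem ordGE_sub {n : ℤ} {a b : L} (ha : OrdGE ord n a) (hb : OrdGE ord n b) :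
    OrdGE ord n (a - b) := by
  rw [sub_eq_add_neg]
  exact h.ordGE_add ha (h.ordGE_neg hb)

theorem ordGE_mul {n m : ℤ} {a b : L} (ha : OrdGE ord n a) (hb : OrdGE ord m b) :
    OrdGE ord (n + m) (a * b) := by
  intro hab
  have ha0 := left_ne_zero_of_mul hab
  have hb0 := right_ne_zero_of_mul hab
  rw [h.mul ha0 hb0]
  exact add_le_add (ha ha0) (hb hb0)

theorem ordGE_pow {n : ℤ} {a : L} (ha : OrdGE ord n a) (m : ℕ) : OrdGE ord (m * n) (a ^ m) := by
  induction m with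
  | zero => intro; simp [h.one]
  | succ m ih =>
    rw [pow_succ]
    have := h.ordGE_mul ih ha
    intro h0
    have := this h0
    push_cast
    linarith

theorem ordGE_const (c : k) : OrdGE ord 0 (algebraMap k L c) := fun _ ↦ (h.const c).ge

theorem ordGE_natCast (n : ℕ) : OrdGE ord 0 (n : L) := by simpa using h.ordGE_const (n : k)

/-- For the bound zero the guard `a ≠ 0` is harmless, thanks to the convention `ord 0 = 0`. -/
theorem ordGE_zero_iff {a : L} : OrdGE ord 0 a ↔ 0 ≤ ord a := by
  refine ⟨fun H ↦ ?_, fun H _ ↦ H⟩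
  rcases eq_or_ne a 0 with rfl | ha
  · exact h.zero.ge
  · exact H ha

omit h in
theorem _root_.LocalInequality.OrdGE.mono {n m : ℤ} {a : L} (ha : OrdGE ord n a) (hm : m ≤ n) :
    OrdGE ord m a := fun h0 ↦ hm.trans (ha h0)

/-- The order of a sum is the smaller order, if the orders differ. -/
theorem ord_add_of_lt {a b : L} (ha : a ≠ 0) (hb : OrdGE ord (ord a + 1) b) :
    a + b ≠ 0 ∧ ord (a + b) = ord a := by
  have hab : a + b ≠ 0 := by
    intro h0
    have hb' : b = -a := by linear_combination h0
    have := hb (by simpa [hb'] using ha)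
    rw [hb', h.neg] at this
    omega
  refine ⟨hab, le_antisymm ?_ (h.ordGE_add (fun _ ↦ le_rfl) (hb.mono (by omega)) hab)⟩
  by_contra! hlt
  have : OrdGE ord (ord a + 1) (a + b - b) := h.ordGE_sub (fun _ ↦ hlt) hb
  rw [add_sub_cancel_right] at this
  have := this ha
  omega

theorem exists_eq_mul_pow {π : L} (hπ : ord π = 1) {a : L} (ha : a ≠ 0) (h0 : 0 ≤ ord a) :
    ∃ u : L, u ≠ 0 ∧ ord u = 0 ∧ a = u * π ^ (ord a).toNat := by
  have hπ0 : π ≠ 0 := by rintro rfl; rw [h.zero] at hπ; omega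
  refine ⟨a / π ^ (ord a).toNat, div_ne_zero ha (pow_ne_zero _ hπ0), ?_,
    (div_mul_cancel₀ _ (pow_ne_zero _ hπ0)).symm⟩
  rw [h.div ha (pow_ne_zero _ hπ0), h.pow hπ0, hπ]
  omega

end IsDiscreteOrder

/-- `B` is an alternating biderivation of `L / k` that is regular with respect to `ord`. -/
structure IsRegularBracket (ord : L → ℤ) (B : L →ₗ[k] Derivation k L L) : Prop where
  alt : ∀ a, B a a = 0
  regular : ∀ a b, 0 ≤ ord a → 0 ≤ ord b → 0 ≤ ord (B a b)

namespace IsRegularBracket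

variable {ord : L → ℤ} {B : L →ₗ[k] Derivation k L L} (hB : IsRegularBracket ord B)
  (h : IsDiscreteOrder k ord)

include hB

theorem swap (a b : L) : B a b = -B b a := by
  have := hB.alt (a + b)
  simp only [map_add, Derivation.add_apply, hB.alt, zero_add, add_zero] at this
  linear_combination this

theorem mul_left (a b c : L) : B (a * b) c = a * B b c + b * B a c := by
  rw [hB.swap, Derivation.leibniz, hB.swap a, hB.swap b]
  simp only [smul_eq_mul]
  ring

include h

theorem ordGE (a b : L) (ha : 0 ≤ ord a) (hb : 0 ≤ ord b) : OrdGE ord 0 (B a b) :=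
  h.ordGE_zero_iff.2 (hB.regular a b ha hb)

/-- The differential of a pole-free function of order `n` vanishes to order at least `n - 1`. -/
theorem ordGE_sub_one {a b : L} (ha : a ≠ 0) (ha' : 0 ≤ ord a) (hb : 0 ≤ ord b) :
    OrdGE ord (ord a - 1) (B a b) := by
  obtain ⟨π, hπ⟩ := h.uniformizer
  obtain ⟨u, hu, hu0, hau⟩ := h.exists_eq_mul_pow hπ ha ha'
  have hπ0 : π ≠ 0 := by rintro rfl; rw [h.zero] at hπ; omega
  rcases ha'.eq_or_lt with h0 | hpos
  · exact (hB.ordGE h a b ha' hb).mono (by omega)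
  -- With `a = u π ^ (n + 1)` and `u` a unit, `da = π ^ n (π du + (n + 1) u dπ)`: exactly one power
  -- of `π` is lost.
  obtain ⟨n, hn⟩ : ∃ n : ℕ, ord a = n + 1 := ⟨(ord a - 1).toNat, by omega⟩
  rw [hn] at hau
  have e : ((n : ℤ) + 1).toNat = n + 1 := by omega
  rw [e] at hau
  have key : B a b = π ^ n * (π * B u b + (n + 1 : ℕ) * (u * B π b)) := by
    rw [hau, hB.swap, Derivation.leibniz, Derivation.leibniz_pow, hB.swap u, hB.swap π]
    simp only [smul_eq_mul, nsmul_eq_mul, Nat.add_sub_cancel]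
    ring
  rw [key, hn]
  have h1 : OrdGE ord 0 (π * B u b + (n + 1 : ℕ) * (u * B π b)) := by
    refine h.ordGE_add ?_ ?_
    · exact (h.ordGE_mul (n := 1) (fun _ ↦ hπ.ge) (hB.ordGE h u b hu0.ge hb)).mono (by norm_num)
    · have := h.ordGE_mul (h.ordGE_natCast (n + 1)) (h.ordGE_mul (n := 0) (fun _ ↦ hu0.ge)
        (hB.ordGE h π b (by omega) hb))
      simpa using this
  have h2 : OrdGE ord n (π ^ n) := by
    have := h.ordGE_pow (n := 1) (a := π) (fun _ ↦ hπ.ge) n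
    simpa using this
  simpa using h.ordGE_mul h2 h1

/-- Logarithmic forms have at most simple poles. -/
theorem ordGE_add_sub_one {a b : L} (ha : a ≠ 0) (hb : b ≠ 0) (ha' : 0 ≤ ord a) (hb' : 0 ≤ ord b) :
    OrdGE ord (ord a + ord b - 1) (B a b) := by
  obtain ⟨π, hπ⟩ := h.uniformizer
  have hπ0 : π ≠ 0 := by rintro rfl; rw [h.zero] at hπ; omega
  -- Against `π` itself nothing is lost, since the term with `dπ ∧ dπ` vanishes.
  have hpi : OrdGE ord (ord a) (B a π) := by
    obtain ⟨u, hu, hu0, hau⟩ := h.exists_eq_mul_pow hπ ha ha'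
    have key : B a π = π ^ (ord a).toNat * B u π := by
      conv_lhs => rw [hau]
      rw [hB.swap, Derivation.leibniz, Derivation.leibniz_pow, hB.swap u, hB.alt]
      simp only [smul_eq_mul, smul_zero, mul_zero]
      ring
    rw [key]
    have h2 := h.ordGE_pow (n := 1) (a := π) (fun _ ↦ hπ.ge) (ord a).toNat
    have := h.ordGE_mul h2 (hB.ordGE h u π hu0.ge (by omega))
    exact this.mono (by omega)
  obtain ⟨w, hw, hw0, hbw⟩ := h.exists_eq_mul_pow hπ hb hb'
  rcases hb'.eq_or_lt with h0 | hpos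
  · rw [← h0, add_zero]
    exact hB.ordGE_sub_one h ha ha' hb'
  obtain ⟨n, hn⟩ : ∃ n : ℕ, ord b = n + 1 := ⟨(ord b - 1).toNat, by omega⟩
  have e : (ord b).toNat = n + 1 := by omega
  rw [e] at hbw
  -- The factor `π` compensates the loss in `B a w`, and `B a π` has none; so only the exponent `n =
  -- ord b - 1` falls short.
  have key : B a b = π ^ n * (π * B a w + (n + 1 : ℕ) * (w * B a π)) := by
    conv_lhs => rw [hbw]
    rw [Derivation.leibniz, Derivation.leibniz_pow]
    simp only [smul_eq_mul, nsmul_eq_mul, Nat.add_sub_cancel]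
    ring
  rw [key]
  have h1 : OrdGE ord (ord a) (π * B a w + (n + 1 : ℕ) * (w * B a π)) := by
    refine h.ordGE_add ?_ ?_
    · exact (h.ordGE_mul (n := 1) (fun _ ↦ hπ.ge)
        (hB.ordGE_sub_one h ha ha' hw0.ge)).mono (by omega)
    · have := h.ordGE_mul (h.ordGE_natCast (n + 1)) (h.ordGE_mul (n := 0) (fun _ ↦ hw0.ge) hpi)
      simpa using this
  have h2 : OrdGE ord n (π ^ n) := by
    have := h.ordGE_pow (n := 1) (a := π) (fun _ ↦ hπ.ge) n
    simpa using this
  exact (h.ordGE_mul h2 h1).mono (by omega)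

end IsRegularBracket

end Bracket

/-! ### Bivariate polynomials and quadratic transformations -/

section Bivariate

open Polynomial Polynomial.Bivariate

variable {k L : Type*} [Field k] [Field L] [Algebra k L]

theorem coeff_coeff_swap (F : k[X][Y]) (i j : ℕ) :
    ((Bivariate.swap F).coeff i).coeff j = (F.coeff j).coeff i := by
  induction F using Polynomial.induction_on' with
  | add p q hp hq => simp [hp, hq]
  | monomial n f =>
    induction f using Polynomial.induction_on' with
    | add p q hp hq => simp only [map_add, coeff_add, hp, hq]
    | monomial m r =>
      rw [Bivariate.swap_monomial_monomial]
      simp only [coeff_monomial]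
      split_ifs <;> simp_all [coeff_monomial]

theorem aevalAeval_comp (F p : k[X][Y]) (x y : L) :
    aevalAeval x y (F.comp p) = aevalAeval x (aevalAeval x y p) F := by
  induction F using Polynomial.induction_on' with
  | add p q hp hq => rw [add_comp, map_add, map_add, hp, hq]
  | monomial n f =>
    rw [← C_mul_X_pow_eq_monomial, mul_comp, X_pow_comp, C_comp, map_mul, map_mul, map_pow,
      map_pow, aevalAeval_C, aevalAeval_C, aevalAeval_Y]

/-- The substitution `Y ↦ XY` in a polynomial of multiplicity at least `m`, divided by `X ^ m`. -/
theorem exists_blowup (F : k[X][Y]) (m : ℕ)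
    (hF : ∀ i j, i + j < m → (F.coeff j).coeff i = 0) :
    ∃ G : k[X][Y], (∀ x y : L, aevalAeval x (x * y) F = x ^ m * aevalAeval x y G) ∧
      ∀ i j, (G.coeff j).coeff i = if j ≤ i + m then (F.coeff j).coeff (i + m - j) else 0 := by
  -- The monomial `X ^ i Y ^ j` becomes `X ^ (i + j) Y ^ j`, which is divisible by `X ^ m` when `i +
  -- j ≥ m`.
  have hdvd : C (X ^ m : k[X]) ∣ F.comp (C X * X) := by
    rw [C_dvd_iff_dvd_coeff]
    intro j
    rw [comp_C_mul_X_coeff, X_pow_dvd_iff]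
    intro d hd
    rw [coeff_mul_X_pow']
    split_ifs with hj
    · exact hF _ _ (by omega)
    · rfl
  obtain ⟨G, hG⟩ := hdvd
  refine ⟨G, fun x y ↦ ?_, fun i j ↦ ?_⟩
  · have h1 : aevalAeval x (x * y) F = aevalAeval x y (F.comp (C X * X)) := by
      rw [aevalAeval_comp, map_mul, aevalAeval_X, aevalAeval_Y]
    rw [h1, hG, map_mul, aevalAeval_C, map_pow, aeval_X]
  · have h2 := congrArg (fun p ↦ (p.coeff j).coeff (i + m)) hG
    simp only [comp_C_mul_X_coeff, coeff_C_mul, coeff_mul_X_pow', coeff_X_pow_mul] at h2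
    exact h2.symm

/-- The substitution `X ↦ XY` in a polynomial of multiplicity at least `m`, divided by `Y ^ m`. -/
theorem exists_blowup' (F : k[X][Y]) (m : ℕ)
    (hF : ∀ i j, i + j < m → (F.coeff j).coeff i = 0) :
    ∃ G : k[X][Y], (∀ x y : L, aevalAeval (x * y) y F = y ^ m * aevalAeval x y G) ∧
      ∀ i j, (G.coeff j).coeff i = if i ≤ j + m then (F.coeff (j + m - i)).coeff i else 0 := by
  obtain ⟨G, hG, hc⟩ := exists_blowup (L := L) (Bivariate.swap F) m
    (fun i j hij ↦ by rw [coeff_coeff_swap]; exact hF _ _ (by omega))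
  refine ⟨Bivariate.swap G, fun x y ↦ ?_, fun i j ↦ ?_⟩
  · rw [Bivariate.aevalAeval_swap, ← hG, Bivariate.aevalAeval_swap, mul_comm]
  · rw [coeff_coeff_swap, hc, coeff_coeff_swap]

theorem aevalAeval_shift (F : k[X][Y]) (c : k) (x y : L) :
    aevalAeval x y (F.comp (X + C (C c))) = aevalAeval x (y + algebraMap k L c) F := by
  rw [aevalAeval_comp, map_add, aevalAeval_Y, aevalAeval_C, aeval_C]

/-- The restriction of a bivariate polynomial to the axis `X = 0`. -/
theorem exists_eq_map_add (F : k[X][Y]) :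
    ∃ H : k[X][Y], F = (F.map constantCoeff).map C + C X * H := by
  have hdvd : C (X : k[X]) ∣ F - (F.map constantCoeff).map C := by
    rw [C_dvd_iff_dvd_coeff]
    intro j
    rw [X_dvd_iff]
    simp
  obtain ⟨H, hH⟩ := hdvd
  exact ⟨H, by rw [← hH]; ring⟩

theorem aevalAeval_map_C (g : k[X]) (x y : L) :
    aevalAeval x y (g.map C) = aeval y g := by
  induction g using Polynomial.induction_on' with
  | add p q hp hq => rw [Polynomial.map_add, map_add, map_add, hp, hq]
  | monomial n a =>
    rw [map_monomial, ← C_mul_X_pow_eq_monomial, ← C_mul_X_pow_eq_monomial, map_mul, map_mul,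
      map_pow, map_pow, aevalAeval_C, aevalAeval_Y, aeval_C, aeval_C, aeval_X]

/-- A non-zero bivariate polynomial has a multiplicity. -/
theorem exists_multiplicity (F : k[X][Y]) {i j : ℕ} (hij : (F.coeff j).coeff i ≠ 0) :
    ∃ i' j', i' + j' ≤ i + j ∧ (F.coeff j').coeff i' ≠ 0 ∧
      ∀ i'' j'', i'' + j'' < i' + j' → (F.coeff j'').coeff i'' = 0 := by
  classical
  have hex : ∃ m i j, i + j = m ∧ (F.coeff j).coeff i ≠ 0 := ⟨_, i, j, rfl, hij⟩
  obtain ⟨i', j', hm, hc⟩ := Nat.find_spec hex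
  refine ⟨i', j', hm.le.trans (Nat.find_min' hex ⟨i, j, rfl, hij⟩), hc, fun i'' j'' hlt ↦ ?_⟩
  by_contra hne
  exact Nat.find_min hex (hm ▸ hlt) ⟨i'', j'', rfl, hne⟩

end Bivariate

/-! ### Orders of polynomial expressions along a discrete valuation -/

section Order

open Polynomial Polynomial.Bivariate

variable {k L : Type*} [Field k] [Field L] [Algebra k L] {ord : L → ℤ}

namespace IsDiscreteOrder

variable (h : IsDiscreteOrder k ord)

include h

theorem ordGE_aeval {y : L} (hy : 0 ≤ ord y) (g : k[X]) : OrdGE ord 0 (aeval y g) := by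
  induction g using Polynomial.induction_on' with
  | add p q hp hq => rw [map_add]; exact h.ordGE_add hp hq
  | monomial n a =>
    rw [aeval_monomial]
    simpa using h.ordGE_mul (h.ordGE_const a) (h.ordGE_pow (h.ordGE_zero_iff.2 hy) n)

theorem ordGE_aevalAeval {x y : L} (hx : 0 ≤ ord x) (hy : 0 ≤ ord y) (F : k[X][Y]) :
    OrdGE ord 0 (aevalAeval x y F) := by
  induction F using Polynomial.induction_on' with
  | add p q hp hq => rw [map_add]; exact h.ordGE_add hp hq
  | monomial n a =>
    rw [← C_mul_X_pow_eq_monomial, map_mul, map_pow, aevalAeval_C, aevalAeval_Y]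
    simpa using h.ordGE_mul (h.ordGE_aeval hx a) (h.ordGE_pow (h.ordGE_zero_iff.2 hy) n)

/-- If the residue of `t` does not lie in the algebraically closed field `k`, it is
transcendental. -/
theorem ord_aeval_eq_zero [IsAlgClosed k] {t : L}
    (ht : ∀ c : k, t - algebraMap k L c ≠ 0 ∧ ord (t - algebraMap k L c) = 0)
    (g : k[X]) (hg : g ≠ 0) : aeval t g ≠ 0 ∧ ord (aeval t g) = 0 := by
  induction hn : g.natDegree using Nat.strong_induction_on generalizing g with
  | _ n ih =>
    by_cases hd : g.degree = 0
    · rw [eq_C_of_degree_eq_zero hd] at hg ⊢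
      rw [aeval_C]
      exact ⟨by simpa using hg, h.const _⟩
    -- Over an algebraically closed field `g` splits into linear factors, each of order zero at `t`.
    · obtain ⟨c, hc⟩ := IsAlgClosed.exists_root g hd
      obtain ⟨q, rfl⟩ := dvd_iff_isRoot.2 hc
      have hq : q ≠ 0 := right_ne_zero_of_mul hg
      obtain ⟨h1, h2⟩ := ih q.natDegree (by
        rw [← hn, natDegree_mul (X_sub_C_ne_zero c) hq, natDegree_X_sub_C]; omega) q hq rfl
      obtain ⟨h3, h4⟩ := ht c
      rw [map_mul, map_sub, aeval_X, aeval_C]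
      exact ⟨mul_ne_zero h3 h1, by rw [h.mul h3 h1, h2, h4, add_zero]⟩

/-- Along a valuation that is centred at the generic point of the curve `X = 0`, a polynomial that
does not vanish on this curve has order zero. -/
theorem ord_aevalAeval_eq_zero [IsAlgClosed k] {x t : L} (hx : 0 < ord x)
    (ht : ∀ c : k, t - algebraMap k L c ≠ 0 ∧ ord (t - algebraMap k L c) = 0)
    (F : k[X][Y]) {j : ℕ} (hF : (F.coeff j).coeff 0 ≠ 0) :
    aevalAeval x t F ≠ 0 ∧ ord (aevalAeval x t F) = 0 := by
  obtain ⟨H, hH⟩ := exists_eq_map_add F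
  have h0 : F.map constantCoeff ≠ 0 := by
    intro h0
    have := congrArg (fun p ↦ p.coeff j) h0
    simp only [coeff_map, constantCoeff_apply, coeff_zero] at this
    exact hF this
  obtain ⟨h1, h2⟩ := h.ord_aeval_eq_zero ht _ h0
  have ht0 : 0 ≤ ord t := by simpa using (ht 0).2.ge
  have h3 : OrdGE ord (ord (aeval t (F.map constantCoeff)) + 1) (x * aevalAeval x t H) :=
    (h.ordGE_mul (n := 1) (fun _ ↦ hx) (h.ordGE_aevalAeval hx.le ht0 H)).mono (by omega)
  have h4 := h.ord_add_of_lt h1 h3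
  rw [hH, map_add, map_mul, aevalAeval_map_C, aevalAeval_X]
  exact ⟨h4.1, h4.2.trans h2⟩

end IsDiscreteOrder

end Order

/-! ### Valuative inequalities by induction on quadratic transformations -/

section Core

open Polynomial Polynomial.Bivariate

variable {k L : Type*} [Field k] [Field L] [Algebra k L] {ord : L → ℤ}
  {B : L →ₗ[k] Derivation k L L}

namespace IsRegularBracket

variable (hB : IsRegularBracket ord B) (h : IsDiscreteOrder k ord)

include hB h

omit h in
theorem bracket_mul_right (x t : L) : B x (x * t) = x * B x t := by
  rw [Derivation.leibniz, hB.alt]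
  simp

omit h in
theorem bracket_mul_left (t y : L) : B (t * y) y = y * B t y := by
  rw [hB.mul_left, hB.alt]
  simp

theorem ord_bracket_mul_right {x t : L} (hx : x ≠ 0) (ht : B x (x * t) ≠ 0) :
    B x t ≠ 0 ∧ ord (B x (x * t)) = ord x + ord (B x t) := by
  rw [hB.bracket_mul_right] at ht ⊢
  exact ⟨right_ne_zero_of_mul ht, h.mul hx (right_ne_zero_of_mul ht)⟩

theorem ord_bracket_mul_left {t y : L} (hy : y ≠ 0) (ht : B (t * y) y ≠ 0) :
    B t y ≠ 0 ∧ ord (B (t * y) y) = ord y + ord (B t y) := by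
  rw [hB.bracket_mul_left] at ht ⊢
  exact ⟨right_ne_zero_of_mul ht, h.mul hy (right_ne_zero_of_mul ht)⟩

/-- The order of a polynomial of multiplicity `i + j`, from bounds on the exceptional curve of the
blow-up. -/
theorem ord_le_of_blowup [IsAlgClosed k] {x y : L} (hx : 0 < ord x) (hxy' : ord x ≤ ord y)
    (hxy : B x y ≠ 0)
    (IH : ∀ (y' : L) (G : k[X][Y]) (n : ℕ), 0 < ord y' → B x y' ≠ 0 →
      ord (B x y') + ord x = ord (B x y) → (G.coeff n).coeff 0 ≠ 0 →
        aevalAeval x y' G ≠ 0 ∧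
          ord (aevalAeval x y' G) ≤ n * (1 + ord (B x y') - ord x))
    (F : k[X][Y]) {i j : ℕ} (hF : (F.coeff j).coeff i ≠ 0)
    (hmin : ∀ i' j', i' + j' < i + j → (F.coeff j').coeff i' = 0) :
    2 * ord x ≤ 1 + ord (B x y) ∧ aevalAeval x y F ≠ 0 ∧
      ord (aevalAeval x y F) ≤ (i + j : ℕ) * (1 + ord (B x y) - ord x) := by
  have hx0 : x ≠ 0 := by rintro rfl; rw [h.zero] at hx; omega
  have hy0 : y ≠ 0 := by rintro rfl; rw [h.zero] at hxy'; omega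
  -- In the chart `(x, t)` of the blow-up, `x = 0` is the exceptional curve, and the bracket loses
  -- the factor `x`.
  obtain ⟨t, rfl⟩ : ∃ t, y = x * t := ⟨y / x, (mul_div_cancel₀ y hx0).symm⟩
  have ht0 : t ≠ 0 := right_ne_zero_of_mul hy0
  have hmt := h.mul hx0 ht0
  have ht : 0 ≤ ord t := by omega
  obtain ⟨hxt, hord⟩ := ord_bracket_mul_right hB h hx0 hxy
  have hlog := hB.ordGE_sub_one h hx0 hx.le ht hxt
  have hA : 2 * ord x ≤ 1 + ord (B x (x * t)) := by omega
  refine ⟨hA, ?_⟩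
  obtain ⟨G, hG, hGc⟩ := exists_blowup (L := L) F (i + j) hmin
  have hGj : (G.coeff j).coeff 0 ≠ 0 := by
    rw [hGc, if_pos (by omega)]
    convert hF using 2
    omega
  rw [hG]
  -- Either `t` has transcendental residue and the valuation is centred at the generic point of the
  -- exceptional curve, where `G` is a unit, or it is centred at a point `t = c` of that curve.
  by_cases hc : ∀ c : k, t - algebraMap k L c ≠ 0 ∧ ord (t - algebraMap k L c) = 0
  · obtain ⟨h1, h2⟩ := h.ord_aevalAeval_eq_zero hx hc G hGj
    refine ⟨mul_ne_zero (pow_ne_zero _ hx0) h1, ?_⟩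
    rw [h.mul (pow_ne_zero _ hx0) h1, h2, h.pow hx0, add_zero]
    exact mul_le_mul_of_nonneg_left (by omega) (by positivity)
  · push Not at hc
    obtain ⟨c, hc⟩ := hc
    set y' := t - algebraMap k L c with hy'
    have hBy : B x y' = B x t := by rw [hy', map_sub, Derivation.map_algebraMap, sub_zero]
    have hy'0 : y' ≠ 0 := by
      intro h0
      rw [h0, map_zero] at hBy
      exact hxt hBy.symm
    have hy'pos : 0 < ord y' := by
      have h1 := h.ordGE_sub (h.ordGE_zero_iff.2 ht) (h.ordGE_const c) hy'0
      exact lt_of_le_of_ne h1 (fun h2 ↦ hc hy'0 h2.symm)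
    have hcomp : (G.comp (X + C (C c))).map constantCoeff =
        (G.map constantCoeff).comp (X + C c) := by
      rw [map_comp]; simp
    have hne : (G.map constantCoeff).comp (X + C c) ≠ 0 := by
      rw [Ne, comp_X_add_C_eq_zero_iff]
      intro h0
      have := congrArg (fun p ↦ p.coeff j) h0
      simp only [coeff_map, constantCoeff_apply, coeff_zero] at this
      exact hGj this
    -- On the exceptional curve `G` restricts to the dehomogenized leading form of `F`, of degree at
    -- most `i + j`. Any index of a non-zero coefficient bounds the vanishing order at `c`, so the
    -- degree can serve as `n`.
    set n := ((G.map constantCoeff).comp (X + C c)).natDegree with hn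
    have hnle : n ≤ i + j := by
      rw [hn, natDegree_comp, natDegree_X_add_C, mul_one, natDegree_le_iff_coeff_eq_zero]
      intro N hN
      rw [coeff_map, constantCoeff_apply, hGc, if_neg (by omega)]
    have hcoef : ((G.comp (X + C (C c))).coeff n).coeff 0 ≠ 0 := by
      have : ((G.comp (X + C (C c))).map constantCoeff).coeff n ≠ 0 := by
        rw [hcomp]; exact leadingCoeff_ne_zero.2 hne
      simpa only [coeff_map, constantCoeff_apply] using this
    have hev : aevalAeval x t G = aevalAeval x y' (G.comp (X + C (C c))) := by
      rw [aevalAeval_shift, hy', sub_add_cancel]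
    obtain ⟨h1, h2⟩ := IH y' _ n hy'pos (by rwa [hBy]) (by rw [hBy]; omega) hcoef
    rw [hev]
    refine ⟨mul_ne_zero (pow_ne_zero _ hx0) h1, ?_⟩
    rw [h.mul (pow_ne_zero _ hx0) h1, h.pow hx0]
    rw [hBy] at h2
    have h3 : (n : ℤ) * (1 + ord (B x t) - ord x) ≤ (i + j : ℕ) * (1 + ord (B x t) - ord x) :=
      mul_le_mul_of_nonneg_right (by exact_mod_cast hnle) (by omega)
    rw [hord]
    linarith

/-- Inversion of adjunction: the order of `F` is bounded by its local intersection number with the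
curve `x = 0`. -/
theorem ord_le_of_coeff_ne_zero [IsAlgClosed k] {x y : L} (hx : 0 < ord x) (hy : 0 < ord y)
    (hxy : B x y ≠ 0) (F : k[X][Y]) {n : ℕ} (hF : (F.coeff n).coeff 0 ≠ 0) :
    aevalAeval x y F ≠ 0 ∧ ord (aevalAeval x y F) ≤ n * (1 + ord (B x y) - ord x) := by
  -- Each transformation divides the bracket by a coordinate of positive order, while regularity
  -- keeps its order non-negative.
  induction hN : (ord (B x y)).toNat using Nat.strong_induction_on generalizing x y F n with
  | _ N ih =>
  have hx0 : x ≠ 0 := by rintro rfl; rw [h.zero] at hx; omega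
  have hy0 : y ≠ 0 := by rintro rfl; rw [h.zero] at hy; omega
  have hBpos := hB.regular x y hx.le hy.le
  have hlog := hB.ordGE_add_sub_one h hx0 hy0 hx.le hy.le hxy
  obtain ⟨i, j, hij, hF', hmin⟩ := exists_multiplicity F hF
  rw [zero_add] at hij
  rcases le_or_gt (ord x) (ord y) with hle | hlt
  · obtain ⟨h1, h2, h3⟩ := ord_le_of_blowup hB h hx hle hxy
      (fun y' G m hy' hxy' he hG ↦ ih _ (by
        have := hB.regular x y' hx.le hy'.le
        omega) hx hy' hxy' G hG rfl) F hF' hmin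
    exact ⟨h2, h3.trans (mul_le_mul_of_nonneg_right (by exact_mod_cast hij) (by omega))⟩
  -- Now the centre lies on the proper transform `t = 0` of the curve `x = 0`; its intersection
  -- number with `F` drops by the multiplicity `i + j`, and `ord B - ord x` is unchanged.
  · obtain ⟨t, rfl⟩ : ∃ t, x = t * y := ⟨x / y, (div_mul_cancel₀ x hy0).symm⟩
    have ht0 : t ≠ 0 := left_ne_zero_of_mul hx0
    have hmt := h.mul ht0 hy0
    obtain ⟨hty, hord⟩ := ord_bracket_mul_left hB h hy0 hxy
    have htpos : 0 < ord t := by omega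
    have hBt := hB.regular t y htpos.le hy.le
    obtain ⟨G, hG, hGc⟩ := exists_blowup' (L := L) F (i + j) hmin
    have hGn : (G.coeff (n - (i + j))).coeff 0 ≠ 0 := by
      rw [hGc, if_pos (by omega)]
      convert hF using 3
      omega
    obtain ⟨h1, h2⟩ := ih _ (by omega) htpos hy hty G hGn rfl
    rw [hG]
    refine ⟨mul_ne_zero (pow_ne_zero _ hy0) h1, ?_⟩
    rw [h.mul (pow_ne_zero _ hy0) h1, h.pow hy0, hord]
    rw [Nat.cast_sub hij] at h2
    have h3 : ((i + j : ℕ) : ℤ) * ord y ≤ (i + j : ℕ) * (1 + ord (B t y) - ord t) :=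
      mul_le_mul_of_nonneg_left (by omega) (by positivity)
    rw [hmt]
    linarith

/-- The order of `F`, bounded in terms of its multiplicity and of its local intersection numbers
with the two coordinate axes. -/
theorem two_mul_ord_le [IsAlgClosed k] {x y : L} (hx : 0 < ord x) (hy : 0 < ord y)
    (hxy : B x y ≠ 0) (F : k[X][Y]) {i j i₁ i₂ : ℕ} (hF : (F.coeff j).coeff i ≠ 0)
    (h₁ : (F.coeff i₁).coeff 0 ≠ 0) (h₂ : (F.coeff 0).coeff i₂ ≠ 0) :
    aevalAeval x y F ≠ 0 ∧ 2 * ord (aevalAeval x y F) ≤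
      2 * (1 + ord (B x y) - ord x - ord y) * (i + j : ℕ) + ord y * i₁ + ord x * i₂ := by
  induction hN : (ord (B x y)).toNat using Nat.strong_induction_on
    generalizing x y F i j i₁ i₂ with
  | _ N ih =>
  have hx0 : x ≠ 0 := by rintro rfl; rw [h.zero] at hx; omega
  have hy0 : y ≠ 0 := by rintro rfl; rw [h.zero] at hy; omega
  have hBpos := hB.regular x y hx.le hy.le
  have hlog := hB.ordGE_add_sub_one h hx0 hy0 hx.le hy.le hxy
  obtain ⟨i', j', hij, hF', hmin⟩ := exists_multiplicity F hF
  have hm₁ : i' + j' ≤ i₁ := by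
    by_contra! hlt
    exact h₁ (hmin _ _ (by omega))
  have hm₂ : i' + j' ≤ i₂ := by
    by_contra! hlt
    exact h₂ (hmin _ _ (by omega))
  -- The coefficient of the multiplicity is non-negative by `hlog`, so it is enough to treat the
  -- exact multiplicity `i' + j'`.
  suffices aevalAeval x y F ≠ 0 ∧ 2 * ord (aevalAeval x y F) ≤
      2 * (1 + ord (B x y) - ord x - ord y) * (i' + j' : ℕ) + ord y * i₁ + ord x * i₂ by
    refine ⟨this.1, this.2.trans ?_⟩
    have : 2 * (1 + ord (B x y) - ord x - ord y) * ((i' + j' : ℕ) : ℤ) ≤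
        2 * (1 + ord (B x y) - ord x - ord y) * (i + j : ℕ) :=
      mul_le_mul_of_nonneg_left (by exact_mod_cast hij) (by omega)
    linarith
  have hy₁ : ord y * ((i' + j' : ℕ) : ℤ) ≤ ord y * i₁ :=
    mul_le_mul_of_nonneg_left (by exact_mod_cast hm₁) hy.le
  have hx₂ : ord x * ((i' + j' : ℕ) : ℤ) ≤ ord x * i₂ :=
    mul_le_mul_of_nonneg_left (by exact_mod_cast hm₂) hx.le
  rcases lt_trichotomy (ord x) (ord y) with hlt | heq | hgt
  · obtain ⟨t, rfl⟩ : ∃ t, y = x * t := ⟨y / x, (mul_div_cancel₀ y hx0).symm⟩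
    have ht0 : t ≠ 0 := right_ne_zero_of_mul hy0
    have hmt := h.mul hx0 ht0
    obtain ⟨hxt, hord⟩ := ord_bracket_mul_right hB h hx0 hxy
    have htpos : 0 < ord t := by omega
    have hBt := hB.regular x t hx.le htpos.le
    obtain ⟨G, hG, hGc⟩ := exists_blowup (L := L) F (i' + j') hmin
    -- The index `j'` bounds both the multiplicity of `G` and its intersection number with the
    -- exceptional curve `x = 0`. The other axis `t = 0` is the proper transform of `y = 0`, where
    -- the intersection number drops to `i₂ - (i' + j')`.
    have hG₁ : (G.coeff j').coeff 0 ≠ 0 := by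
      rw [hGc, if_pos (by omega)]
      convert hF' using 2
      omega
    have hG₂ : (G.coeff 0).coeff (i₂ - (i' + j')) ≠ 0 := by
      rw [hGc, if_pos (by omega)]
      convert h₂ using 2
      omega
    obtain ⟨h3, h4⟩ := ih _ (by omega) hx htpos hxt G hG₁ hG₁ hG₂ rfl
    rw [hG]
    refine ⟨mul_ne_zero (pow_ne_zero _ hx0) h3, ?_⟩
    rw [h.mul (pow_ne_zero _ hx0) h3, h.pow hx0]
    rw [Nat.cast_sub hm₂] at h4
    rw [hmt] at hlog hy₁ ⊢
    rw [hord] at hlog ⊢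
    have h5 : (2 * (1 + ord (B x t) - ord x - ord t) + ord t) * (j' : ℤ) ≤
        (2 * (1 + ord (B x t) - ord x - ord t) + ord t) * (i' + j' : ℕ) :=
      mul_le_mul_of_nonneg_left (by push_cast; omega) (by omega)
    push_cast at *
    linarith
  -- For equal orders the centre leaves both proper transforms. Inversion of adjunction along the
  -- exceptional curve gives `ord F ≤ m (1 + ord B - ord x)`, with `m = i' + j'`; this suffices
  -- because `m ≤ i₁` and `m ≤ i₂`.
  · obtain ⟨h3, h4, h5⟩ := ord_le_of_blowup hB h hx heq.le hxy
      (fun y' G m hy' hxy' he hG ↦ ord_le_of_coeff_ne_zero hB h hx hy' hxy' G hG) F hF' hmin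
    refine ⟨h4, ?_⟩
    rw [← heq] at hy₁ ⊢
    push_cast at *
    linarith
  · obtain ⟨t, rfl⟩ : ∃ t, x = t * y := ⟨x / y, (div_mul_cancel₀ x hy0).symm⟩
    have ht0 : t ≠ 0 := left_ne_zero_of_mul hx0
    have hmt := h.mul ht0 hy0
    obtain ⟨hty, hord⟩ := ord_bracket_mul_left hB h hy0 hxy
    have htpos : 0 < ord t := by omega
    have hBt := hB.regular t y htpos.le hy.le
    obtain ⟨G, hG, hGc⟩ := exists_blowup' (L := L) F (i' + j') hmin
    have hG₁ : (G.coeff (i₁ - (i' + j'))).coeff 0 ≠ 0 := by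
      rw [hGc, if_pos (by omega)]
      convert h₁ using 3
      omega
    have hG₂ : (G.coeff 0).coeff i' ≠ 0 := by
      rw [hGc, if_pos (by omega)]
      convert hF' using 3
      omega
    obtain ⟨h3, h4⟩ := ih _ (by omega) htpos hy hty G hG₂ hG₁ hG₂ rfl
    rw [hG]
    refine ⟨mul_ne_zero (pow_ne_zero _ hy0) h3, ?_⟩
    rw [h.mul (pow_ne_zero _ hy0) h3, h.pow hy0]
    rw [Nat.cast_sub hm₁] at h4
    rw [hmt] at hlog hx₂ ⊢
    rw [hord] at hlog ⊢
    have h5 : (2 * (1 + ord (B t y) - ord t - ord y) + ord t) * (i' : ℤ) ≤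
        (2 * (1 + ord (B t y) - ord t - ord y) + ord t) * (i' + j' : ℕ) :=
      mul_le_mul_of_nonneg_left (by push_cast; omega) (by omega)
    push_cast at *
    linarith

end IsRegularBracket

end Core

/-! ### From polynomials to elements of a two-dimensional local ring -/

section LocalRing

open Polynomial Polynomial.Bivariate IsLocalRing

variable {k R L : Type*} [Field k] [CommRing R] [IsLocalRing R] [Algebra k R]
  [Field L] [Algebra k L] [Algebra R L] [IsScalarTower k R L]

omit [IsLocalRing R] in
theorem aevalAeval_mem (x y : R) (F : k[X][Y]) (I : Ideal R)
    (hI : ∀ i j, (F.coeff j).coeff i ≠ 0 → x ^ i * y ^ j ∈ I) : aevalAeval x y F ∈ I := by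
  rw [F.as_sum_support_C_mul_X_pow, map_sum]
  refine Ideal.sum_mem _ fun j _ ↦ ?_
  rw [map_mul, map_pow, aevalAeval_C, aevalAeval_Y, aeval_def, eval₂_eq_sum, Polynomial.sum,
    Finset.sum_mul]
  refine Ideal.sum_mem _ fun i hi ↦ ?_
  rw [mul_assoc]
  exact Ideal.mul_mem_left _ _ (hI i j (mem_support_iff.1 hi))

omit [IsLocalRing R] in
theorem aevalAeval_algebraMap (x y : R) (F : k[X][Y]) :
    aevalAeval (algebraMap R L x) (algebraMap R L y) F = algebraMap R L (aevalAeval x y F) := by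
  induction F using Polynomial.induction_on' with
  | add p q hp hq => rw [map_add, map_add, hp, hq, map_add]
  | monomial n f =>
    rw [← C_mul_X_pow_eq_monomial, map_mul, map_mul, map_pow, map_pow, aevalAeval_C, aevalAeval_C,
      aevalAeval_Y, aevalAeval_Y, aeval_algebraMap_apply, map_mul, map_pow]

/-- Elements of a local ring with residue field `k` and maximal ideal `(x, y)` are polynomials in
`x` and `y` to any order. -/
theorem exists_sub_aevalAeval_mem {x y : R} (hm : maximalIdeal R = Ideal.span {x, y})
    (hk : ∀ r : R, ∃ c : k, r - algebraMap k R c ∈ maximalIdeal R) (N : ℕ) (r : R) :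
    ∃ F : k[X][Y], r - aevalAeval x y F ∈ maximalIdeal R ^ N := by
  induction N generalizing r with
  | zero => exact ⟨0, by simp⟩
  | succ N ih =>
    obtain ⟨c, hc⟩ := hk r
    rw [hm, Ideal.mem_span_pair] at hc
    obtain ⟨r₁, r₂, hr⟩ := hc
    obtain ⟨F₁, hF₁⟩ := ih r₁
    obtain ⟨F₂, hF₂⟩ := ih r₂
    refine ⟨C (C c) + C X * F₁ + X * F₂, ?_⟩
    have hx : x ∈ maximalIdeal R := hm ▸ Ideal.subset_span (by simp)
    have hy : y ∈ maximalIdeal R := hm ▸ Ideal.subset_span (by simp)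
    have e : r - aevalAeval x y (C (C c) + C X * F₁ + X * F₂) =
        (r₁ - aevalAeval x y F₁) * x + (r₂ - aevalAeval x y F₂) * y := by
      rw [map_add, map_add, map_mul, map_mul, aevalAeval_X, aevalAeval_Y, aevalAeval_C, aeval_C]
      linear_combination -hr
    rw [e, pow_succ]
    exact Ideal.add_mem _ (Ideal.mul_mem_mul hF₁ hx) (Ideal.mul_mem_mul hF₂ hy)

-- Both generators of the maximal ideal have order at least one. This makes the error of a
-- polynomial approximation negligible along the valuation.
omit [Algebra k R] [IsScalarTower k R L] in
theorem ordGE_of_mem_pow {ord : L → ℤ} (h : IsDiscreteOrder k ord)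
    {x y : R} (hm : maximalIdeal R = Ideal.span {x, y})
    (hR : ∀ r : R, 0 ≤ ord (algebraMap R L r)) (hx : 0 < ord (algebraMap R L x))
    (hy : 0 < ord (algebraMap R L y)) (N : ℕ) {r : R} (hr : r ∈ maximalIdeal R ^ N) :
    OrdGE ord N (algebraMap R L r) := by
  induction N generalizing r with
  | zero => exact_mod_cast h.ordGE_zero_iff.2 (hR r)
  | succ N ih =>
    rw [pow_succ] at hr
    refine Submodule.mul_induction_on hr (fun a ha b hb ↦ ?_) (fun a b ha hb ↦ ?_)
    · rw [map_mul]
      push_cast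
      refine h.ordGE_mul (ih ha) ?_
      rw [hm, Ideal.mem_span_pair] at hb
      obtain ⟨c, d, rfl⟩ := hb
      rw [map_add, map_mul, map_mul]
      refine h.ordGE_add ?_ ?_
      · simpa using h.ordGE_mul (h.ordGE_zero_iff.2 (hR c)) (m := 1) (fun _ ↦ hx)
      · simpa using h.ordGE_mul (h.ordGE_zero_iff.2 (hR d)) (m := 1) (fun _ ↦ hy)
    · rw [map_add]
      exact h.ordGE_add ha hb

/-- The order of an element of a regular local ring of dimension two, bounded in terms of its
multiplicity `μ` and its intersection numbers with the two coordinate curves. -/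
theorem two_mul_ord_le_of_notMem [IsAlgClosed k] {ord : L → ℤ} {B : L →ₗ[k] Derivation k L L}
    (hB : IsRegularBracket ord B) (h : IsDiscreteOrder k ord)
    {x y : R} (hm : maximalIdeal R = Ideal.span {x, y})
    (hk : ∀ r : R, ∃ c : k, r - algebraMap k R c ∈ maximalIdeal R)
    (hR : ∀ r : R, 0 ≤ ord (algebraMap R L r)) (hx : 0 < ord (algebraMap R L x))
    (hy : 0 < ord (algebraMap R L y)) (hxy : B (algebraMap R L x) (algebraMap R L y) ≠ 0)
    (f : R) {μ n₁ n₂ : ℕ} (hμ : f ∉ maximalIdeal R ^ (μ + 1))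
    (hn₁ : f ∉ Ideal.span {x} ⊔ maximalIdeal R ^ (n₁ + 1))
    (hn₂ : f ∉ Ideal.span {y} ⊔ maximalIdeal R ^ (n₂ + 1)) :
    2 * ord (algebraMap R L f) ≤
      2 * (1 + ord (B (algebraMap R L x) (algebraMap R L y)) - ord (algebraMap R L x)
        - ord (algebraMap R L y)) * μ + ord (algebraMap R L y) * n₁
        + ord (algebraMap R L x) * n₂ := by
  set p := ord (algebraMap R L x)
  set q := ord (algebraMap R L y)
  set b := ord (B (algebraMap R L x) (algebraMap R L y))
  set bound := 2 * (1 + b - p - q) * μ + q * n₁ + p * n₂ with hbound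
  have hxm : x ∈ maximalIdeal R := hm ▸ Ideal.subset_span (by simp)
  have hym : y ∈ maximalIdeal R := hm ▸ Ideal.subset_span (by simp)
  have hlog : 0 ≤ 1 + b - p - q := by
    have := hB.ordGE_add_sub_one h (a := algebraMap R L x) (b := algebraMap R L y)
      (by intro h0; simp [p, h0, h.zero] at hx) (by intro h0; simp [q, h0, h.zero] at hy)
      hx.le hy.le hxy
    change p + q - 1 ≤ b at this
    omega
  by_contra! hlt
  have hb0 : 0 ≤ bound := by positivity
  -- The precision exceeds the claimed bound, so `F` violates it if `f` does, and it exceeds `μ`,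
  -- `n₁`, `n₂`, so `F` inherits the three non-membership conditions.
  obtain ⟨F, hF⟩ := exists_sub_aevalAeval_mem (k := k) hm hk
    (bound.toNat + 1 + μ + n₁ + n₂ + 1) f
  have hFm : ∀ {I : Ideal R} {n : ℕ}, n ≤ bound.toNat + 1 + μ + n₁ + n₂ + 1 →
      maximalIdeal R ^ n ≤ I → f ∉ I → aevalAeval x y F ∉ I := by
    intro I n hn hI hf hFI
    refine hf ?_
    rw [← sub_add_cancel f (aevalAeval x y F)]
    exact I.add_mem (hI (Ideal.pow_le_pow_right hn hF)) hFI
  have hxy_mem : ∀ i j n, n ≤ i + j → x ^ i * y ^ j ∈ maximalIdeal R ^ n := by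
    intro i j n hn
    refine Ideal.pow_le_pow_right hn ?_
    rw [pow_add]
    exact Ideal.mul_mem_mul (Ideal.pow_mem_pow hxm _) (Ideal.pow_mem_pow hym _)
  -- If all coefficients of total degree at most `μ` vanished, `F` would lie in the excluded power
  -- of the maximal ideal. The next two steps argue in the same way on each axis.
  obtain ⟨i, j, hij, hc⟩ : ∃ i j, i + j ≤ μ ∧ (F.coeff j).coeff i ≠ 0 := by
    by_contra! H
    refine hFm (by omega) le_rfl hμ (aevalAeval_mem x y F _ fun i j hij ↦ ?_)
    refine hxy_mem _ _ _ ?_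
    by_contra! h1
    exact hij (H i j (by omega))
  obtain ⟨i₁, hi₁, hc₁⟩ : ∃ j, j ≤ n₁ ∧ (F.coeff j).coeff 0 ≠ 0 := by
    by_contra! H
    refine hFm (by omega) le_sup_right hn₁ (aevalAeval_mem x y F _ fun i j hij ↦ ?_)
    rcases Nat.eq_zero_or_pos i with rfl | hi
    · refine Ideal.mem_sup_right (hxy_mem _ _ _ ?_)
      by_contra! h1
      exact hij (H j (by omega))
    · exact Ideal.mem_sup_left (Ideal.mul_mem_right _ _
        (Ideal.pow_mem_of_mem _ (Ideal.mem_span_singleton_self x) _ hi))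
  obtain ⟨i₂, hi₂, hc₂⟩ : ∃ i, i ≤ n₂ ∧ (F.coeff 0).coeff i ≠ 0 := by
    by_contra! H
    refine hFm (by omega) le_sup_right hn₂ (aevalAeval_mem x y F _ fun i j hij ↦ ?_)
    rcases Nat.eq_zero_or_pos j with rfl | hj
    · refine Ideal.mem_sup_right (hxy_mem _ _ _ ?_)
      by_contra! h1
      exact hij (H i (by omega))
    · exact Ideal.mem_sup_left (Ideal.mul_mem_left _ _
        (Ideal.pow_mem_of_mem _ (Ideal.mem_span_singleton_self y) _ hj))
  obtain ⟨hF0, hFle⟩ := hB.two_mul_ord_le h hx hy hxy F hc hc₁ hc₂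
  have e : aevalAeval (algebraMap R L x) (algebraMap R L y) F =
      algebraMap R L (aevalAeval x y F) := aevalAeval_algebraMap x y F
  have hle : 2 * ord (aevalAeval (algebraMap R L x) (algebraMap R L y) F) ≤ bound := by
    refine hFle.trans ?_
    rw [hbound]
    gcongr
  have h1 : OrdGE ord (bound.toNat + 1) (algebraMap R L (f - aevalAeval x y F)) :=
    (ordGE_of_mem_pow h hm hR hx hy _ hF).mono (by push_cast; omega)
  have h2 : 2 * ord (aevalAeval (algebraMap R L x) (algebraMap R L y) F) > bound := by
    -- If `f` maps to zero, its order is zero by convention, and this cannot exceed the non-negative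
    -- bound.
    by_cases hf0 : algebraMap R L f = 0
    · rw [hf0, h.zero] at hlt
      omega
    have h3 : OrdGE ord (min (ord (algebraMap R L f)) (bound.toNat + 1))
        (algebraMap R L f - algebraMap R L (f - aevalAeval x y F)) :=
      h.ordGE_sub (fun _ ↦ min_le_left _ _) (h1.mono (min_le_right _ _))
    rw [← map_sub, sub_sub_cancel, ← e] at h3
    have := h3 hF0
    omega
  omega

end LocalRing

/-! ### Regular parameters cut out by two transversal smooth curves -/

section RegularRing

open IsLocalRing

variable {R : Type*} [CommRing R] [IsLocalRing R]

/-- Nakayama's lemma, in the form in which generators are checked below: inclusion modulo the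
maximal ideal suffices. -/
theorem le_of_le_sup_maximalIdeal_smul [IsNoetherianRing R] {M : Type*} [AddCommGroup M]
    [Module R M] [Module.Finite R M] {N N' : Submodule R M}
    (h : N' ≤ N ⊔ maximalIdeal R • N') : N' ≤ N :=
  Submodule.le_of_le_smul_of_le_jacobson_bot (IsNoetherian.noetherian N')
    (IsLocalRing.jacobson_eq_maximalIdeal ⊥ bot_ne_top).ge h

/-- A prime local quotient with principal maximal ideal is a discrete valuation ring. -/
theorem isDiscreteValuationRing_quotient [IsNoetherianRing R] {I : Ideal R} [I.IsPrime] {y : R}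
    (hI : I ≠ maximalIdeal R) (hy : y ∈ maximalIdeal R) (hm : maximalIdeal R ≤ I ⊔ Ideal.span {y}) :
    IsDiscreteValuationRing (R ⧸ I) := by
  have : IsLocalRing (R ⧸ I) :=
    IsLocalRing.of_surjective' (Ideal.Quotient.mk I) Ideal.Quotient.mk_surjective
  have hmap : (maximalIdeal R).map (Ideal.Quotient.mk I) = maximalIdeal (R ⧸ I) :=
    IsLocalRing.map_maximalIdeal_of_surjective _ Ideal.Quotient.mk_surjective
  have hprin : (maximalIdeal (R ⧸ I)).IsPrincipal := by
    refine ⟨Ideal.Quotient.mk I y, ?_⟩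
    refine le_antisymm ?_ ?_
    · rw [← hmap]
      refine (Ideal.map_mono hm).trans ?_
      rw [Ideal.map_sup, Ideal.map_quotient_self, bot_sup_eq, Ideal.map_span, Set.image_singleton]
    · rw [Ideal.submodule_span_eq, Ideal.span_singleton_le_iff_mem, ← hmap]
      exact Ideal.mem_map_of_mem _ hy
  have hfield : ¬ IsField (R ⧸ I) := by
    intro hf
    have := Ideal.Quotient.maximal_of_isField I hf
    exact hI (eq_maximalIdeal this)
  exact ((IsDiscreteValuationRing.TFAE (R ⧸ I) hfield).out 0 4).2 hprin

/-- Two smooth curves that meet transversally at a smooth point of a surface are the coordinate axes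
of a regular system of parameters. -/
theorem exists_regular_parameters [IsNoetherianRing R] [IsDomain R] {u v : R}
    (hm : maximalIdeal R = Ideal.span {u, v}) {I₁ I₂ : Ideal R} [I₁.IsPrime] [I₂.IsPrime]
    (h₁ : I₁ ≠ ⊥) (h₁' : I₁ ≠ maximalIdeal R) (h₂' : I₂ ≠ maximalIdeal R)
    (hsup : I₁ ⊔ I₂ = maximalIdeal R) (hreg : IsRegularLocalRing (R ⧸ I₁)) :
    ∃ x y : R, I₁ = Ideal.span {x} ∧ I₂ = Ideal.span {y} ∧
      maximalIdeal R = Ideal.span {x, y} := by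
  have hle₁ : I₁ ≤ maximalIdeal R := hsup ▸ le_sup_left
  have hle₂ : I₂ ≤ maximalIdeal R := hsup ▸ le_sup_right
  have hfield : ¬ IsField (R ⧸ I₁) := by
    intro hf
    have := Ideal.Quotient.maximal_of_isField I₁ hf
    exact h₁' (eq_maximalIdeal this)
  have hdvr : IsDiscreteValuationRing (R ⧸ I₁) := by
    refine ((IsDiscreteValuationRing.TFAE (R ⧸ I₁) hfield).out 0 4).2 ?_
    rw [← finrank_cotangentSpace_le_one_iff]
    obtain ⟨a, ha, ha0⟩ := Submodule.exists_mem_ne_zero_of_ne_bot h₁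
    -- Dividing by a non-zero ideal of a domain lowers the dimension, and `R` has dimension at most
    -- two. As the quotient is regular, its cotangent space has dimension at most one.
    have hd : ringKrullDim (R ⧸ I₁) + 1 ≤ ringKrullDim R :=
      ringKrullDim_succ_le_of_surjective (Ideal.Quotient.mk I₁) Ideal.Quotient.mk_surjective
        (mem_nonZeroDivisors_of_ne_zero ha0) (Ideal.Quotient.eq_zero_iff_mem.2 ha)
    have h2 : (maximalIdeal R).spanFinrank ≤ 2 := by
      rw [hm]
      exact (Submodule.spanFinrank_span_le_ncard_of_finite (by simp)).trans
        (Set.ncard_insert_le _ _ |>.trans (by simp))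
    have h3 := hd.trans (ringKrullDim_le_spanFinrank_maximalIdeal R)
    rw [← (IsRegularLocalRing.iff_finrank_cotangentSpace _).1 hreg] at h3
    have h4 := h3.trans (Nat.cast_le.2 h2)
    have h5 : Module.finrank (ResidueField (R ⧸ I₁)) (CotangentSpace (R ⧸ I₁)) + 1 ≤ 2 := by
      exact_mod_cast h4
    exact Nat.le_of_succ_le_succ h5
  obtain ⟨ϖ, hϖ⟩ := IsDiscreteValuationRing.exists_irreducible (R ⧸ I₁)
  have hmap : (maximalIdeal R).map (Ideal.Quotient.mk I₁) = maximalIdeal (R ⧸ I₁) :=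
    IsLocalRing.map_maximalIdeal_of_surjective _ Ideal.Quotient.mk_surjective
  have hmap₂ : I₂.map (Ideal.Quotient.mk I₁) = maximalIdeal (R ⧸ I₁) := by
    rw [← hmap, ← hsup, Ideal.map_sup, Ideal.map_quotient_self, bot_sup_eq]
  -- Transversality says that `I₂` maps onto the maximal ideal of the first curve, so a uniformizer
  -- of that curve lifts to an element of `I₂`.
  obtain ⟨y, hy, hyϖ⟩ := (Ideal.mem_map_iff_of_surjective (Ideal.Quotient.mk I₁)
    Ideal.Quotient.mk_surjective (I := I₂) (y := ϖ)).1
      (by rw [hmap₂, mem_maximalIdeal]; exact hϖ.not_isUnit)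
  have hmy : ∀ r ∈ maximalIdeal R, ∃ s, r - s * y ∈ I₁ := by
    intro r hr
    have : Ideal.Quotient.mk I₁ r ∈ maximalIdeal (R ⧸ I₁) := hmap ▸ Ideal.mem_map_of_mem _ hr
    rw [hϖ.maximalIdeal_eq, Ideal.mem_span_singleton'] at this
    obtain ⟨s, hs⟩ := this
    obtain ⟨s, rfl⟩ := Ideal.Quotient.mk_surjective s
    refine ⟨s, ?_⟩
    rw [← Ideal.Quotient.eq_zero_iff_mem, map_sub, map_mul, hyϖ, hs, sub_self]
  have hysq : y ∉ maximalIdeal R ^ 2 := by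
    intro hy2
    have := Ideal.mem_map_of_mem (Ideal.Quotient.mk I₁) hy2
    rw [Ideal.map_pow, hmap, hϖ.maximalIdeal_eq, Ideal.span_singleton_pow, hyϖ,
      Ideal.mem_span_singleton] at this
    exact hϖ.not_isUnit (isUnit_of_dvd_one (by
      rw [pow_two] at this
      exact (mul_dvd_mul_iff_left hϖ.ne_zero).1 (by simpa using this)))
  have hyI₁ : y ∉ I₁ := by
    intro h0
    rw [Ideal.Quotient.eq_zero_iff_mem.2 h0] at hyϖ
    exact hϖ.ne_zero hyϖ.symm
  -- one of the two given generators can be exchanged for `y`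
  have hex : ∀ u v : R, maximalIdeal R = Ideal.span {u, v} → (∃ α β, IsUnit α ∧ y = α * u + β * v) →
      ∃ x, x ∈ I₁ ∧ maximalIdeal R = Ideal.span {x, y} := by
    rintro u v hm ⟨α, β, ⟨α, rfl⟩, hαβ⟩
    have hv : v ∈ maximalIdeal R := hm ▸ Ideal.subset_span (by simp)
    obtain ⟨r, hr⟩ := hmy v hv
    refine ⟨v - r * y, hr, le_antisymm ?_ ?_⟩
    · have hv' : v ∈ Ideal.span {v - r * y, y} :=
        Ideal.mem_span_pair.2 ⟨1, r, by ring⟩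
      have hy' : y ∈ Ideal.span {v - r * y, y} := Ideal.subset_span (by simp)
      rw [hm, Ideal.span_le]
      rintro a (rfl | rfl)
      · have : a = (↑α⁻¹ : R) * (y - β * v) := by
          rw [hαβ, add_sub_cancel_right, Units.inv_mul_cancel_left]
        rw [this]
        exact Ideal.mul_mem_left _ _ (Ideal.sub_mem _ hy' (Ideal.mul_mem_left _ _ hv'))
      · exact hv'
    · rw [Ideal.span_le]
      rintro a (rfl | rfl)
      · exact hle₁ hr
      · exact hle₂ hy
  obtain ⟨x, hx, hmxy⟩ : ∃ x, x ∈ I₁ ∧ maximalIdeal R = Ideal.span {x, y} := by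
    have hyuv := hle₂ hy
    rw [hm, Ideal.mem_span_pair] at hyuv
    obtain ⟨α, β, hαβ⟩ := hyuv
    by_cases hα : IsUnit α
    · exact hex u v hm ⟨α, β, hα, hαβ.symm⟩
    by_cases hβ : IsUnit β
    · exact hex v u (by rw [hm, Set.pair_comm]) ⟨β, α, hβ, by rw [← hαβ, add_comm]⟩
    refine absurd ?_ hysq
    rw [← hαβ, pow_two]
    exact Ideal.add_mem _
      (Ideal.mul_mem_mul ((mem_maximalIdeal _).2 hα) (hm ▸ Ideal.subset_span (by simp)))
      (Ideal.mul_mem_mul ((mem_maximalIdeal _).2 hβ) (hm ▸ Ideal.subset_span (by simp)))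
  have hxI₂ : x ∉ I₂ := by
    intro h0
    refine h₂' (hle₂.antisymm ?_)
    rw [hmxy, Ideal.span_le]
    rintro a (rfl | rfl)
    exacts [h0, hy]
  -- An element `b x + c y` of `I` forces `c ∈ I`, as `I` is prime and `y ∉ I`. Hence `I` is
  -- contained in `(x)` plus the maximal ideal times `I`, and Nakayama applies.
  have hgen : ∀ (I : Ideal R) [I.IsPrime] (x y : R), maximalIdeal R = Ideal.span {x, y} →
      x ∈ I → y ∉ I → I ≤ maximalIdeal R → I = Ideal.span {x} := by
    intro I _ x y hm hx hy hle
    refine le_antisymm (le_of_le_sup_maximalIdeal_smul fun a ha ↦ ?_)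
      ((Ideal.span_singleton_le_iff_mem _).2 hx)
    have ha' := hle ha
    rw [hm, Ideal.mem_span_pair] at ha'
    obtain ⟨b, c, rfl⟩ := ha'
    refine Submodule.add_mem_sup (Ideal.mul_mem_left _ _ (Ideal.mem_span_singleton_self x)) ?_
    have hcy : c * y ∈ I := by
      have := I.sub_mem ha (I.mul_mem_left b hx)
      rwa [add_sub_cancel_left] at this
    rw [mul_comm c y]
    exact Ideal.mul_mem_mul (hm ▸ Ideal.subset_span (by simp))
      ((Ideal.IsPrime.mem_or_mem ‹_› hcy).resolve_right hy)
  exact ⟨x, y, hgen I₁ x y hmxy hx hyI₁ hle₁,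
    hgen I₂ y x (by rw [hmxy, Set.pair_comm]) hy hxI₂ hle₂, hmxy⟩

end RegularRing

/-! ### Multiplicity and intersection number as non-membership conditions -/

section Multiplicities

open IsLocalRing

variable {R : Type*} [CommRing R] [IsLocalRing R]

/-- By Krull's intersection theorem the set of exponents is bounded, so the supremum is a true
maximum and not the default value for an unbounded set. -/
theorem notMem_pow_sSup_add_one [IsNoetherianRing R] [IsDomain R] {f : R} (hf : f ≠ 0) :
    f ∉ maximalIdeal R ^ (sSup {n : ℕ | Ideal.span {f} ≤ maximalIdeal R ^ n} + 1) := by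
  have hbdd : BddAbove {n : ℕ | Ideal.span {f} ≤ maximalIdeal R ^ n} := by
    by_contra hb
    rw [not_bddAbove_iff] at hb
    refine hf ?_
    have hkrull := Ideal.iInf_pow_eq_bot_of_isLocalRing (maximalIdeal R)
      (maximalIdeal.isMaximal R).ne_top
    rw [← Ideal.mem_bot, ← hkrull, Ideal.mem_iInf]
    intro n
    obtain ⟨m, hm, hlt⟩ := hb n
    exact Ideal.pow_le_pow_right hlt.le ((Ideal.span_singleton_le_iff_mem _).1 hm)
  intro hmem
  have := le_csSup hbdd (a := sSup {n : ℕ | Ideal.span {f} ≤ maximalIdeal R ^ n} + 1)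
    ((Ideal.span_singleton_le_iff_mem _).2 hmem)
  omega

/-- The intersection number of `f` with a smooth curve `I` is the order of vanishing of `f` on this
curve. -/
theorem exists_length_eq {I : Ideal R} [I.IsPrime] [IsDiscreteValuationRing (R ⧸ I)]
    {f : R} (hf : f ∉ I) : ∃ n : ℕ, Module.length R (R ⧸ (Ideal.span {f} ⊔ I)) = n ∧
      f ∉ I ⊔ maximalIdeal R ^ (n + 1) := by
  have hf0 : Ideal.Quotient.mk I f ≠ 0 := fun h ↦ hf (Ideal.Quotient.eq_zero_iff_mem.1 h)
  have hsurj : Function.Surjective (Ideal.Quotient.mk I) := Ideal.Quotient.mk_surjective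
  obtain ⟨n, hn⟩ := exists_maximalIdeal_pow_eq_of_principal (R ⧸ I)
    (IsPrincipalIdealRing.principal _) (Ideal.span {Ideal.Quotient.mk I f})
    (by simpa using hf0)
  -- The image of `f` in the discrete valuation ring generates the `n`-th power of the maximal
  -- ideal. The length of the quotient is the coheight of this ideal, which is `n`.
  have hcomap : Ideal.span {f} ⊔ I =
      (maximalIdeal (R ⧸ I) ^ n).comap (Ideal.Quotient.mk I) := by
    rw [← hn, ← Set.image_singleton, ← Ideal.map_span, Ideal.comap_map_of_surjective _ hsurj,
      ← RingHom.ker_eq_comap_bot, Ideal.mk_ker]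
  refine ⟨n, ?_, fun hmem ↦ ?_⟩
  · rw [Module.length_quotient, hcomap]
    exact (Ideal.coheight_comap_of_surjective _ hsurj _).trans
      (IsDiscreteValuationRing.coheight_pow_maximalIdeal _ n)
  · have h1 := Ideal.mem_map_of_mem (Ideal.Quotient.mk I) hmem
    rw [Ideal.map_sup, Ideal.map_quotient_self, bot_sup_eq, Ideal.map_pow,
      IsLocalRing.map_maximalIdeal_of_surjective _ hsurj] at h1
    have h2 : maximalIdeal (R ⧸ I) ^ n ≤ maximalIdeal (R ⧸ I) ^ (n + 1) := by
      rw [← hn, Ideal.span_singleton_le_iff_mem]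
      exact h1
    have h3 := IsDiscreteValuationRing.coheight_pow_maximalIdeal (R ⧸ I) (n + 1)
    rw [le_antisymm h2 (Ideal.pow_le_pow_right (Nat.le_succ n)) |>.symm,
      IsDiscreteValuationRing.coheight_pow_maximalIdeal] at h3
    norm_cast at h3
    omega

end Multiplicities

/-! ### Factoriality of the local ring -/

section Factorial

open IsLocalRing

variable {R : Type*} [CommRing R] [IsLocalRing R] [IsNoetherianRing R]

/-- In a local ring with a smooth principal curve `x = 0`, every prime ideal except possibly the
maximal ideal is principal. -/
theorem isPrincipal_of_isPrime {x : R} [(Ideal.span {x}).IsPrime]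
    [IsDiscreteValuationRing (R ⧸ Ideal.span {x})] (p : Ideal R) [hp : p.IsPrime]
    (hpm : p ≠ maximalIdeal R) : ∃ f, p = Ideal.span {f} := by
  have hsurj : Function.Surjective (Ideal.Quotient.mk (Ideal.span {x})) :=
    Ideal.Quotient.mk_surjective
  -- If `x ∈ p`, the image of `p` in the discrete valuation ring is prime, hence zero or maximal;
  -- the latter is excluded.
  by_cases hx : x ∈ p
  · refine ⟨x, ?_⟩
    have hle : Ideal.span {x} ≤ p := (Ideal.span_singleton_le_iff_mem _).2 hx
    have hprime : (p.map (Ideal.Quotient.mk (Ideal.span {x}))).IsPrime :=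
      Ideal.map_isPrime_of_surjective hsurj (by simpa using hle)
    have hcm : (p.map (Ideal.Quotient.mk (Ideal.span {x}))).comap
        (Ideal.Quotient.mk (Ideal.span {x})) = p := by
      rw [Ideal.comap_map_of_surjective _ hsurj, ← RingHom.ker_eq_comap_bot, Ideal.mk_ker,
        sup_eq_left.2 hle]
    by_cases hbot : p.map (Ideal.Quotient.mk (Ideal.span {x})) = ⊥
    · rw [← hcm, hbot, ← RingHom.ker_eq_comap_bot, Ideal.mk_ker]
    · have hmax := hprime.isMaximal hbot
      have := Ideal.comap_isMaximal_of_surjective _ hsurj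
        (K := p.map (Ideal.Quotient.mk (Ideal.span {x})))
      rw [hcm] at this
      exact absurd (eq_maximalIdeal this) hpm
  -- Otherwise lift a generator of the image of `p` to `f ∈ p`. An element of `p` is `c f + x d`;
  -- since `x ∉ p`, also `d ∈ p`, and Nakayama gives `p = (f)`.
  · obtain ⟨g, hg⟩ := (IsPrincipalIdealRing.principal
      (p.map (Ideal.Quotient.mk (Ideal.span {x})))).principal
    have hg' : g ∈ p.map (Ideal.Quotient.mk (Ideal.span {x})) :=
      hg ▸ Submodule.mem_span_singleton_self g
    obtain ⟨f, hf, rfl⟩ := (Ideal.mem_map_iff_of_surjective _ hsurj).1 hg'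
    have hxm : x ∈ maximalIdeal R :=
      le_maximalIdeal (Ideal.IsPrime.ne_top ‹(Ideal.span {x}).IsPrime›)
        (Ideal.mem_span_singleton_self x)
    refine ⟨f, le_antisymm (le_of_le_sup_maximalIdeal_smul fun a ha ↦ ?_)
      ((Ideal.span_singleton_le_iff_mem _).2 hf)⟩
    have h1 := Ideal.mem_map_of_mem (Ideal.Quotient.mk (Ideal.span {x})) ha
    rw [hg, Submodule.mem_span_singleton] at h1
    obtain ⟨c, hc⟩ := h1
    obtain ⟨c, rfl⟩ := hsurj c
    rw [smul_eq_mul, ← map_mul, eq_comm, Ideal.Quotient.eq, Ideal.mem_span_singleton] at hc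
    obtain ⟨d, hd⟩ := hc
    have ha' : a = c * f + x * d := by linear_combination hd
    have hxd : x * d ∈ p := by
      rw [← hd]
      exact p.sub_mem ha (p.mul_mem_left _ hf)
    rw [ha']
    exact Submodule.add_mem_sup (Ideal.mul_mem_left _ _ (Ideal.mem_span_singleton_self f))
      (Ideal.mul_mem_mul hxm ((hp.mem_or_mem hxd).resolve_left hx))

/-- Kaplansky's criterion: every non-zero prime ideal contains a prime element, namely `x` or its
own generator. -/
theorem uniqueFactorizationMonoid_of_smooth_curve [IsDomain R] {x : R} (hx : x ≠ 0)
    [hxp : (Ideal.span {x}).IsPrime] [IsDiscreteValuationRing (R ⧸ Ideal.span {x})] :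
    UniqueFactorizationMonoid R := by
  rw [UniqueFactorizationMonoid.iff_exists_prime_mem_of_isPrime]
  intro I hI hIp
  by_cases hxI : x ∈ I
  · exact ⟨x, hxI, (Ideal.span_singleton_prime hx).1 hxp⟩
  · have hIm : I ≠ maximalIdeal R := by
      rintro rfl
      exact hxI (le_maximalIdeal hxp.ne_top (Ideal.mem_span_singleton_self x))
    obtain ⟨f, rfl⟩ := isPrincipal_of_isPrime (x := x) I hIm
    have hf : f ≠ 0 := by rintro rfl; simp at hI
    exact ⟨f, Ideal.mem_span_singleton_self f, (Ideal.span_singleton_prime hf).1 hIp⟩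

end Factorial

/-! ### Differentials and two-forms -/

section Wedge

variable (k : Type u) {K : Type u} [Field k] [Field K] [Algebra k K]

/-- The wedge product of one-forms, as a bilinear map. -/
def wedge : KaehlerDifferential k K →ₗ[K] KaehlerDifferential k K →ₗ[K] TwoForm k K :=
  LinearMap.mk₂ K (fun u v ↦ exteriorPower.ιMulti K 2 ![u, v])
    (fun u₁ u₂ v ↦ by simpa using (exteriorPower.ιMulti K 2).map_vecCons_add ![v] u₁ u₂)
    (fun c u v ↦ by simpa using (exteriorPower.ιMulti K 2).map_vecCons_smul ![v] c u)
    (fun u v₁ v₂ ↦ by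
      have e : ∀ v : KaehlerDifferential k K, ![u, v] = Function.update ![u, 0] 1 v := by
        intro v; ext i; fin_cases i <;> simp
      rw [e (v₁ + v₂), e v₁, e v₂]
      exact (exteriorPower.ιMulti K 2).map_update_add _ _ _ _)
    (fun c u v ↦ by
      have e : ∀ v : KaehlerDifferential k K, ![u, v] = Function.update ![u, 0] 1 v := by
        intro v; ext i; fin_cases i <;> simp
      rw [e (c • v), e v]
      exact (exteriorPower.ιMulti K 2).map_update_smul _ _ _ _)

theorem wedge_self (u : KaehlerDifferential k K) : wedge k u u = 0 :=
  (exteriorPower.ιMulti K 2).map_eq_zero_of_eq ![u, u] (i := 0) (j := 1) rfl (by decide)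

theorem wedge_swap (u v : KaehlerDifferential k K) : wedge k u v = -wedge k v u := by
  have := wedge_self k (u + v)
  simp only [map_add, LinearMap.add_apply, wedge_self, zero_add, add_zero] at this
  exact eq_neg_of_add_eq_zero_right this

theorem dWedge_eq_wedge (a b : K) :
    dWedge k a b = wedge k (KaehlerDifferential.D k K a) (KaehlerDifferential.D k K b) := rfl

theorem wedge_combination (e₁ e₂ : KaehlerDifferential k K) (a₁ a₂ b₁ b₂ : K) :
    wedge k (a₁ • e₁ + a₂ • e₂) (b₁ • e₁ + b₂ • e₂) = (a₁ * b₂ - a₂ * b₁) • wedge k e₁ e₂ := by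
  simp only [map_add, map_smul, LinearMap.add_apply, LinearMap.smul_apply, wedge_self, smul_zero,
    zero_add, add_zero]
  rw [wedge_swap k e₂ e₁]
  module

theorem span_wedge_eq_top :
    Submodule.span K (Set.range fun p : KaehlerDifferential k K × KaehlerDifferential k K ↦
      wedge k p.1 p.2) = ⊤ := by
  rw [eq_top_iff, ← exteriorPower.ιMulti_span K 2 (KaehlerDifferential k K), Submodule.span_le]
  rintro _ ⟨v, rfl⟩
  refine Submodule.subset_span ⟨(v 0, v 1), ?_⟩
  change exteriorPower.ιMulti K 2 ![v 0, v 1] = _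
  congr 1
  ext i
  fin_cases i <;> rfl

theorem exists_eq_smul_wedge {e₁ e₂ : KaehlerDifferential k K}
    (he : ∀ u, ∃ a b : K, u = a • e₁ + b • e₂) (θ : TwoForm k K) :
    ∃ c : K, θ = c • wedge k e₁ e₂ := by
  have hθ : θ ∈ Submodule.span K (Set.range fun p : KaehlerDifferential k K ×
      KaehlerDifferential k K ↦ wedge k p.1 p.2) := by
    rw [span_wedge_eq_top]; trivial
  induction hθ using Submodule.span_induction with
  | mem θ h =>
    obtain ⟨⟨u, v⟩, rfl⟩ := h
    obtain ⟨a₁, a₂, rfl⟩ := he u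
    obtain ⟨b₁, b₂, rfl⟩ := he v
    exact ⟨_, wedge_combination k e₁ e₂ a₁ a₂ b₁ b₂⟩
  | zero => exact ⟨0, by simp⟩
  | add θ₁ θ₂ _ _ h₁ h₂ =>
    obtain ⟨c₁, rfl⟩ := h₁
    obtain ⟨c₂, rfl⟩ := h₂
    exact ⟨c₁ + c₂, by rw [add_smul]⟩
  | smul a θ _ h =>
    obtain ⟨c, rfl⟩ := h
    exact ⟨a * c, by rw [mul_smul]⟩

end Wedge

/-! ### Differentials of a local ring in terms of two parameters -/

section LocalDifferentials

open IsLocalRing KaehlerDifferential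

variable {k R : Type*} [Field k] [CommRing R] [IsLocalRing R] [Algebra k R]

/-- Modulo the maximal ideal, `d (a x + b y)` is `a dx + b dy`, and every element is a constant plus
such a combination. As the module of differentials is finite, Nakayama concludes. -/
theorem exists_D_eq [IsNoetherianRing R] [Algebra.EssFiniteType k R] {x y : R}
    (hm : maximalIdeal R = Ideal.span {x, y})
    (hk : ∀ r : R, ∃ c : k, r - algebraMap k R c ∈ maximalIdeal R) (ω : Ω[R⁄k]) :
    ∃ a b : R, ω = a • D k R x + b • D k R y := by
  have key : (⊤ : Submodule R Ω[R⁄k]) ≤ Submodule.span R {D k R x, D k R y} := by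
    refine le_of_le_sup_maximalIdeal_smul ?_
    rw [← span_range_derivation k R, Submodule.span_le]
    rintro _ ⟨r, rfl⟩
    obtain ⟨c, hc⟩ := hk r
    have hD : D k R r = D k R (r - algebraMap k R c) := by
      rw [map_sub, Derivation.map_algebraMap, sub_zero]
    rw [hD]
    have hc' := hc
    rw [hm, Ideal.mem_span_pair] at hc
    obtain ⟨a, b, hab⟩ := hc
    rw [← hab, map_add, Derivation.leibniz, Derivation.leibniz,
      show ∀ p q r s : Ω[R⁄k], p + q + (r + s) = (p + r) + (q + s) by intros; abel]
    refine Submodule.add_mem_sup (Submodule.mem_span_pair.2 ⟨a, b, rfl⟩) ?_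
    rw [span_range_derivation]
    exact Submodule.add_mem _
      (Submodule.smul_mem_smul (hm ▸ Ideal.subset_span (by simp)) trivial)
      (Submodule.smul_mem_smul (hm ▸ Ideal.subset_span (by simp)) trivial)
  obtain ⟨a, b, h⟩ := Submodule.mem_span_pair.1 (key (Submodule.mem_top : ω ∈ ⊤))
  exact ⟨a, b, h.symm⟩

variable {L : Type*} [Field L] [Algebra k L] [Algebra R L] [IsScalarTower k R L]

theorem exists_D_algebraMap_eq [IsNoetherianRing R] [Algebra.EssFiniteType k R] {x y : R}
    (hm : maximalIdeal R = Ideal.span {x, y})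
    (hk : ∀ r : R, ∃ c : k, r - algebraMap k R c ∈ maximalIdeal R) (r : R) :
    ∃ a b : R, D k L (algebraMap R L r) = algebraMap R L a • D k L (algebraMap R L x) +
      algebraMap R L b • D k L (algebraMap R L y) := by
  obtain ⟨a, b, hab⟩ := exists_D_eq hm hk (D k R r)
  refine ⟨a, b, ?_⟩
  have := congrArg (KaehlerDifferential.map k k R L) hab
  simpa only [map_add, map_smul, KaehlerDifferential.map_D, algebraMap_smul] using this

omit [IsLocalRing R] [Algebra k R] [IsScalarTower k R L] in
/-- The differential of a fraction. -/
theorem D_div_eq (x y : L) {r s : L} {a b c d : R}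
    (hr : D k L r = algebraMap R L a • D k L x + algebraMap R L b • D k L y)
    (hs : D k L s = algebraMap R L c • D k L x + algebraMap R L d • D k L y) :
    D k L (r / s) = ((s * algebraMap R L a - r * algebraMap R L c) / s ^ 2) • D k L x +
      ((s * algebraMap R L b - r * algebraMap R L d) / s ^ 2) • D k L y := by
  rw [Derivation.leibniz_div, hr, hs, div_eq_mul_inv, div_eq_mul_inv, inv_pow]
  module

end LocalDifferentials

/-! ### The canonical generator at a divisor and its bracket -/

section Generator

open KaehlerDifferential

variable {k V L : Type u} [Field k] [CommRing V] [Field L] [Algebra k V] [Algebra k L] [Algebra V L]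
  [IsScalarTower k V L]

omit [Algebra k V] [IsScalarTower k V L] in
theorem exists_forall_ordGE {ord : L → ℤ} {ι : Type*} [Finite ι] (c : ι → L) :
    ∃ N : ℤ, ∀ i, OrdGE ord N (c i) := by
  obtain ⟨N, hN⟩ := (Set.finite_range fun i ↦ ord (c i)).bddBelow
  exact ⟨N, fun i _ ↦ hN ⟨i, rfl⟩⟩

/-- The regular two-forms on a discrete valuation ring of a function field form a free module of
rank one. -/
theorem exists_regularTwoForms_eq_span [Algebra.EssFiniteType k V] {ord : L → ℤ}
    (h : IsDiscreteOrder k ord) (hV : ∀ a : L, 0 ≤ ord a ↔ a ∈ Set.range (algebraMap V L))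
    {θ₀ : TwoForm k L} (hθ₀ : ∀ θ : TwoForm k L, ∃ c : L, θ = c • θ₀)
    (hθ₀' : θ₀ ≠ 0) (hmem : θ₀ ∈ regularTwoForms k V L) :
    ∃ η : TwoForm k L, regularTwoForms k V L = Submodule.span V {η} := by
  obtain ⟨n, e, he⟩ := Module.Finite.exists_fin (R := V) (M := Ω[V⁄k])
  set e' : Fin n → Ω[L⁄k] := fun i ↦ KaehlerDifferential.map k k V L (e i)
  choose c hc using fun p : Fin n × Fin n ↦ hθ₀ (wedge k (e' p.1) (e' p.2))
  -- The differentials of `V` are finitely generated, so the pole orders of regular two-forms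
  -- relative to `θ₀` are bounded.
  obtain ⟨N, hN⟩ := exists_forall_ordGE (ord := ord) c
  have hVge : ∀ v : V, OrdGE ord 0 (algebraMap V L v) :=
    fun v ↦ h.ordGE_zero_iff.2 ((hV _).2 ⟨v, rfl⟩)
  have hD : ∀ a : V, ∃ f : Fin n → V, D k L (algebraMap V L a) = ∑ i, algebraMap V L (f i) • e' i := by
    intro a
    have ha : D k V a ∈ Submodule.span V (Set.range e) := he ▸ Submodule.mem_top
    obtain ⟨f, hf⟩ := (Submodule.mem_span_range_iff_exists_fun V).1 ha
    refine ⟨f, ?_⟩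
    have := congrArg (KaehlerDifferential.map k k V L) hf
    rw [KaehlerDifferential.map_D, map_sum] at this
    rw [← this]
    simp only [map_smul, algebraMap_smul, e']
  have hreg : ∀ θ ∈ regularTwoForms k V L, ∃ c : L, θ = c • θ₀ ∧ OrdGE ord N c := by
    intro θ hθ
    induction hθ using Submodule.span_induction with
    | mem θ hθ =>
      obtain ⟨a, b, rfl⟩ := hθ
      obtain ⟨f, hf⟩ := hD a
      obtain ⟨g, hg⟩ := hD b
      refine ⟨∑ i, ∑ j, algebraMap V L (f i) * (algebraMap V L (g j) * c (i, j)), ?_, ?_⟩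
      · rw [dWedge_eq_wedge, hf, hg]
        simp only [map_sum, LinearMap.sum_apply, map_smul, LinearMap.smul_apply, Finset.sum_smul]
        rw [Finset.sum_comm]
        refine Finset.sum_congr rfl fun i _ ↦ ?_
        rw [Finset.smul_sum]
        refine Finset.sum_congr rfl fun j _ ↦ ?_
        rw [hc (j, i), smul_smul, smul_smul]
        congr 1
        ring
      · have hsum : ∀ (t : Finset (Fin n)) (F : Fin n → L), (∀ i, OrdGE ord N (F i)) →
            OrdGE ord N (∑ i ∈ t, F i) := by
          classical
          intro t F hF
          induction t using Finset.induction_on with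
          | empty => intro h0; simp at h0
          | insert i t hi ih => rw [Finset.sum_insert hi]; exact h.ordGE_add (hF i) ih
        refine hsum _ _ fun i ↦ hsum _ _ fun j ↦ ?_
        simpa using h.ordGE_mul (hVge (f i)) (h.ordGE_mul (hVge (g j)) (hN (i, j)))
    | zero => exact ⟨0, by simp, fun h0 ↦ absurd rfl h0⟩
    | add θ₁ θ₂ _ _ h₁ h₂ =>
      obtain ⟨c₁, rfl, h₁⟩ := h₁
      obtain ⟨c₂, rfl, h₂⟩ := h₂
      exact ⟨c₁ + c₂, by rw [add_smul], h.ordGE_add h₁ h₂⟩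
    | smul v θ _ hθ =>
      obtain ⟨c, rfl, hc⟩ := hθ
      refine ⟨algebraMap V L v * c, by rw [mul_smul, algebraMap_smul], ?_⟩
      simpa using h.ordGE_mul (hVge v) hc
  have hinj : ∀ {a b : L}, a • θ₀ = b • θ₀ → a = b := fun hab ↦ smul_left_injective L hθ₀' hab
  -- A regular form of least order generates: the quotient of any other coefficient by `c₀` has
  -- non-negative order and so lies in `V`.
  obtain ⟨o, ⟨c₀, hc₀, hc₀mem, ho⟩, hmin⟩ := Int.exists_least_of_bdd
    (P := fun z ↦ ∃ c : L, c ≠ 0 ∧ c • θ₀ ∈ regularTwoForms k V L ∧ ord c = z)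
    ⟨N, by
      rintro z ⟨c, hc, hmem, rfl⟩
      obtain ⟨c', hc', hge⟩ := hreg _ hmem
      rw [hinj hc'] at hc ⊢
      exact hge hc⟩
    ⟨ord 1, 1, one_ne_zero, by simpa using hmem, rfl⟩
  refine ⟨c₀ • θ₀, le_antisymm (fun θ hθ ↦ ?_)
    ((Submodule.span_singleton_le_iff_mem _ _).2 hc₀mem)⟩
  obtain ⟨c, rfl, -⟩ := hreg θ hθ
  rcases eq_or_ne c 0 with rfl | hc0
  · simp
  have hle := hmin (ord c) ⟨c, hc0, hθ, rfl⟩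
  obtain ⟨v, hv⟩ := (hV (c / c₀)).1 (by rw [h.div hc0 hc₀]; omega)
  refine Submodule.mem_span_singleton.2 ⟨v, ?_⟩
  rw [← algebraMap_smul L v, hv, smul_smul, div_mul_cancel₀ _ hc₀]

/-- The bracket determined by a non-zero two-form `η`: `da ∧ db = {a, b} η`. -/
theorem exists_bracket {η : TwoForm k L} (hη : η ≠ 0) (hgen : ∀ θ : TwoForm k L, ∃ c : L, θ = c • η) :
    ∃ B : L →ₗ[k] Derivation k L L, ∀ a b, dWedge k a b = B a b • η := by
  -- Two-forms are a line spanned by `η`, so `da ∧ d(·)` becomes a derivation of `L` after dividing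
  -- by `η`.
  let ε : L ≃ₗ[L] TwoForm k L := LinearEquiv.ofBijective (LinearMap.toSpanSingleton L _ η)
    ⟨smul_left_injective L hη, fun θ ↦ (hgen θ).imp fun c hc ↦ hc.symm⟩
  refine ⟨{ toFun := fun a ↦ (ε.symm.toLinearMap.comp (wedge k (D k L a))).compDer (D k L)
            map_add' := fun a b ↦ by ext c; simp
            map_smul' := fun r a ↦ by
              ext c
              have := ε.symm.map_smul (algebraMap k L r) (wedge k (D k L a) (D k L c))
              simpa [algebraMap_smul, Algebra.smul_def] using this }, fun a b ↦ ?_⟩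
  have : ε (ε.symm (dWedge k a b)) = dWedge k a b := ε.apply_symm_apply _
  exact this.symm

theorem isRegularBracket_of_regularTwoForms {ord : L → ℤ}
    (hV : ∀ a : L, 0 ≤ ord a ↔ a ∈ Set.range (algebraMap V L)) {η : TwoForm k L} (hη : η ≠ 0)
    (hreg : regularTwoForms k V L = Submodule.span V {η}) {B : L →ₗ[k] Derivation k L L}
    (hB : ∀ a b, dWedge k a b = B a b • η) : IsRegularBracket ord B where
  alt a := by
    have := hB a a
    rw [dWedge_eq_wedge, wedge_self, eq_comm, smul_eq_zero] at this
    exact this.resolve_right hη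
  regular a b ha hb := by
    obtain ⟨a, rfl⟩ := (hV a).1 ha
    obtain ⟨b, rfl⟩ := (hV b).1 hb
    have hmem : dWedge k (algebraMap V L a) (algebraMap V L b) ∈ regularTwoForms k V L :=
      Submodule.subset_span ⟨a, b, rfl⟩
    rw [hreg, Submodule.mem_span_singleton] at hmem
    obtain ⟨v, hv⟩ := hmem
    rw [hB, ← algebraMap_smul L v] at hv
    rw [← smul_left_injective L hη hv]
    exact (hV _).2 ⟨v, rfl⟩

end Generator

/-! ### Rank of differentials and embedding dimension -/

section Dimension

open IsLocalRing KaehlerDifferential TensorProduct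

/-- Going up lifts a chain of primes of `A` to a chain of the same length in `B`. -/
theorem ringKrullDim_le_of_isIntegral (A B : Type*) [CommRing A] [CommRing B] [Algebra A B]
    [Algebra.IsIntegral A B] [FaithfulSMul A B] [Nontrivial A] : ringKrullDim A ≤ ringKrullDim B := by
  refine iSup_le fun l ↦ ?_
  obtain ⟨Q, -, hQ, hQl⟩ := Ideal.exists_ideal_over_prime_of_isIntegral l.head.asIdeal (⊥ : Ideal B)
    (by
      rw [← RingHom.ker_eq_comap_bot, (RingHom.injective_iff_ker_eq_bot _).1
        (FaithfulSMul.algebraMap_injective A B)]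
      exact bot_le)
  have : Q.LiesOver l.head.asIdeal := ⟨hQl.symm⟩
  obtain ⟨l', hl', -⟩ := Ideal.exists_ltSeries_of_hasGoingUp l Q
  rw [← hl']
  exact Order.LTSeries.length_le_krullDim l'

/-- The rank of the module of differentials of an affine variety is at most its dimension. -/
theorem finrank_kaehlerDifferential_le (k A K : Type*) [Field k] [CharZero k] [CommRing A]
    [IsDomain A] [Algebra k A] [Algebra.FiniteType k A] [Field K] [Algebra A K] [IsFractionRing A K]
    [Algebra k K] [IsScalarTower k A K] {d : ℕ} (hd : ringKrullDim A ≤ d) :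
    Module.finrank K Ω[K⁄k] ≤ d := by
  -- Noether normalization. In characteristic zero `K` is separable algebraic over the field of
  -- rational functions, so the differentials of the `s ≤ d` coordinates span.
  obtain ⟨s, g, hg, hfin⟩ := exists_finite_inj_algHom_of_fg k A
  algebraize [g.toRingHom]
  let _ : Algebra (MvPolynomial (Fin s) k) K :=
    ((algebraMap A K).comp (algebraMap (MvPolynomial (Fin s) k) A)).toAlgebra
  have : IsScalarTower (MvPolynomial (Fin s) k) A K := IsScalarTower.of_algebraMap_eq fun _ ↦ rfl
  have : IsScalarTower k (MvPolynomial (Fin s) k) K :=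
    IsScalarTower.of_algebraMap_eq fun r ↦ by
      rw [IsScalarTower.algebraMap_apply k A K]
      exact congrArg (algebraMap A K) (g.commutes r).symm
  have : FaithfulSMul (MvPolynomial (Fin s) k) A :=
    (faithfulSMul_iff_algebraMap_injective _ _).2 hg
  have : FaithfulSMul (MvPolynomial (Fin s) k) K :=
    (faithfulSMul_iff_algebraMap_injective _ _).2 ((IsFractionRing.injective A K).comp hg)
  have : Module.Finite (MvPolynomial (Fin s) k) A := hfin
  have hs : s ≤ d := by
    have := (ringKrullDim_le_of_isIntegral (MvPolynomial (Fin s) k) A).trans hd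
    rw [MvPolynomial.ringKrullDim_of_isNoetherianRing, ringKrullDim_eq_zero_of_field, zero_add,
      Nat.card_eq_fintype_card, Fintype.card_fin] at this
    exact_mod_cast this
  let F := FractionRing (MvPolynomial (Fin s) k)
  let _ : Algebra F K := FractionRing.liftAlgebra _ K
  have : IsScalarTower (MvPolynomial (Fin s) k) F K := inferInstance
  have : Algebra.IsAlgebraic F K := isAlgebraic_of_isFractionRing (MvPolynomial (Fin s) k) A F K
  have : CharZero F := charZero_of_injective_algebraMap (FaithfulSMul.algebraMap_injective k F)
  have : Algebra.FormallyUnramified F K := Algebra.FormallyUnramified.of_isSeparable F K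
  have : Algebra.FormallyUnramified (MvPolynomial (Fin s) k) F :=
    Algebra.FormallyUnramified.of_isLocalization (nonZeroDivisors (MvPolynomial (Fin s) k))
  have : Algebra.FormallyUnramified (MvPolynomial (Fin s) k) K :=
    Algebra.FormallyUnramified.comp _ F K
  have hsurj : Function.Surjective (mapBaseChange k (MvPolynomial (Fin s) k) K) := by
    intro ω
    rw [← Set.mem_range, ← LinearMap.coe_range, SetLike.mem_coe, range_mapBaseChange,
      LinearMap.mem_ker]
    exact Subsingleton.elim _ _
  have hfree : Module.finrank K (K ⊗[MvPolynomial (Fin s) k] Ω[MvPolynomial (Fin s) k⁄k]) = s := by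
    rw [Module.finrank_eq_card_basis ((mvPolynomialBasis k (Fin s)).baseChange K), Fintype.card_fin]
  have : Module.Finite K (K ⊗[MvPolynomial (Fin s) k] Ω[MvPolynomial (Fin s) k⁄k]) :=
    Module.Finite.of_basis ((mvPolynomialBasis k (Fin s)).baseChange K)
  exact ((LinearMap.finrank_le_finrank_of_surjective hsurj).trans hfree.le).trans hs

/-- The module of differentials of a smooth local ring is free of the expected rank. -/
theorem exists_span_eq_top_of_formallySmooth (k R K : Type*) [Field k] [CommRing R] [IsDomain R]
    [IsLocalRing R] [Algebra k R] [Algebra.EssFiniteType k R] [Algebra.FormallySmooth k R] [Field K]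
    [Algebra R K] [IsFractionRing R K] [Algebra k K] [IsScalarTower k R K]
    (h2 : Module.finrank K Ω[K⁄k] ≤ 2) :
    ∃ e₁ e₂ : Ω[R⁄k], ∀ ω : Ω[R⁄k], ∃ a b : R, ω = a • e₁ + b • e₂ := by
  -- Formal smoothness makes the finite module of differentials projective, hence free over a local
  -- ring; its rank can be read off at the generic point.
  have : Module.Free R Ω[R⁄k] := Module.free_of_flat_of_isLocalRing
  have hrank : Module.finrank R Ω[R⁄k] ≤ 2 := by
    rw [IsLocalization.finrank_eq K (p := nonZeroDivisors R) le_rfl,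
      IsLocalizedModule.finrank_eq (nonZeroDivisors R) (KaehlerDifferential.map k k R K) le_rfl] at h2
    exact h2
  let b := Module.finBasis R Ω[R⁄k]
  set n := Module.finrank R Ω[R⁄k]
  let e : ℕ → Ω[R⁄k] := fun i ↦ if h : i < n then b ⟨i, h⟩ else 0
  refine ⟨e 0, e 1, fun ω ↦ ?_⟩
  have hω : ω ∈ Submodule.span R (Set.range b) := by rw [b.span_eq]; trivial
  suffices Submodule.span R (Set.range b) ≤ Submodule.span R {e 0, e 1} by
    obtain ⟨a, c, h⟩ := Submodule.mem_span_pair.1 (this hω)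
    exact ⟨a, c, h.symm⟩
  rw [Submodule.span_le]
  rintro _ ⟨⟨i, hi⟩, rfl⟩
  have hi' : i = 0 ∨ i = 1 := by omega
  have hb : b ⟨i, hi⟩ = e i := by simp [e, hi]
  rw [hb]
  rcases hi' with rfl | rfl <;> exact Submodule.subset_span (by simp)

/-- If the differentials of a local ring with residue field `k` are generated by two elements, then
so is its maximal ideal. -/
theorem exists_maximalIdeal_eq_span_pair (k R : Type*) [Field k] [CommRing R] [IsLocalRing R]
    [IsNoetherianRing R] [Algebra k R] (hk : ∀ r : R, ∃ c : k, r - algebraMap k R c ∈ maximalIdeal R)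
    {e₁ e₂ : Ω[R⁄k]} (he : ∀ ω : Ω[R⁄k], ∃ a b : R, ω = a • e₁ + b • e₂) :
    ∃ u v : R, maximalIdeal R = Ideal.span {u, v} := by
  have huniq : ∀ c : k, algebraMap k R c ∈ maximalIdeal R → c = 0 := by
    intro c hc
    by_contra h0
    exact (mem_maximalIdeal _).1 hc ((isUnit_iff_ne_zero.2 h0).map _)
  choose σ hσ using hk
  have hσeq : ∀ r c, r - algebraMap k R c ∈ maximalIdeal R → σ r = c := by
    intro r c hc
    rw [← sub_eq_zero]
    refine huniq _ ?_
    have := (maximalIdeal R).sub_mem hc (hσ r)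
    rwa [sub_sub_sub_cancel_left, ← map_sub] at this
  have hadd : ∀ r s, σ (r + s) = σ r + σ s := fun r s ↦ hσeq _ _ (by
    rw [map_add, add_sub_add_comm]
    exact Ideal.add_mem _ (hσ r) (hσ s))
  have hmul : ∀ r s, σ (r * s) = σ r * σ s := fun r s ↦ hσeq _ _ (by
    have e : r * s - algebraMap k R (σ r * σ s) =
        s * (r - algebraMap k R (σ r)) + algebraMap k R (σ r) * (s - algebraMap k R (σ s)) := by
      rw [map_mul]; ring
    rw [e]
    exact Ideal.add_mem _ (Ideal.mul_mem_left _ _ (hσ r)) (Ideal.mul_mem_left _ _ (hσ s)))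
  have hconst : ∀ c : k, σ (algebraMap k R c) = c := fun c ↦ hσeq _ _ (by simp)
  let H : R →ₗ[k] (maximalIdeal R).Cotangent :=
    { toFun := fun r ↦ (maximalIdeal R).toCotangent ⟨r - algebraMap k R (σ r), hσ r⟩
      map_add' := fun r s ↦ by
        rw [← map_add]
        congr 1
        ext
        simp only [hadd, map_add, Submodule.coe_add]
        ring
      map_smul' := fun c r ↦ by
        rw [RingHom.id_apply, ← algebraMap_smul R c ((maximalIdeal R).toCotangent _), ← map_smul]
        congr 1
        ext
        simp only [Algebra.smul_def, Algebra.algebraMap_self, RingHom.id_apply, hmul, hconst, map_mul,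
          Submodule.coe_smul]
        ring }
  -- The map sending `r` to the class of `r - r(P)` is a derivation. Its linear extension sends `da`
  -- to the class of `a` in the cotangent space, so the images of `e₁`, `e₂` span that space.
  let δ : Derivation k R (maximalIdeal R).Cotangent := Derivation.mk' H fun r s ↦ by
    change (maximalIdeal R).toCotangent _ = r • (maximalIdeal R).toCotangent _ +
      s • (maximalIdeal R).toCotangent _
    rw [← map_smul, ← map_smul, ← map_add, Ideal.toCotangent_eq]
    simp only [Submodule.coe_add, Submodule.coe_smul, smul_eq_mul, hmul, map_mul]
    have e : r * s - algebraMap k R (σ r) * algebraMap k R (σ s) -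
        (r * (s - algebraMap k R (σ s)) + s * (r - algebraMap k R (σ r))) =
        -((r - algebraMap k R (σ r)) * (s - algebraMap k R (σ s))) := by ring
    rw [e, pow_two]
    exact Ideal.neg_mem_iff _ |>.2 (Ideal.mul_mem_mul (hσ r) (hσ s))
  have hδ : ∀ a (ha : a ∈ maximalIdeal R), δ.liftKaehlerDifferential (D k R a) =
      (maximalIdeal R).toCotangent ⟨a, ha⟩ := by
    intro a ha
    rw [Derivation.liftKaehlerDifferential_comp_D]
    change (maximalIdeal R).toCotangent _ = _
    rw [Ideal.toCotangent_eq]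
    have : σ a = 0 := hσeq a 0 (by simpa using ha)
    simp [this]
  obtain ⟨⟨u, hu⟩, hu'⟩ := (maximalIdeal R).toCotangent_surjective (δ.liftKaehlerDifferential e₁)
  obtain ⟨⟨v, hv⟩, hv'⟩ := (maximalIdeal R).toCotangent_surjective (δ.liftKaehlerDifferential e₂)
  refine ⟨u, v, le_antisymm (le_of_le_sup_maximalIdeal_smul fun a ha ↦ ?_) ?_⟩
  · obtain ⟨c, d, hcd⟩ := he (D k R a)
    have h1 := hδ a ha
    rw [hcd, map_add, map_smul, map_smul, ← hu', ← hv', ← map_smul, ← map_smul, ← map_add,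
      eq_comm, Ideal.toCotangent_eq] at h1
    simp only [Submodule.coe_add, Submodule.coe_smul, smul_eq_mul] at h1
    rw [← add_sub_cancel (c * u + d * v) a]
    refine Submodule.add_mem_sup (Ideal.mem_span_pair.2 ⟨c, d, rfl⟩) ?_
    rwa [smul_eq_mul, ← pow_two]
  · rw [Ideal.span_le]
    rintro a (rfl | rfl) <;> assumption

end Dimension

/-! ### Decomposition of a rational function into prime factors -/

section Factorization

variable {R K ι : Type*} [CommRing R] [IsDomain R] [UniqueFactorizationMonoid R] [Field K]
  [Algebra R K] [IsFractionRing R K]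

/-- A function on the fraction field of a factorial ring that is additive on products and trivial on
units is determined by its values on the primes. -/
theorem exists_finset_forall_eq_sum {v : K → ℤ} {w : ι → K → ℤ} {f : ι → R}
    (hv : ∀ a b, a ≠ 0 → b ≠ 0 → v (a * b) = v a + v b)
    (hw : ∀ i a b, a ≠ 0 → b ≠ 0 → w i (a * b) = w i a + w i b)
    (hvu : ∀ a : R, IsUnit a → v (algebraMap R K a) = 0)
    (hwu : ∀ i, ∀ a : R, IsUnit a → w i (algebraMap R K a) = 0)
    (hf : ∀ p : R, Prime p → ∃ i, Associated (f i) p)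
    (hw₁ : ∀ i, w i (algebraMap R K (f i)) = 1)
    (hw₀ : ∀ i j, i ≠ j → w j (algebraMap R K (f i)) = 0) {g : K} (hg : g ≠ 0) :
    ∃ T₀ : Finset ι, ∀ T, T₀ ⊆ T → v g = ∑ i ∈ T, w i g * v (algebraMap R K (f i)) := by
  classical
  have inj := IsFractionRing.injective R K
  -- Only the finitely many primes dividing `r` contribute. Allowing every larger index set makes it
  -- possible to use one set for several functions.
  have hR : ∀ r : R, r ≠ 0 → ∃ T₀ : Finset ι, ∀ T, T₀ ⊆ T →
      v (algebraMap R K r) = ∑ i ∈ T, w i (algebraMap R K r) * v (algebraMap R K (f i)) := by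
    intro r
    induction r using UniqueFactorizationMonoid.induction_on_prime with
    | h₁ => exact fun h ↦ absurd rfl h
    | h₂ a ha =>
      intro _
      exact ⟨∅, fun T _ ↦ by simp [hvu a ha, hwu _ a ha]⟩
    | h₃ a p ha hp ih =>
      intro _
      obtain ⟨i, u, hu⟩ := hf p hp
      obtain ⟨T₁, hT₁⟩ := ih ha
      have hfi : f i ≠ 0 := by rintro h0; rw [h0, zero_mul] at hu; exact hp.ne_zero hu.symm
      have e₁ : ∀ t : K → ℤ, (∀ a b, a ≠ 0 → b ≠ 0 → t (a * b) = t a + t b) →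
          (∀ a : R, IsUnit a → t (algebraMap R K a) = 0) → t (algebraMap R K (p * a)) =
          t (algebraMap R K (f i)) + t (algebraMap R K a) := by
        intro t ht htu
        have h0 : ∀ r : R, r ≠ 0 → algebraMap R K r ≠ 0 := fun r hr ↦
          (map_ne_zero_iff _ inj).2 hr
        rw [← hu, map_mul, ht _ _ (h0 _ (mul_ne_zero hfi u.ne_zero)) (h0 _ ha), map_mul,
          ht _ _ (h0 _ hfi) (h0 _ u.ne_zero), htu _ u.isUnit, add_zero]
      refine ⟨insert i T₁, fun T hT ↦ ?_⟩
      rw [e₁ v hv hvu, hT₁ T ((Finset.subset_insert _ _).trans hT)]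
      simp_rw [fun j ↦ e₁ (w j) (hw j) (hwu j), add_mul, Finset.sum_add_distrib]
      congr 1
      rw [Finset.sum_eq_single_of_mem i (hT (Finset.mem_insert_self _ _))
        fun j _ hj ↦ by rw [hw₀ i j hj.symm, zero_mul], hw₁, one_mul]
  obtain ⟨a, b, hb, rfl⟩ := IsFractionRing.div_surjective (A := R) g
  have hb' : algebraMap R K b ≠ 0 := (map_ne_zero_iff _ inj).2 (nonZeroDivisors.ne_zero hb)
  have ha : a ≠ 0 := by rintro rfl; simp at hg
  obtain ⟨T₁, hT₁⟩ := hR a ha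
  obtain ⟨T₂, hT₂⟩ := hR b (nonZeroDivisors.ne_zero hb)
  have hdiv : ∀ t : K → ℤ, (∀ a b, a ≠ 0 → b ≠ 0 → t (a * b) = t a + t b) →
      t (algebraMap R K a / algebraMap R K b) = t (algebraMap R K a) - t (algebraMap R K b) := by
    intro t ht
    rw [eq_sub_iff_add_eq, ← ht _ _ hg hb', div_mul_cancel₀ _ hb']
  refine ⟨T₁ ∪ T₂, fun T hT ↦ ?_⟩
  rw [hdiv v hv, hT₁ T (Finset.union_subset_left hT), hT₂ T (Finset.union_subset_right hT),
    ← Finset.sum_sub_distrib]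
  exact Finset.sum_congr rfl fun i _ ↦ by rw [hdiv (w i) (hw i), sub_mul]

end Factorization

/-! ### Local rings of schemes over a field -/

section Stalks

variable {k : Type u} [Field k] {X Y S : Scheme.{u}}

/-- The scalars in the local ring of a scheme over a field. -/
def stalkScalar (p : X ⟶ Spec (.of k)) (x : X) : k →+* X.presheaf.stalk x :=
  (X.presheaf.germ ⊤ x (TopologicalSpace.Opens.mem_top _)).hom.comp
    (p.appTop.hom.comp (Scheme.ΓSpecIso (.of k)).inv.hom)

theorem stalkScalar_eq_germ_comp_appLE (p : X ⟶ Spec (.of k)) {U : X.Opens} {x : X} (hx : x ∈ U) :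
    stalkScalar p x = (X.presheaf.germ U x hx).hom.comp
      ((p.appLE ⊤ U le_top).hom.comp (Scheme.ΓSpecIso (.of k)).inv.hom) := by
  have : p.appTop ≫ X.presheaf.germ ⊤ x (TopologicalSpace.Opens.mem_top _) =
      p.appLE ⊤ U le_top ≫ X.presheaf.germ U x hx := by
    change p.appTop ≫ _ = (p.appTop ≫ X.presheaf.map (homOfLE le_top).op) ≫ _
    rw [Category.assoc, TopCat.Presheaf.germ_res]
  rw [stalkScalar, ← RingHom.comp_assoc, ← RingHom.comp_assoc, ← CommRingCat.hom_comp, this]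
  rfl

theorem stalkMap_comp_stalkScalar (f : Y ⟶ X) (p : X ⟶ Spec (.of k)) (y : Y) :
    (f.stalkMap y).hom.comp (stalkScalar p (f y)) = stalkScalar (f ≫ p) y := by
  have h : p.appTop ≫ X.presheaf.germ ⊤ (f y) (TopologicalSpace.Opens.mem_top _) ≫ f.stalkMap y =
      (f ≫ p).appTop ≫ Y.presheaf.germ ⊤ y (TopologicalSpace.Opens.mem_top _) := by
    rw [Scheme.Hom.germ_stalkMap, Scheme.Hom.comp_appTop, Category.assoc]
    rfl
  rw [stalkScalar, stalkScalar, ← RingHom.comp_assoc, ← RingHom.comp_assoc, ← RingHom.comp_assoc,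
    ← CommRingCat.hom_comp, ← CommRingCat.hom_comp, ← CommRingCat.hom_comp, h]
  rfl

theorem stalkSpecializes_comp_stalkScalar (p : X ⟶ Spec (.of k)) {z x : X} (h : z ⤳ x) :
    (X.presheaf.stalkSpecializes h).hom.comp (stalkScalar p x) = stalkScalar p z := by
  rw [stalkScalar, ← RingHom.comp_assoc, ← CommRingCat.hom_comp,
    TopCat.Presheaf.germ_stalkSpecializes]
  rfl

theorem essFiniteType_stalkScalar (p : X ⟶ Spec (.of k)) [LocallyOfFiniteType p] (x : X) :
    (stalkScalar p x).EssFiniteType := by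
  obtain ⟨_, ⟨U, hU, rfl⟩, hx, -⟩ :=
    X.isBasis_affineOpens.exists_subset_of_mem_open (Set.mem_univ x) isOpen_univ
  rw [stalkScalar_eq_germ_comp_appLE p hx]
  refine .comp (.comp (RingHom.FiniteType.of_surjective _
    (ConcreteCategory.bijective_of_isIso (Scheme.ΓSpecIso (.of k)).inv).2).essFiniteType
    (p.finiteType_appLE (isAffineOpen_top _) hU le_top).essFiniteType) ?_
  let _ := TopCat.Presheaf.algebra_section_stalk X.presheaf ⟨x, hx⟩
  have : IsLocalization.AtPrime (X.presheaf.stalk x) (hU.primeIdealOf ⟨x, hx⟩).asIdeal :=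
    hU.isLocalization_stalk ⟨x, hx⟩
  exact RingHom.EssFiniteType.holdsForLocalization _ (hU.primeIdealOf ⟨x, hx⟩).asIdeal.primeCompl

theorem formallySmooth_stalkScalar_of_smooth (p : X ⟶ Spec (.of k)) [Smooth p] (x : X) :
    (stalkScalar p x).FormallySmooth := by
  obtain ⟨_, ⟨U, hU, rfl⟩, hx, -⟩ :=
    X.isBasis_affineOpens.exists_subset_of_mem_open (Set.mem_univ x) isOpen_univ
  rw [stalkScalar_eq_germ_comp_appLE p hx]
  refine .comp (.comp (.of_bijective
    (ConcreteCategory.bijective_of_isIso (Scheme.ΓSpecIso (.of k)).inv))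
    (p.smooth_appLE (isAffineOpen_top _) hU le_top).1) ?_
  let _ := TopCat.Presheaf.algebra_section_stalk X.presheaf ⟨x, hx⟩
  have : IsLocalization.AtPrime (X.presheaf.stalk x) (hU.primeIdealOf ⟨x, hx⟩).asIdeal :=
    hU.isLocalization_stalk ⟨x, hx⟩
  exact RingHom.formallySmooth_algebraMap.mpr
    (.of_isLocalization (hU.primeIdealOf ⟨x, hx⟩).asIdeal.primeCompl)

theorem formallySmooth_stalkScalar_of_isOpenImmersion (j : Y ⟶ X) [IsOpenImmersion j]
    (p : X ⟶ Spec (.of k)) [Smooth (j ≫ p)] (y : Y) : (stalkScalar p (j y)).FormallySmooth := by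
  have h₁ := formallySmooth_stalkScalar_of_smooth (j ≫ p) y
  rw [← stalkMap_comp_stalkScalar] at h₁
  have h₂ : ((inv (j.stalkMap y)).hom).FormallySmooth :=
    .of_bijective (ConcreteCategory.bijective_of_isIso _)
  have h₃ := h₁.comp h₂
  rw [← RingHom.comp_assoc, ← CommRingCat.hom_comp, IsIso.hom_inv_id] at h₃
  exact h₃

theorem IsSmoothPoint.formallySmooth_stalkScalar [S.Over (Spec (.of k))] {P : S}
    (h : IsSmoothPoint k S P) : (stalkScalar (S ↘ Spec (.of k)) P).FormallySmooth := by
  obtain ⟨U, hP, hU⟩ := h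
  exact formallySmooth_stalkScalar_of_isOpenImmersion U.ι (S ↘ Spec (.of k)) ⟨P, hP⟩

/-- By the Nullstellensatz the residue field at a closed point is `k`; the constant `c` is the value
of `r` at the point. -/
theorem exists_sub_stalkScalar_mem_maximalIdeal [IsAlgClosed k] (p : X ⟶ Spec (.of k))
    [LocallyOfFiniteType p] {x : X} (hx : IsClosed {x}) (r : X.presheaf.stalk x) :
    ∃ c : k, r - stalkScalar p x c ∈ IsLocalRing.maximalIdeal (X.presheaf.stalk x) := by
  have h1 : CommRingCat.ofHom (stalkScalar p x) ≫ X.residue x =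
      (residueFieldIsoBase p x hx).inv := by
    apply Spec.map_injective
    rw [SpecMap_residueFieldIsoBase_inv, Spec.map_comp, Scheme.fromSpecResidueField, Category.assoc]
    congr 1
    have h2 : CommRingCat.ofHom (stalkScalar p x) = (Scheme.ΓSpecIso (.of k)).inv ≫ p.appTop ≫
      X.presheaf.germ ⊤ x (TopologicalSpace.Opens.mem_top _) := rfl
    rw [h2, Spec.map_comp, Spec.map_comp, ← Scheme.fromSpecStalk_toSpecΓ, Category.assoc,
      Category.assoc]
    congr 1
    rw [← Scheme.toSpecΓ_naturality_assoc, ← SpecMap_ΓSpecIso_hom, ← Spec.map_comp, Iso.inv_hom_id, Spec.map_id,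
      Category.comp_id]
  obtain ⟨c, hc⟩ := (ConcreteCategory.bijective_of_isIso (residueFieldIsoBase p x hx).inv).2
    (X.residue x r)
  refine ⟨c, ?_⟩
  rw [← h1] at hc
  rw [← IsLocalRing.residue_eq_zero_iff, map_sub, sub_eq_zero]
  exact hc.symm

end Stalks

/-! ### Generizations and prime ideals of a local ring -/

section Generizations

open Order

variable {X Y S : Scheme.{u}}

/-- The local ring at a generization is a localization: denominators can be cleared. -/
theorem exists_stalkSpecializes_mul_eq {z x : X} (h : z ⤳ x) (b : X.presheaf.stalk z) :
    ∃ r s : X.presheaf.stalk x, IsUnit (X.presheaf.stalkSpecializes h s) ∧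
      X.presheaf.stalkSpecializes h s * b = X.presheaf.stalkSpecializes h r := by
  obtain ⟨_, ⟨U, hU, rfl⟩, hx, -⟩ :=
    X.isBasis_affineOpens.exists_subset_of_mem_open (Set.mem_univ x) isOpen_univ
  have hz : z ∈ U := h.mem_open U.2 hx
  let _ := TopCat.Presheaf.algebra_section_stalk X.presheaf ⟨z, hz⟩
  have : IsLocalization.AtPrime (X.presheaf.stalk z) (hU.primeIdealOf ⟨z, hz⟩).asIdeal :=
    hU.isLocalization_stalk ⟨z, hz⟩
  obtain ⟨⟨a, t⟩, hat⟩ :=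
    IsLocalization.surj (hU.primeIdealOf ⟨z, hz⟩).asIdeal.primeCompl b
  have e : ∀ c : Γ(X, U), X.presheaf.stalkSpecializes h (X.presheaf.germ U x hx c) =
      algebraMap Γ(X, U) (X.presheaf.stalk z) c := fun c ↦
    TopCat.Presheaf.germ_stalkSpecializes_apply ..
  refine ⟨X.presheaf.germ U x hx a, X.presheaf.germ U x hx t, ?_, ?_⟩
  · rw [e]
    exact IsLocalization.map_units _ t
  · rw [e, e, mul_comm, hat]

theorem idealAt_eq_comap {z x : X} (h : z ⤳ x) : idealAt z x =
    (IsLocalRing.maximalIdeal (X.presheaf.stalk z)).comap (X.presheaf.stalkSpecializes h).hom :=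
  dif_pos h

theorem idealAt_eq_top {z x : X} (h : ¬ z ⤳ x) : idealAt z x = ⊤ := dif_neg h

theorem idealAt_self (x : X) : idealAt x x = IsLocalRing.maximalIdeal (X.presheaf.stalk x) := by
  rw [idealAt_eq_comap specializes_rfl, TopCat.Presheaf.stalkSpecializes_refl]
  rfl

theorem notMem_idealAt {z x : X} (h : z ⤳ x) {r : X.presheaf.stalk x} :
    r ∉ idealAt z x ↔ IsUnit (X.presheaf.stalkSpecializes h r) := by
  rw [idealAt_eq_comap h, Ideal.mem_comap, IsLocalRing.mem_maximalIdeal, mem_nonunits_iff, not_not]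

theorem isPrime_idealAt {z x : X} (h : z ⤳ x) : (idealAt z x).IsPrime := by
  rw [idealAt_eq_comap h]
  infer_instance

theorem fromSpecStalk_idealAt {z x : X} (h : z ⤳ x) :
    X.fromSpecStalk x ⟨idealAt z x, isPrime_idealAt h⟩ = z := by
  have e : (⟨idealAt z x, isPrime_idealAt h⟩ : PrimeSpectrum (X.presheaf.stalk x)) =
      Spec.map (X.presheaf.stalkSpecializes h) (IsLocalRing.closedPoint (X.presheaf.stalk z)) :=
    PrimeSpectrum.ext (idealAt_eq_comap h)
  rw [e]
  change (Spec.map (X.presheaf.stalkSpecializes h) ≫ X.fromSpecStalk x)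
    (IsLocalRing.closedPoint (X.presheaf.stalk z)) = z
  rw [Scheme.SpecMap_stalkSpecializes_fromSpecStalk, Scheme.fromSpecStalk_closedPoint]

theorem eq_of_idealAt_eq {z w x : X} (hz : z ⤳ x) (hw : w ⤳ x) (h : idealAt z x = idealAt w x) :
    z = w := by
  rw [← fromSpecStalk_idealAt hz, ← fromSpecStalk_idealAt hw]
  congr 1
  exact PrimeSpectrum.ext h

theorem exists_idealAt_eq (x : X) (p : Ideal (X.presheaf.stalk x)) [hp : p.IsPrime] :
    ∃ z, z ⤳ x ∧ idealAt z x = p := by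
  have h : X.fromSpecStalk x ⟨p, hp⟩ ⤳ x := by
    have : X.fromSpecStalk x ⟨p, hp⟩ ∈ Set.range (X.fromSpecStalk x) := ⟨_, rfl⟩
    rwa [Scheme.range_fromSpecStalk] at this
  refine ⟨_, h, ?_⟩
  exact congrArg PrimeSpectrum.asIdeal
    ((X.fromSpecStalk x).isEmbedding.injective (fromSpecStalk_idealAt h))

theorem eq_of_idealAt_eq_maximalIdeal {z x : X} (hz : z ⤳ x)
    (h : idealAt z x = IsLocalRing.maximalIdeal (X.presheaf.stalk x)) : z = x :=
  eq_of_idealAt_eq hz specializes_rfl (h.trans (idealAt_self x).symm)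

theorem lt_of_specializes {z x : X} (h : z ⤳ x) (hne : z ≠ x) : x < z :=
  lt_of_le_not_ge h fun h' ↦ hne (h.antisymm h').eq

/-- A point of codimension one has no other point of codimension one as a generization. Two distinct
curves through `P` thus keep `P` from being a prime divisor, and ideals of curves at `P` differ from
the maximal ideal. -/
theorem ne_of_coheight_eq_one {z w x : X} (hz : coheight z = 1) (hw : coheight w = 1)
    (hzx : z ⤳ x) (hwx : w ⤳ x) (h : z ≠ w) : coheight x ≠ 1 := by
  intro hx
  have key : ∀ t, coheight t = 1 → t ⤳ x → t = x := by
    intro t ht htx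
    by_contra hne
    have := coheight_strictAnti (lt_of_specializes htx hne) (by simp [ht])
    rw [ht, hx] at this
    exact lt_irrefl _ this
  exact h ((key z hz hzx).trans (key w hw hwx).symm)

theorem idealAt_ne_bot {z x : X} (h : z ⤳ x) (hz : coheight z = 1) : idealAt z x ≠ ⊥ := by
  intro h0
  have hf : IsField (X.presheaf.stalk z) := by
    rw [IsLocalRing.isField_iff_maximalIdeal_eq, eq_bot_iff]
    intro b hb
    obtain ⟨r, s, hs, hrs⟩ := exists_stalkSpecializes_mul_eq h b
    have hr : r ∈ idealAt z x := by
      rw [idealAt_eq_comap h]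
      change X.presheaf.stalkSpecializes h r ∈ IsLocalRing.maximalIdeal _
      rw [← hrs]
      exact Ideal.mul_mem_left _ _ hb
    rw [h0, Ideal.mem_bot] at hr
    rw [hr, map_zero, hs.mul_right_eq_zero] at hrs
    exact hrs
  have := ringKrullDim_eq_zero_of_isField hf
  rw [ringKrullDim_stalk_eq_coheight, hz] at this
  exact absurd this (by simp)

variable [IsIntegral X]

theorem algebraMap_stalkSpecializes {z x : X} (h : z ⤳ x) (r : X.presheaf.stalk x) :
    algebraMap (X.presheaf.stalk z) X.functionField (X.presheaf.stalkSpecializes h r) =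
      algebraMap (X.presheaf.stalk x) X.functionField r := by
  change X.presheaf.stalkSpecializes _ (X.presheaf.stalkSpecializes h r) =
    X.presheaf.stalkSpecializes _ r
  rw [TopCat.Presheaf.stalkSpecializes_comp_apply]

theorem stalkSpecializes_injective {z x : X} (h : z ⤳ x) :
    Function.Injective (X.presheaf.stalkSpecializes h) := by
  intro r s hrs
  apply IsFractionRing.injective (X.presheaf.stalk x) X.functionField
  rw [← algebraMap_stalkSpecializes h, hrs, algebraMap_stalkSpecializes h]

theorem coheight_eq_one_of_isDiscreteValuationRing {z : X}
    [IsDiscreteValuationRing (X.presheaf.stalk z)] : coheight z = 1 := by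
  have h := IsPrincipalIdealRing.ringKrullDim_eq_one (X.presheaf.stalk z)
    (IsDiscreteValuationRing.not_isField _)
  rw [ringKrullDim_stalk_eq_coheight] at h
  exact_mod_cast h

variable [IsLocallyNoetherian X]

/-- Localizing at the principal prime `(f)` turns `f` into a generator of the maximal ideal. -/
theorem isDiscreteValuationRing_stalk_of_idealAt_eq_span {z x : X} (h : z ⤳ x)
    {f : X.presheaf.stalk x} (hf : idealAt z x = Ideal.span {f}) (hf0 : f ≠ 0) :
    IsDiscreteValuationRing (X.presheaf.stalk z) ∧ Irreducible (X.presheaf.stalkSpecializes h f) := by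
  set φ := X.presheaf.stalkSpecializes h with hφ
  have hm : IsLocalRing.maximalIdeal (X.presheaf.stalk z) = Ideal.span {φ f} := by
    apply le_antisymm
    · intro b hb
      obtain ⟨r, s, hs, hrs⟩ := exists_stalkSpecializes_mul_eq h b
      have hr : r ∈ idealAt z x := by
        rw [idealAt_eq_comap h]
        change X.presheaf.stalkSpecializes h r ∈ IsLocalRing.maximalIdeal _
        rw [← hrs]
        exact Ideal.mul_mem_left _ _ hb
      rw [hf, Ideal.mem_span_singleton] at hr
      obtain ⟨c, rfl⟩ := hr
      rw [Ideal.mem_span_singleton, ← hs.dvd_mul_left, hrs, map_mul]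
      exact dvd_mul_right _ _
    · rw [Ideal.span_singleton_le_iff_mem]
      have : f ∈ idealAt z x := by rw [hf]; exact Ideal.mem_span_singleton_self f
      rwa [idealAt_eq_comap h] at this
  have hφf : φ f ≠ 0 := (map_ne_zero_iff _ (stalkSpecializes_injective h)).2 hf0
  have hnf : ¬ IsField (X.presheaf.stalk z) := by
    rw [IsLocalRing.isField_iff_maximalIdeal_eq, hm, Ideal.span_singleton_eq_bot]
    exact hφf
  have hp : (IsLocalRing.maximalIdeal (X.presheaf.stalk z)).IsPrincipal := ⟨⟨φ f, hm⟩⟩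
  have hdvr : IsDiscreteValuationRing (X.presheaf.stalk z) :=
    ((IsDiscreteValuationRing.TFAE (X.presheaf.stalk z) hnf).out 4 0).1 hp
  exact ⟨hdvr, (IsDiscreteValuationRing.irreducible_iff_uniformizer _).2 hm⟩

theorem ord_algebraMap_of_isUnit {z : X} {b : X.presheaf.stalk z} (hb : IsUnit b) :
    X.ord (algebraMap (X.presheaf.stalk z) X.functionField b) z = 0 := by
  by_cases hz : coheight z = 1
  · have : Ring.KrullDimLE 1 (X.presheaf.stalk z) := krullDimLE_of_coheight_le hz.le
    rw [Scheme.ord_eq_iff hz ((hb.map _).ne_zero)]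
    exact Ring.ordFrac_of_isUnit hb
  · exact Scheme.ord_eq_zero_of_coheight_neq_one hz _

theorem ord_algebraMap_of_irreducible {z : X} [IsDiscreteValuationRing (X.presheaf.stalk z)]
    {b : X.presheaf.stalk z} (hb : Irreducible b) :
    X.ord (algebraMap (X.presheaf.stalk z) X.functionField b) z = 1 := by
  have h0 : algebraMap (X.presheaf.stalk z) X.functionField b ≠ 0 :=
    (map_ne_zero_iff _ (IsFractionRing.injective _ _)).2 hb.ne_zero
  rw [Scheme.ord_eq_iff coheight_eq_one_of_isDiscreteValuationRing h0]
  exact Ring.ordFrac_irreducible hb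

theorem ord_nonneg_iff {z : X} [IsDiscreteValuationRing (X.presheaf.stalk z)]
    (a : X.functionField) :
    0 ≤ X.ord a z ↔ a ∈ Set.range (algebraMap (X.presheaf.stalk z) X.functionField) := by
  have hz : coheight z = 1 := coheight_eq_one_of_isDiscreteValuationRing
  by_cases ha : a = 0
  · subst ha
    rw [Scheme.ord_zero]
    exact iff_of_true le_rfl ⟨0, map_zero _⟩
  rw [Scheme.le_ord_iff hz ha]
  change _ ≤ Ring.ordFrac (X.presheaf.stalk z) a ↔ _
  rw [Ring.ordFrac_eq_valuation_inv]
  change 1 ≤ _ ↔ _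
  rw [one_le_inv₀ (by simpa [zero_lt_iff] using ha)]
  constructor
  · intro h
    obtain ⟨b, hb⟩ := IsDiscreteValuationRing.exists_lift_of_le_one h
    exact ⟨b, hb⟩
  · rintro ⟨b, rfl⟩
    exact IsDedekindDomain.HeightOneSpectrum.valuation_le_one _ b

end Generizations

/-! ### Discrete valuations and canonical divisors on schemes over a field -/

section Canonical

open Order KaehlerDifferential

variable {k : Type u} [Field k] {X Y : Scheme.{u}} [IsIntegral X] [IsIntegral Y]
  [X.Over (Spec (.of k))] [Y.Over (Spec (.of k))]

instance (priority := low) stalkAlgebra (x : X) : Algebra k (X.presheaf.stalk x) :=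
  (stalkScalar (X ↘ Spec (.of k)) x).toAlgebra

instance stalk_functionField_isScalarTower (x : X) :
    IsScalarTower k (X.presheaf.stalk x) X.functionField :=
  .of_algebraMap_eq' (stalkSpecializes_comp_stalkScalar (X ↘ Spec (.of k)) _).symm

instance essFiniteType_stalk [LocallyOfFiniteType (X ↘ Spec (.of k))] (x : X) :
    Algebra.EssFiniteType k (X.presheaf.stalk x) :=
  RingHom.essFiniteType_algebraMap.1 (essFiniteType_stalkScalar (X ↘ Spec (.of k)) x)

theorem finrank_kaehlerDifferential_functionField_le [CharZero k]
    [LocallyOfFiniteType (X ↘ Spec (.of k))] {d : ℕ} (hd : topologicalKrullDim X ≤ d) :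
    Module.finrank X.functionField Ω[X.functionField⁄k] ≤ d := by
  obtain ⟨_, ⟨U, hU, rfl⟩, hx, -⟩ :=
    X.isBasis_affineOpens.exists_subset_of_mem_open (Set.mem_univ (genericPoint X)) isOpen_univ
  have : Nonempty U := ⟨_, hx⟩
  have := functionField_isFractionRing_of_isAffineOpen X U hU
  let _ : Algebra k Γ(X, U) := (((X ↘ Spec (.of k)).appLE ⊤ U le_top).hom.comp
    (Scheme.ΓSpecIso (.of k)).inv.hom).toAlgebra
  have : IsScalarTower k Γ(X, U) X.functionField :=
    .of_algebraMap_eq' (stalkScalar_eq_germ_comp_appLE (X ↘ Spec (.of k)) hx)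
  have : Algebra.FiniteType k Γ(X, U) := RingHom.finiteType_algebraMap.1 <|
    .comp ((X ↘ Spec (.of k)).finiteType_appLE (isAffineOpen_top _) hU le_top)
      (.of_surjective _ (ConcreteCategory.bijective_of_isIso (Scheme.ΓSpecIso (.of k)).inv).2)
  refine finrank_kaehlerDifferential_le k Γ(X, U) X.functionField ?_
  rw [← PrimeSpectrum.topologicalKrullDim_eq_ringKrullDim]
  have : IsOpenImmersion (IsAffineOpen.fromSpec hU) := IsAffineOpen.isOpenImmersion_fromSpec hU
  exact ((IsAffineOpen.fromSpec hU).isOpenEmbedding.isInducing.topologicalKrullDim_le).trans hd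

/-- Two local generators differ by a unit, so the choice made in the definition does not affect the
order. -/
theorem canonicalCoeff_eq_ord [IsLocallyNoetherian X] {z : X} {η θ : TwoForm k X.functionField}
    {g : X.functionField} (hη : IsLocalGenerator z η) (hθ : θ = g • η) (hθ0 : θ ≠ 0) :
    canonicalCoeff θ z = X.ord g z := by
  have h : ∃ g : X.functionField, ∃ η, IsLocalGenerator (k := k) z η ∧ θ = g • η := ⟨g, η, hη, hθ⟩
  rw [canonicalCoeff, dif_pos h]
  obtain ⟨η', hη', hθ'⟩ := h.choose_spec
  set g' := h.choose
  have hspan := hη.symm.trans hη'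
  obtain ⟨v, hv⟩ := Submodule.mem_span_singleton.1 (hspan ▸ Submodule.mem_span_singleton_self η')
  obtain ⟨w, hw⟩ := Submodule.mem_span_singleton.1 (hspan ▸ Submodule.mem_span_singleton_self η)
  have hη0 : η ≠ 0 := by rintro rfl; exact hθ0 (by rw [hθ, smul_zero])
  have inj := IsFractionRing.injective (X.presheaf.stalk z) X.functionField
  have hwv : w * v = 1 := by
    apply inj
    rw [← hv, ← mul_smul, ← algebraMap_smul X.functionField] at hw
    rw [map_one]
    exact smul_left_injective _ hη0 (by simpa using hw)
  have hg : g = g' * algebraMap (X.presheaf.stalk z) X.functionField v := by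
    rw [← hv, hθ, ← algebraMap_smul X.functionField v, ← mul_smul] at hθ'
    exact smul_left_injective _ hη0 hθ'
  have hv' : IsUnit v := IsUnit.of_mul_eq_one_right w hwv
  have hg' : g' ≠ 0 := by
    intro h0
    rw [h0, zero_smul] at hθ'
    exact hθ0 hθ'
  rw [hg, Scheme.ord_mul hg' (hv'.map _).ne_zero, ord_algebraMap_of_isUnit hv', add_zero]

section Parameters

variable [IsLocallyNoetherian X] [LocallyOfFiniteType (X ↘ Spec (.of k))]
  {z P : X} (h : z ⤳ P) {x y : X.presheaf.stalk P}
  (hm : IsLocalRing.maximalIdeal (X.presheaf.stalk P) = Ideal.span {x, y})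
  (hk : ∀ r : X.presheaf.stalk P, ∃ c : k,
    r - algebraMap k _ c ∈ IsLocalRing.maximalIdeal (X.presheaf.stalk P))

include h hm hk

theorem exists_D_algebraMap_stalk_eq (b : X.presheaf.stalk z) :
    ∃ α β : X.presheaf.stalk z, D k X.functionField (algebraMap _ _ b) =
      algebraMap _ X.functionField α • D k _ (algebraMap _ X.functionField x) +
        algebraMap _ X.functionField β • D k _ (algebraMap _ X.functionField y) := by
  set e := algebraMap (X.presheaf.stalk P) X.functionField
  set φ := X.presheaf.stalkSpecializes h
  have he : ∀ r, algebraMap (X.presheaf.stalk z) X.functionField (φ r) = e r :=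
    algebraMap_stalkSpecializes h
  obtain ⟨r, s, ⟨t, ht⟩, hrs⟩ := exists_stalkSpecializes_mul_eq h b
  obtain ⟨r₁, r₂, hr⟩ := exists_D_algebraMap_eq (L := X.functionField) hm hk r
  obtain ⟨s₁, s₂, hs⟩ := exists_D_algebraMap_eq (L := X.functionField) hm hk s
  have hsr : e s * algebraMap _ _ b = e r := by rw [← he, ← he, ← map_mul, hrs]
  have hD := congrArg (D k X.functionField) hsr
  rw [Derivation.leibniz, hr, hs] at hD
  have ht1 : algebraMap _ X.functionField (↑t⁻¹ : X.presheaf.stalk z) * e s = 1 := by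
    rw [← he, ← map_mul, ← ht, Units.inv_mul, map_one]
  refine ⟨↑t⁻¹ * (φ r₁ - b * φ s₁), ↑t⁻¹ * (φ r₂ - b * φ s₂), ?_⟩
  have := congrArg (algebraMap _ X.functionField (↑t⁻¹ : X.presheaf.stalk z) • ·)
    (eq_sub_of_add_eq hD)
  simp only [smul_smul, ht1, one_smul] at this
  rw [this]
  simp only [map_mul, map_sub, he]
  module

theorem isLocalGenerator_dWedge : IsLocalGenerator z
    (dWedge k (algebraMap _ X.functionField x) (algebraMap _ X.functionField y)) := by
  refine le_antisymm (Submodule.span_le.2 ?_) ?_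
  · rintro _ ⟨a, b, rfl⟩
    obtain ⟨a₁, a₂, ha⟩ := exists_D_algebraMap_stalk_eq h hm hk a
    obtain ⟨b₁, b₂, hb⟩ := exists_D_algebraMap_stalk_eq h hm hk b
    have hab := congrArg₂ (fun u v ↦ wedge k u v) ha hb
    simp only [wedge_combination, ← dWedge_eq_wedge] at hab
    rw [hab]
    refine Submodule.mem_span_singleton.2 ⟨a₁ * b₂ - a₂ * b₁, ?_⟩
    rw [← algebraMap_smul X.functionField, map_sub, map_mul, map_mul]
  · rw [Submodule.span_singleton_le_iff_mem]
    exact Submodule.subset_span ⟨X.presheaf.stalkSpecializes h x, X.presheaf.stalkSpecializes h y,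
      by rw [algebraMap_stalkSpecializes, algebraMap_stalkSpecializes]⟩

omit h in
theorem exists_D_functionField_eq (b : X.functionField) :
    ∃ α β : X.functionField, D k X.functionField b =
      α • D k _ (algebraMap _ X.functionField x) + β • D k _ (algebraMap _ X.functionField y) := by
  obtain ⟨r, s, -, rfl⟩ := IsFractionRing.div_surjective (A := X.presheaf.stalk P) b
  obtain ⟨r₁, r₂, hr⟩ := exists_D_algebraMap_eq (L := X.functionField) hm hk r
  obtain ⟨s₁, s₂, hs⟩ := exists_D_algebraMap_eq (L := X.functionField) hm hk s
  exact ⟨_, _, D_div_eq _ _ hr hs⟩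

end Parameters

/-- A one-dimensional integrally closed Noetherian local domain is a discrete valuation ring; its
maximal ideal is the only non-zero prime. -/
theorem IsNormal.isDiscreteValuationRing [IsLocallyNoetherian X] (hX : IsNormal X) {z : X}
    (hz : coheight z = 1) : IsDiscreteValuationRing (X.presheaf.stalk z) := by
  have h1 : ringKrullDim (X.presheaf.stalk z) = 1 := by
    rw [ringKrullDim_stalk_eq_coheight, hz]; rfl
  have hnf : ¬ IsField (X.presheaf.stalk z) := by
    intro hf
    rw [ringKrullDim_eq_zero_of_isField hf] at h1
    exact absurd h1 (by simp)
  have : Ring.KrullDimLE 1 (X.presheaf.stalk z) := krullDimLE_of_coheight_le hz.le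
  have hP : ∃! P : Ideal (X.presheaf.stalk z), P ≠ ⊥ ∧ P.IsPrime :=
    ⟨_, ⟨(IsLocalRing.isField_iff_maximalIdeal_eq.not).1 hnf, inferInstance⟩, fun P hP ↦
      IsLocalRing.eq_maximalIdeal
        (Ring.krullDimLE_one_iff_of_noZeroDivisors.1 ‹_› P hP.1 hP.2)⟩
  have h2 : IsIntegrallyClosed (X.presheaf.stalk z) ∧
    ∃! P : Ideal (X.presheaf.stalk z), P ≠ ⊥ ∧ P.IsPrime := ⟨hX z, hP⟩
  exact ((IsDiscreteValuationRing.TFAE (X.presheaf.stalk z) hnf).out 3 0).1 h2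

theorem isDiscreteOrder_ord [IsLocallyNoetherian X] {z : X}
    [IsDiscreteValuationRing (X.presheaf.stalk z)] : IsDiscreteOrder k (X.ord · z) where
  mul ha hb := Scheme.ord_mul ha hb
  add hab := Scheme.ord_add hab
  const c := by
    by_cases hc : c = 0
    · simp [hc]
    rw [IsScalarTower.algebraMap_apply k (X.presheaf.stalk z) X.functionField]
    exact ord_algebraMap_of_isUnit ((isUnit_iff_ne_zero.2 hc).map _)
  uniformizer := by
    obtain ⟨π, hπ⟩ := IsDiscreteValuationRing.exists_irreducible (X.presheaf.stalk z)
    exact ⟨_, ord_algebraMap_of_irreducible hπ⟩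

theorem rationalPullback_algebraMap (f : Y ⟶ X) [IsDominant f] (y : Y)
    (r : X.presheaf.stalk (f y)) :
    rationalPullback f (algebraMap _ X.functionField r) =
      algebraMap (Y.presheaf.stalk y) Y.functionField (f.stalkMap y r) := by
  change f.stalkMap (genericPoint Y) (X.presheaf.stalkSpecializes _
    (X.presheaf.stalkSpecializes _ r)) = Y.presheaf.stalkSpecializes _ (f.stalkMap y r)
  rw [TopCat.Presheaf.stalkSpecializes_comp_apply]
  exact Scheme.Hom.stalkSpecializes_stalkMap_apply f (genericPoint Y) y
    ((genericPoint_spec Y).specializes trivial) r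

end Canonical

/-! ### Curves through a point with factorial local ring -/

section Curves

open Order IsLocalRing

variable {X Y S : Scheme.{u}}

theorem specializes_of_idealAt_le {z w x : X} (hz : z ⤳ x) (hw : w ⤳ x)
    (h : idealAt z x ≤ idealAt w x) : z ⤳ w := by
  rw [← fromSpecStalk_idealAt hz, ← fromSpecStalk_idealAt hw]
  exact ((PrimeSpectrum.le_iff_specializes _ _).1 h).map (X.fromSpecStalk x).continuous

variable [IsIntegral S] [IsLocallyNoetherian S]

/-- The prime divisors through a point. -/
abbrev CurveThrough (P : S) : Type u := {z : S // z ⤳ P ∧ coheight z = 1}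

variable {P : S} {f : CurveThrough P → S.presheaf.stalk P}
  (hf : ∀ z : CurveThrough P, idealAt z.1 P = Ideal.span {f z})

include hf

omit [IsIntegral S] [IsLocallyNoetherian S] in
theorem localEquation_ne_zero (z : CurveThrough P) : f z ≠ 0 := by
  intro h0
  refine idealAt_ne_bot z.2.1 z.2.2 ?_
  rw [hf, h0, Ideal.span_singleton_eq_bot]

omit [IsIntegral S] [IsLocallyNoetherian S] in
theorem prime_localEquation (z : CurveThrough P) : Prime (f z) := by
  rw [← Ideal.span_singleton_prime (localEquation_ne_zero hf z), ← hf]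
  exact isPrime_idealAt z.2.1

omit [IsLocallyNoetherian S] in
theorem eq_of_localEquation_mem {z : CurveThrough P} {p : Ideal (S.presheaf.stalk P)}
    [hp : p.IsPrime] {g : S.presheaf.stalk P} (hg : p = Ideal.span {g}) (h : f z ∈ p) :
    idealAt z.1 P = p := by
  have hgu : ¬ IsUnit g := by rw [← Ideal.span_singleton_eq_top, ← hg]; exact hp.ne_top
  rw [hf, hg, Ideal.span_singleton_eq_span_singleton]
  rw [hg, Ideal.mem_span_singleton] at h
  exact ((prime_localEquation hf z).irreducible.dvd_iff.1 h).resolve_left hgu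

theorem ord_localEquation_self (z : CurveThrough P) :
    S.ord (algebraMap _ S.functionField (f z)) z.1 = 1 := by
  obtain ⟨h, hirr⟩ := isDiscreteValuationRing_stalk_of_idealAt_eq_span z.2.1 (hf z)
    (localEquation_ne_zero hf z)
  rw [← algebraMap_stalkSpecializes z.2.1]
  exact ord_algebraMap_of_irreducible hirr

omit hf in
theorem ord_algebraMap_of_notMem_idealAt {z : S} (h : z ⤳ P) {r : S.presheaf.stalk P}
    (hr : r ∉ idealAt z P) : S.ord (algebraMap _ S.functionField r) z = 0 := by
  rw [← algebraMap_stalkSpecializes h]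
  exact ord_algebraMap_of_isUnit ((notMem_idealAt h).1 hr)

theorem ord_localEquation_of_ne {z w : CurveThrough P} (hzw : z ≠ w) :
    S.ord (algebraMap _ S.functionField (f z)) w.1 = 0 := by
  refine ord_algebraMap_of_notMem_idealAt w.2.1 fun h ↦ hzw ?_
  have := isPrime_idealAt w.2.1
  exact Subtype.ext (eq_of_idealAt_eq z.2.1 w.2.1 (eq_of_localEquation_mem hf (hf w) h))

/-- The order along a discrete valuation centred in the local ring of `P` is determined by
the orders along the curves through `P`. -/
theorem exists_finset_forall_eq_sum_ord [UniqueFactorizationMonoid (S.presheaf.stalk P)]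
    {v : S.functionField → ℤ} (hv : ∀ a b, a ≠ 0 → b ≠ 0 → v (a * b) = v a + v b)
    (hvu : ∀ a : S.presheaf.stalk P, IsUnit a → v (algebraMap _ S.functionField a) = 0)
    {g : S.functionField} (hg : g ≠ 0) :
    ∃ T₀ : Finset (CurveThrough P), ∀ T, T₀ ⊆ T →
      v g = ∑ z ∈ T, S.ord g z.1 * v (algebraMap _ S.functionField (f z)) := by
  refine exists_finset_forall_eq_sum (R := S.presheaf.stalk P)
    (w := fun (z : CurveThrough P) g ↦ S.ord g z.1) hv
    (fun z a b ha hb ↦ Scheme.ord_mul ha hb) hvu (fun z a ha ↦ ?_) (fun p hp ↦ ?_)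
    (ord_localEquation_self hf) (fun z w h ↦ ord_localEquation_of_ne hf h) hg
  · exact ord_algebraMap_of_notMem_idealAt z.2.1 fun h ↦
      (isPrime_idealAt z.2.1).ne_top (Ideal.eq_top_of_isUnit_mem _ h ha)
  · have : (Ideal.span {p}).IsPrime := (Ideal.span_singleton_prime hp.ne_zero).2 hp
    obtain ⟨z, hz, hzp⟩ := exists_idealAt_eq P (Ideal.span {p})
    obtain ⟨_, -⟩ := isDiscreteValuationRing_stalk_of_idealAt_eq_span hz hzp hp.ne_zero
    refine ⟨⟨z, hz, coheight_eq_one_of_isDiscreteValuationRing⟩, ?_⟩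
    rw [← Ideal.span_singleton_eq_span_singleton, ← hf, hzp]

end Curves

/-! ### Orders of pulled-back functions and the centre of a divisor -/

section Centre

open Order IsLocalRing

variable {k : Type u} [Field k] {S Y : Scheme.{u}} [IsIntegral S] [IsIntegral Y]
  [IsLocallyNoetherian Y] (f : Y ⟶ S) [IsDominant f]

omit [IsLocallyNoetherian Y] in
theorem rationalPullback_algebraMap_of_specializes {y : Y} {P : S} (hP : f y ⤳ P)
    (r : S.presheaf.stalk P) :
    rationalPullback f (algebraMap _ S.functionField r) =
      algebraMap (Y.presheaf.stalk y) Y.functionField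
        (f.stalkMap y (S.presheaf.stalkSpecializes hP r)) := by
  rw [← algebraMap_stalkSpecializes hP, rationalPullback_algebraMap]

variable {y : Y} [IsDiscreteValuationRing (Y.presheaf.stalk y)] {P : S} (hP : f y ⤳ P)

include hP

theorem ord_rationalPullback_nonneg (r : S.presheaf.stalk P) :
    0 ≤ Y.ord (rationalPullback f (algebraMap _ S.functionField r)) y := by
  rw [ord_nonneg_iff, rationalPullback_algebraMap_of_specializes f hP]
  exact ⟨_, rfl⟩

omit [IsDiscreteValuationRing (Y.presheaf.stalk y)] in
theorem ord_rationalPullback_of_notMem {r : S.presheaf.stalk P} (hr : r ∉ idealAt (f y) P) :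
    Y.ord (rationalPullback f (algebraMap _ S.functionField r)) y = 0 := by
  rw [rationalPullback_algebraMap_of_specializes f hP]
  exact ord_algebraMap_of_isUnit (((notMem_idealAt hP).1 hr).map _)

/-- The stalk map is local, so `r` pulls back into the maximal ideal; were its order zero, the
inverse would be regular as well. -/
theorem ord_rationalPullback_pos {r : S.presheaf.stalk P} (hr : r ∈ idealAt (f y) P)
    (hr0 : r ≠ 0) : 0 < Y.ord (rationalPullback f (algebraMap _ S.functionField r)) y := by
  have h0 : rationalPullback f (algebraMap _ S.functionField r) ≠ 0 :=
    (map_ne_zero _).2 ((map_ne_zero_iff _ (IsFractionRing.injective _ _)).2 hr0)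
  have hr' : f.stalkMap y (S.presheaf.stalkSpecializes hP r) ∈
      maximalIdeal (Y.presheaf.stalk y) := by
    by_contra h
    rw [IsLocalRing.mem_maximalIdeal, mem_nonunits_iff, not_not] at h
    exact (notMem_idealAt hP).2 ((isUnit_map_iff (f.stalkMap y).hom _).1 h) hr
  refine lt_of_le_of_ne (ord_rationalPullback_nonneg f hP r) fun he ↦ ?_
  have hinv : (0 : ℤ) ≤ Y.ord (rationalPullback f (algebraMap _ S.functionField r))⁻¹ y := by
    have := Scheme.ord_mul (x := y) h0 (inv_ne_zero h0)
    rw [mul_inv_cancel₀ h0, ← he, zero_add] at this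
    rw [← this, ← map_one (algebraMap (Y.presheaf.stalk y) Y.functionField),
      ord_algebraMap_of_isUnit isUnit_one]
  rw [ord_nonneg_iff] at hinv
  obtain ⟨b, hb⟩ := hinv
  rw [rationalPullback_algebraMap_of_specializes f hP] at hb h0
  refine (mem_maximalIdeal _).1 hr' (IsUnit.of_mul_eq_one b ?_)
  apply IsFractionRing.injective (Y.presheaf.stalk y) Y.functionField
  rw [map_mul, hb, map_one, mul_inv_cancel₀ h0]

end Centre

/-! ### The discrepancy in terms of a regular bracket -/

section TwoForms

open KaehlerDifferential

variable {k K L : Type u} [Field k] [Field K] [Field L] [Algebra k K] [Algebra k L]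

theorem exists_eq_smul_dWedge {x y : K}
    (h : ∀ b : K, ∃ α β : K, D k K b = α • D k K x + β • D k K y) (θ : TwoForm k K) :
    ∃ c : K, θ = c • dWedge k x y := by
  refine exists_eq_smul_wedge k (fun u ↦ ?_) θ
  have hu : u ∈ Submodule.span K (Set.range (D k K)) := by
    rw [span_range_derivation]; trivial
  induction hu using Submodule.span_induction with
  | mem u hu =>
    obtain ⟨b, rfl⟩ := hu
    exact h b
  | zero => exact ⟨0, 0, by simp⟩
  | add u v _ _ hu hv =>
    obtain ⟨a, b, rfl⟩ := hu
    obtain ⟨c, d, rfl⟩ := hv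
    exact ⟨a + c, b + d, by module⟩
  | smul t u _ hu =>
    obtain ⟨a, b, rfl⟩ := hu
    exact ⟨t * a, t * b, by module⟩

theorem exists_D_eq_of_algHom (φ : K →ₐ[k] L) {x y b : K} {α β : K}
    (h : D k K b = α • D k K x + β • D k K y) :
    D k L (φ b) = φ α • D k L (φ x) + φ β • D k L (φ y) := by
  let _ : Algebra K L := φ.toRingHom.toAlgebra
  have _ : IsScalarTower k K L := IsScalarTower.of_algebraMap_eq fun x ↦ (φ.commutes x).symm
  have := congrArg (KaehlerDifferential.map k k K L) h
  rw [map_add, map_smul, map_smul, map_D, map_D, map_D, ← algebraMap_smul L α,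
    ← algebraMap_smul L β] at this
  exact this

/-- Pull back along the inverse isomorphism. -/
theorem dWedge_map_ne_zero {φ : K →ₐ[k] L} (hφ : Function.Bijective φ) {x y : K}
    (h : dWedge k x y ≠ 0) : dWedge k (φ x) (φ y) ≠ 0 := by
  intro h0
  let ψ : L →ₐ[k] K := (AlgEquiv.ofBijective φ hφ).symm
  have hψ : ∀ a, ψ (φ a) = a := (AlgEquiv.ofBijective φ hφ).symm_apply_apply
  have h1 := TwoForm.pullback_smul_dWedge ψ 1 (φ x) (φ y)
  rw [h0, smul_zero, map_zero, map_one, one_smul, hψ, hψ] at h1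
  exact h h1.symm

end TwoForms

/-! ### Discrepancies through brackets and local equations -/

section Discrepancy

open Order IsLocalRing

variable {k : Type u} [Field k] {S Y : Scheme.{u}} [IsIntegral S] [IsIntegral Y]
  [IsLocallyNoetherian S] [IsLocallyNoetherian Y] [S.Over (Spec (.of k))] [Y.Over (Spec (.of k))]
  [LocallyOfFiniteType (S ↘ Spec (.of k))] [LocallyOfFiniteType (Y ↘ Spec (.of k))]
  {f : Y ⟶ S} [f.IsOver (Spec (.of k))] [IsDominant f]

/-- The auxiliary form and function drop out. Writing `ω = h dx₁ ∧ dx₂`, the canonical coefficients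
are `ord h` on curves through `P`, and `ord h` plus the order of the bracket at `y`. Factoriality
computes the orders of `g` and `h` at `y` from those along curves through `P`, so the contributions
of `h` cancel. -/
theorem IsDiscrepancy.exists_eq {D : AlgebraicCycle S ℚ} {y : Y} {a : ℚ}
    (ha : IsDiscrepancy k f D y a) (hf : IsBirational f)
    [IsDiscreteValuationRing (Y.presheaf.stalk y)] {P : S} (hP : f y ⤳ P)
    [UniqueFactorizationMonoid (S.presheaf.stalk P)] {e : CurveThrough P → S.presheaf.stalk P}
    (he : ∀ z : CurveThrough P, idealAt z.1 P = Ideal.span {e z}) {x₁ x₂ : S.presheaf.stalk P}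
    (hm : maximalIdeal (S.presheaf.stalk P) = Ideal.span {x₁, x₂})
    (hk : ∀ r : S.presheaf.stalk P, ∃ c : k,
      r - algebraMap k _ c ∈ maximalIdeal (S.presheaf.stalk P)) :
    ∃ B : Y.functionField →ₗ[k] Derivation k Y.functionField Y.functionField,
      IsRegularBracket (Y.ord · y) B ∧
      B (rationalPullback f (algebraMap _ _ x₁)) (rationalPullback f (algebraMap _ _ x₂)) ≠ 0 ∧
      ∃ T₀ : Finset (CurveThrough P), ∀ T, T₀ ⊆ T →
        a = Y.ord (B (rationalPullback f (algebraMap _ _ x₁))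
            (rationalPullback f (algebraMap _ _ x₂))) y -
          ∑ z ∈ T, D z.1 * Y.ord (rationalPullback f (algebraMap _ _ (e z))) y := by
  obtain ⟨ω, m, g, hω, hm0, hg, hgD, rfl⟩ := ha
  set φ := rationalPullbackAlgHom (k := k) f with hφ
  have hφb : Function.Bijective φ := hf
  have hφe : ∀ a, φ a = rationalPullback f a := fun _ ↦ rfl
  set u₁ := algebraMap _ S.functionField x₁
  set u₂ := algebraMap _ S.functionField x₂
  have hD := exists_D_functionField_eq hm hk
  obtain ⟨h, rfl⟩ := exists_eq_smul_dWedge hD ω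
  have hh : h ≠ 0 := by rintro rfl; exact hω (zero_smul _ _)
  have hw : dWedge k u₁ u₂ ≠ 0 := fun h0 ↦ hω (by rw [h0, smul_zero])
  have hDL : ∀ b : Y.functionField, ∃ α β : Y.functionField, KaehlerDifferential.D k _ b =
      α • KaehlerDifferential.D k _ (φ u₁) + β • KaehlerDifferential.D k _ (φ u₂) := by
    intro b
    obtain ⟨b, rfl⟩ := hφb.2 b
    obtain ⟨α, β, h⟩ := hD b
    exact ⟨_, _, exists_D_eq_of_algHom φ h⟩
  have hw' := dWedge_map_ne_zero hφb hw
  have hθ := exists_eq_smul_dWedge hDL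
  have hord : IsDiscreteOrder k (Y.ord · y) := isDiscreteOrder_ord
  have hmem : dWedge k (φ u₁) (φ u₂) ∈
      regularTwoForms k (Y.presheaf.stalk y) Y.functionField := by
    refine Submodule.subset_span ⟨f.stalkMap y (S.presheaf.stalkSpecializes hP x₁),
      f.stalkMap y (S.presheaf.stalkSpecializes hP x₂), ?_⟩
    rw [← rationalPullback_algebraMap_of_specializes f hP,
      ← rationalPullback_algebraMap_of_specializes f hP]
    rfl
  obtain ⟨η, hη⟩ := exists_regularTwoForms_eq_span hord ord_nonneg_iff hθ hw' hmem
  have hη0 : η ≠ 0 := by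
    rintro rfl
    rw [hη, Submodule.span_zero_singleton, Submodule.mem_bot] at hmem
    exact hw' hmem
  have hηgen : ∀ θ : TwoForm k Y.functionField, ∃ c : Y.functionField, θ = c • η := by
    intro θ
    obtain ⟨c, hc⟩ := hθ θ
    obtain ⟨d, hd⟩ := hθ η
    have hd0 : d ≠ 0 := by rintro rfl; exact hη0 (by rw [hd, zero_smul])
    exact ⟨c * d⁻¹, by rw [hc, hd, ← mul_smul, inv_mul_cancel_right₀ hd0]⟩
  obtain ⟨B, hB⟩ := exists_bracket hη0 hηgen
  have hB0 : B (φ u₁) (φ u₂) ≠ 0 := by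
    intro h0
    rw [hB, h0, zero_smul] at hw'
    exact hw' rfl
  refine ⟨B, isRegularBracket_of_regularTwoForms ord_nonneg_iff hη0 hη hB, hB0, ?_⟩
  have hcS : ∀ z, z ⤳ P → canonicalCoeff (h • dWedge k u₁ u₂) z = S.ord h z := fun z hz ↦
    canonicalCoeff_eq_ord (isLocalGenerator_dWedge hz hm hk) rfl hω
  have hφh : φ h ≠ 0 := (map_ne_zero φ).2 hh
  have hpull : TwoForm.pullback φ (h • dWedge k u₁ u₂) = (φ h * B (φ u₁) (φ u₂)) • η := by
    rw [TwoForm.pullback_smul_dWedge, hB, mul_smul]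
  have hcY : canonicalCoeff (TwoForm.pullback φ (h • dWedge k u₁ u₂)) y =
      Y.ord (φ h) y + Y.ord (B (φ u₁) (φ u₂)) y := by
    rw [canonicalCoeff_eq_ord hη hpull, Scheme.ord_mul hφh hB0]
    rw [hpull]
    exact smul_ne_zero (mul_ne_zero hφh hB0) hη0
  have hvu : ∀ r : S.presheaf.stalk P, IsUnit r →
      Y.ord (φ (algebraMap _ S.functionField r)) y = 0 := fun r hr ↦
    ord_rationalPullback_of_notMem f hP fun h ↦
      (isPrime_idealAt hP).ne_top (Ideal.eq_top_of_isUnit_mem _ h hr)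
  have hvmul : ∀ a b : S.functionField, a ≠ 0 → b ≠ 0 →
      Y.ord (φ (a * b)) y = Y.ord (φ a) y + Y.ord (φ b) y := fun a b ha hb ↦ by
    rw [map_mul, Scheme.ord_mul ((map_ne_zero φ).2 ha) ((map_ne_zero φ).2 hb)]
  obtain ⟨T₁, hT₁⟩ := exists_finset_forall_eq_sum_ord he (v := fun a ↦ Y.ord (φ a) y) hvmul hvu hg
  obtain ⟨T₂, hT₂⟩ := exists_finset_forall_eq_sum_ord he (v := fun a ↦ Y.ord (φ a) y) hvmul hvu hh
  classical
  refine ⟨T₁ ∪ T₂, fun T hT ↦ ?_⟩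
  have h1 := hT₁ T (Finset.union_subset_left hT)
  have h2 := hT₂ T (Finset.union_subset_right hT)
  have hm' : (m : ℚ) ≠ 0 := by exact_mod_cast hm0.ne'
  have key : ((Y.ord (φ g) y : ℤ) : ℚ) / m = Y.ord (φ h) y +
      ∑ z ∈ T, D z.1 * Y.ord (φ (algebraMap _ _ (e z))) y := by
    rw [h1, h2, div_eq_iff hm']
    push_cast
    rw [← Finset.sum_add_distrib, Finset.sum_mul]
    refine Finset.sum_congr rfl fun z _ ↦ ?_
    -- The equation for `g` is available only on curves through `f y`. On any other curve through
    -- `P` the local equation is a unit at `f y`, so the term vanishes.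
    by_cases hz : e z ∈ idealAt (f y) P
    · have hzy : z.1 ⤳ f y := by
        refine specializes_of_idealAt_le z.2.1 hP ?_
        rw [he, Ideal.span_singleton_le_iff_mem]
        exact hz
      rw [hgD z.1 z.2.2 hzy, hcS z.1 z.2.1]
      ring
    · have : Y.ord (φ (algebraMap _ _ (e z))) y = 0 := ord_rationalPullback_of_notMem f hP hz
      rw [this]
      simp
  rw [hcY]
  push_cast
  rw [← hφe g, key]
  simp only [← hφe]
  ring

end Discrepancy

/-! ### Divisors near a point -/

section Divisors

open Order IsLocalRing

variable {S Y : Scheme.{u}}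

theorem curveMult_eq_zero {z P : S} (h : ¬ z ⤳ P) : curveMult z P = 0 := by
  have e : {n : ℕ | idealAt z P ≤ maximalIdeal (S.presheaf.stalk P) ^ n} = {0} := by
    ext n
    simp only [idealAt_eq_top h, Set.mem_ofPred_eq, Set.mem_singleton_iff, top_le_iff]
    refine ⟨fun hn ↦ ?_, by rintro rfl; simp⟩
    by_contra h0
    exact (maximalIdeal.isMaximal _).ne_top (top_le_iff.1 (hn ▸ Ideal.pow_le_self h0))
  rw [curveMult, e, csSup_singleton]

theorem localInter_eq_zero {z Δ P : S} (h : ¬ z ⤳ P) : localInter z Δ P = 0 := by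
  rw [localInter, idealAt_eq_top h, top_sup_eq, Module.length_eq_zero, ENat.toNat_zero]

theorem finite_setOf_curveThrough (D : AlgebraicCycle S ℚ) (P : S) :
    {z : CurveThrough P | D z.1 ≠ 0}.Finite := by
  obtain ⟨t, ht, hfin⟩ := D.supportLocallyFiniteWithinDomain' P trivial
  obtain ⟨U, hUt, hU, hPU⟩ := mem_nhds_iff.1 ht
  refine (hfin.preimage Subtype.val_injective.injOn).subset fun z hz ↦ ⟨?_, hz⟩
  exact hUt (z.2.1.mem_open hU hPU)

/-- Components away from `P` contribute nothing, so multiplicity, intersection numbers and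
discrepancy can be summed over one common finite set. -/
theorem finsum_eq_sum_curveThrough {D : AlgebraicCycle S ℚ} (hD : IsQDivisor D) {P : S}
    {F : S → ℕ} (hF : ∀ z, ¬ z ⤳ P → F z = 0) {T : Finset (CurveThrough P)}
    (hT : ∀ z : CurveThrough P, D z.1 ≠ 0 → z ∈ T) :
    ∑ᶠ z : S, D z * F z = ∑ z ∈ T, D z.1 * F z.1 := by
  rw [finsum_eq_sum_of_support_subset (s := T.map (Function.Embedding.subtype _)), Finset.sum_map]
  · rfl
  · intro z hz
    have hDz : D z ≠ 0 := left_ne_zero_of_mul hz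
    have hzP : z ⤳ P := by
      by_contra h
      exact hz (by simp [hF z h])
    simp only [Finset.coe_map, Set.mem_image, Finset.mem_coe]
    exact ⟨⟨z, hzP, hD z hDz⟩, hT _ hDz, rfl⟩

theorem notMem_maximalIdeal_pow_curveMult [IsIntegral S] [IsLocallyNoetherian S] {z P : S}
    {e : S.presheaf.stalk P} (he : idealAt z P = Ideal.span {e}) (he0 : e ≠ 0) :
    e ∉ maximalIdeal (S.presheaf.stalk P) ^ (curveMult z P + 1) := by
  rw [curveMult, he]
  exact notMem_pow_sSup_add_one he0

theorem localInter_spec [IsIntegral S] [IsLocallyNoetherian S] {z Δ P : S} {e : S.presheaf.stalk P}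
    (he : idealAt z P = Ideal.span {e}) (hΔ : (idealAt Δ P).IsPrime)
    (hΔ' : IsDiscreteValuationRing (S.presheaf.stalk P ⧸ idealAt Δ P)) (hne : e ∉ idealAt Δ P) :
    e ∉ idealAt Δ P ⊔ maximalIdeal (S.presheaf.stalk P) ^ (localInter z Δ P + 1) := by
  obtain ⟨n, hn, hen⟩ := exists_length_eq hne
  rwa [localInter, he, hn, ENat.toNat_natCast]

theorem one_le_curveMult [IsIntegral S] [IsLocallyNoetherian S] {z P : S} (h : z ⤳ P)
    {e : S.presheaf.stalk P} (he : idealAt z P = Ideal.span {e}) (he0 : e ≠ 0) :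
    1 ≤ curveMult z P := by
  by_contra h0
  have := notMem_maximalIdeal_pow_curveMult he he0
  rw [Nat.lt_one_iff.1 (not_le.1 h0), zero_add, pow_one] at this
  refine this (le_maximalIdeal (isPrime_idealAt h).ne_top ?_)
  rw [he]
  exact Ideal.mem_span_singleton_self e

/-- A prime divisor over `S` whose centre is a curve is that curve itself. -/
theorem exists_curveThrough_of_idealAt_eq_span [IsIntegral S] [IsIntegral Y] [IsLocallyNoetherian S]
    [IsLocallyNoetherian Y] {f : Y ⟶ S} [IsDominant f] (hf : IsBirational f) {y : Y}
    [IsDiscreteValuationRing (Y.presheaf.stalk y)] {P : S} (hP : f y ⤳ P)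
    [UniqueFactorizationMonoid (S.presheaf.stalk P)] {e : CurveThrough P → S.presheaf.stalk P}
    (he : ∀ z : CurveThrough P, idealAt z.1 P = Ideal.span {e z})
    {g : S.presheaf.stalk P} (hg : idealAt (f y) P = Ideal.span {g}) :
    ∃ z₀ : CurveThrough P,
      Y.ord (rationalPullback f (algebraMap _ _ (e z₀))) y = 1 ∧
      ∀ z, z ≠ z₀ → Y.ord (rationalPullback f (algebraMap _ _ (e z))) y = 0 := by
  obtain ⟨π, hπ⟩ := IsDiscreteValuationRing.exists_irreducible (Y.presheaf.stalk y)
  -- By birationality a uniformizer at `y` comes from a rational function `b` on `S`. Its order one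
  -- is a sum over curves through `P`; a curve contributing to it must be the centre, and its local
  -- equation has order dividing one.
  obtain ⟨b, hb⟩ := hf.2 (algebraMap _ Y.functionField π)
  have hb1 : Y.ord (rationalPullback f b) y = 1 := by
    rw [hb]; exact ord_algebraMap_of_irreducible hπ
  have hb0 : b ≠ 0 := by
    rintro rfl
    rw [map_zero, Scheme.ord_zero] at hb1
    exact absurd hb1 (by simp)
  have hpr := isPrime_idealAt hP
  obtain ⟨T, hT⟩ := exists_finset_forall_eq_sum_ord he
    (v := fun a ↦ Y.ord (rationalPullback f a) y) (fun a b ha hb ↦ by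
      rw [map_mul, Scheme.ord_mul ((map_ne_zero _).2 ha) ((map_ne_zero _).2 hb)])
    (fun r hr ↦ ord_rationalPullback_of_notMem f hP fun h ↦
      hpr.ne_top (Ideal.eq_top_of_isUnit_mem _ h hr)) hb0
  have hsum := hT T subset_rfl
  simp only [hb1] at hsum
  obtain ⟨z₀, hz₀, hne⟩ : ∃ z ∈ T, S.ord b z.1 *
      Y.ord (rationalPullback f (algebraMap _ _ (e z))) y ≠ 0 :=
    Finset.exists_ne_zero_of_sum_ne_zero (by rw [← hsum]; exact one_ne_zero)
  have hmem : ∀ z, Y.ord (rationalPullback f (algebraMap _ _ (e z))) y ≠ 0 →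
      idealAt z.1 P = idealAt (f y) P := fun z hz ↦ by
    refine eq_of_localEquation_mem he hg ?_
    by_contra h
    exact hz (ord_rationalPullback_of_notMem f hP h)
  have huniq : ∀ z, z ≠ z₀ → Y.ord (rationalPullback f (algebraMap _ _ (e z))) y = 0 := by
    intro z hz
    by_contra h
    exact hz (Subtype.ext (eq_of_idealAt_eq z.2.1 z₀.2.1
      ((hmem z h).trans (hmem z₀ (right_ne_zero_of_mul hne)).symm)))
  refine ⟨z₀, ?_, huniq⟩
  rw [Finset.sum_eq_single_of_mem z₀ hz₀ fun z _ hz ↦ by rw [huniq z hz, mul_zero]] at hsum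
  have h0 := ord_rationalPullback_nonneg f hP (e z₀)
  exact Int.eq_one_of_mul_eq_one_left h0 hsum.symm

end Divisors

/-! ### Parameters at the smooth point -/

section SmoothPoint

open Order IsLocalRing

variable (k : Type u) [Field k] {S : Scheme.{u}} [IsIntegral S] [IsLocallyNoetherian S]
  [S.Over (Spec (.of k))] [LocallyOfFiniteType (S ↘ Spec (.of k))] {P Δ₁ Δ₂ : S}

omit [IsIntegral S] [IsLocallyNoetherian S] in
theorem exists_sub_algebraMap_mem_maximalIdeal [IsAlgClosed k] (hP : IsClosed {P})
    (r : S.presheaf.stalk P) :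
    ∃ c : k, r - algebraMap k _ c ∈ maximalIdeal (S.presheaf.stalk P) :=
  exists_sub_stalkScalar_mem_maximalIdeal (S ↘ Spec (.of k)) hP r

/-- Smoothness and dimension two make the differentials at `P` generated by two elements, hence also
the maximal ideal; transversality then permits exchanging its generators for equations of the
curves. -/
theorem exists_transversal_parameters [IsAlgClosed k] [CharZero k]
    (hdim : topologicalKrullDim S ≤ 2) (hP : IsClosed {P}) (hPs : IsSmoothPoint k S P)
    (hΔ₁ : IsSmoothCurveAt Δ₁ P) (hΔ₂ : IsSmoothCurveAt Δ₂ P)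
    (htrans : MeetTransversallyAt Δ₁ Δ₂ P) :
    ∃ x y : S.presheaf.stalk P, idealAt Δ₁ P = Ideal.span {x} ∧ idealAt Δ₂ P = Ideal.span {y} ∧
      maximalIdeal (S.presheaf.stalk P) = Ideal.span {x, y} := by
  have hk := exists_sub_algebraMap_mem_maximalIdeal k hP
  have : Algebra.FormallySmooth k (S.presheaf.stalk P) :=
    RingHom.formallySmooth_algebraMap.1 hPs.formallySmooth_stalkScalar
  obtain ⟨e₁, e₂, he⟩ := exists_span_eq_top_of_formallySmooth k (S.presheaf.stalk P)
    S.functionField (finrank_kaehlerDifferential_functionField_le hdim)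
  obtain ⟨u, v, hm⟩ := exists_maximalIdeal_eq_span_pair k (S.presheaf.stalk P) hk he
  have hPc := ne_of_coheight_eq_one hΔ₁.1 hΔ₂.1 hΔ₁.2.1 hΔ₂.2.1 htrans.1
  have := isPrime_idealAt hΔ₁.2.1
  have := isPrime_idealAt hΔ₂.2.1
  refine exists_regular_parameters hm (idealAt_ne_bot hΔ₁.2.1 hΔ₁.1) (fun h ↦ ?_) (fun h ↦ ?_)
    htrans.2 hΔ₁.2.2
  · exact hPc (eq_of_idealAt_eq_maximalIdeal hΔ₁.2.1 h ▸ hΔ₁.1)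
  · exact hPc (eq_of_idealAt_eq_maximalIdeal hΔ₂.2.1 h ▸ hΔ₂.1)

end SmoothPoint

/-! ### The local inequality -/

section Main

open Order IsLocalRing

variable {k : Type u} [Field k] {S Y : Scheme.{u}} [IsIntegral S] [IsIntegral Y]
  [IsLocallyNoetherian S] [IsLocallyNoetherian Y] {P Δ₁ Δ₂ : S} {a₁ a₂ : ℚ}

omit [IsIntegral S] [IsLocallyNoetherian S] in
theorem multipleOf_add_apply (Ω : AlgebraicCycle S ℚ) (z : S) : (multipleOf a₁ Δ₁ + multipleOf a₂ Δ₂ + Ω) z =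
      (open Classical in if z = Δ₁ then a₁ else 0) + (open Classical in if z = Δ₂ then a₂ else 0)
        + Ω z := by
  simp [multipleOf, Pi.single_apply]

omit [IsLocallyNoetherian S] in
theorem ord_rationalPullback_eq_of_span_eq (f : Y ⟶ S) [IsDominant f] {y : Y} (hP : f y ⤳ P)
    {r s : S.presheaf.stalk P} (h : Ideal.span {r} = Ideal.span {s}) :
    Y.ord (rationalPullback f (algebraMap _ _ r)) y =
      Y.ord (rationalPullback f (algebraMap _ _ s)) y := by
  rw [Ideal.span_singleton_eq_span_singleton] at h
  obtain ⟨u, rfl⟩ := h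
  by_cases hr : r = 0
  · simp [hr]
  have inj : Function.Injective
      ((rationalPullback f).comp (algebraMap (S.presheaf.stalk P) S.functionField)) :=
    (rationalPullback f).injective.comp (IsFractionRing.injective _ _)
  have h0 : ∀ t : S.presheaf.stalk P, t ≠ 0 → rationalPullback f (algebraMap _ _ t) ≠ 0 :=
    fun t ht ↦ (map_ne_zero_iff _ inj).2 ht
  rw [map_mul, map_mul, Scheme.ord_mul (h0 _ hr) (h0 _ u.ne_zero),
    ord_rationalPullback_of_notMem f hP (r := (u : S.presheaf.stalk P)) fun hu ↦
      (isPrime_idealAt hP).ne_top (Ideal.eq_top_of_isUnit_mem _ hu u.isUnit), add_zero]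

/-- This is `two_mul_ord_le_of_notMem` for the local ring at `P`, mapped to the function field of
`Y` by pullback. -/
theorem two_mul_ord_rationalPullback_le [S.Over (Spec (.of k))] [Y.Over (Spec (.of k))]
    {f : Y ⟶ S} [f.IsOver (Spec (.of k))] [IsDominant f] [IsAlgClosed k] {y : Y}
    [IsDiscreteValuationRing (Y.presheaf.stalk y)] (hy : f y = P)
    (hk : ∀ r : S.presheaf.stalk P, ∃ c : k,
      r - algebraMap k _ c ∈ maximalIdeal (S.presheaf.stalk P))
    {u v : S.presheaf.stalk P} (hu : idealAt Δ₁ P = Ideal.span {u})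
    (hv : idealAt Δ₂ P = Ideal.span {v}) (hu0 : u ≠ 0) (hv0 : v ≠ 0)
    (hp₁ : (idealAt Δ₁ P).IsPrime) (hp₂ : (idealAt Δ₂ P).IsPrime)
    (hm : maximalIdeal (S.presheaf.stalk P) = Ideal.span {u, v})
    (hd₁ : IsDiscreteValuationRing (S.presheaf.stalk P ⧸ idealAt Δ₁ P))
    (hd₂ : IsDiscreteValuationRing (S.presheaf.stalk P ⧸ idealAt Δ₂ P))
    {B : Y.functionField →ₗ[k] Derivation k Y.functionField Y.functionField}
    (hB : IsRegularBracket (Y.ord · y) B)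
    (hB0 : B (rationalPullback f (algebraMap _ _ u)) (rationalPullback f (algebraMap _ _ v)) ≠ 0)
    {z : S} {e : S.presheaf.stalk P} (he : idealAt z P = Ideal.span {e}) (he0 : e ≠ 0)
    (hz₁ : e ∉ idealAt Δ₁ P) (hz₂ : e ∉ idealAt Δ₂ P) :
    2 * Y.ord (rationalPullback f (algebraMap _ _ e)) y ≤
      2 * (1 + Y.ord (B (rationalPullback f (algebraMap _ _ u))
          (rationalPullback f (algebraMap _ _ v))) y
        - Y.ord (rationalPullback f (algebraMap _ _ u)) y
        - Y.ord (rationalPullback f (algebraMap _ _ v)) y) * curveMult z P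
      + Y.ord (rationalPullback f (algebraMap _ _ v)) y * localInter z Δ₁ P
      + Y.ord (rationalPullback f (algebraMap _ _ u)) y * localInter z Δ₂ P := by
  let _ : Algebra (S.presheaf.stalk P) Y.functionField :=
    ((rationalPullback f).comp (algebraMap (S.presheaf.stalk P) S.functionField)).toAlgebra
  have : IsScalarTower k (S.presheaf.stalk P) Y.functionField := .of_algebraMap_eq fun c ↦ by
    rw [← (rationalPullbackAlgHom (k := k) f).commutes c,
      IsScalarTower.algebraMap_apply k (S.presheaf.stalk P) S.functionField]
    rfl
  have hP : f y ⤳ P := specializes_of_eq hy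
  have hmP : idealAt (f y) P = maximalIdeal (S.presheaf.stalk P) := by rw [hy, idealAt_self]
  have hum : u ∈ maximalIdeal (S.presheaf.stalk P) :=
    hm ▸ Ideal.subset_span (Set.mem_insert _ _)
  have hvm : v ∈ maximalIdeal (S.presheaf.stalk P) :=
    hm ▸ Ideal.subset_span (Set.mem_insert_of_mem _ rfl)
  exact two_mul_ord_le_of_notMem hB isDiscreteOrder_ord hm hk
    (ord_rationalPullback_nonneg f hP) (ord_rationalPullback_pos f hP (hmP ▸ hum) hu0)
    (ord_rationalPullback_pos f hP (hmP ▸ hvm) hv0) hB0 e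
    (notMem_maximalIdeal_pow_curveMult he he0)
    (hu ▸ localInter_spec he hp₁ hd₁ hz₁)
    (hv ▸ localInter_spec he hp₂ hd₂ hz₂)

theorem neg_one_le_of_isDiscrepancy [S.Over (Spec (.of k))] [Y.Over (Spec (.of k))]
    [LocallyOfFiniteType (S ↘ Spec (.of k))] [LocallyOfFiniteType (Y ↘ Spec (.of k))]
    {f : Y ⟶ S} [f.IsOver (Spec (.of k))] [IsDominant f] [IsAlgClosed k] [CharZero k]
    (hdim : topologicalKrullDim S ≤ 2) (hP : IsClosed {P}) (hPs : IsSmoothPoint k S P)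
    (hΔ₁ : IsSmoothCurveAt Δ₁ P) (hΔ₂ : IsSmoothCurveAt Δ₂ P)
    (htrans : MeetTransversallyAt Δ₁ Δ₂ P) {Ω : AlgebraicCycle S ℚ} (hΩ : IsQDivisor Ω)
    (hΩeff : 0 ≤ Ω) (hΩ₁ : Ω Δ₁ = 0) (hΩ₂ : Ω Δ₂ = 0) (hM : divisorMult Ω P ≤ 1)
    (hN₁ : divisorInter Ω Δ₁ P ≤ 2 * (1 - a₂)) (hN₂ : divisorInter Ω Δ₂ P ≤ 2 * (1 - a₁))
    (hf : IsBirational f) {y : Y} [IsDiscreteValuationRing (Y.presheaf.stalk y)] (hy : f y ⤳ P)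
    {a : ℚ} (ha : IsDiscrepancy k f (multipleOf a₁ Δ₁ + multipleOf a₂ Δ₂ + Ω) y a) : -1 ≤ a := by
  classical
  have hk := exists_sub_algebraMap_mem_maximalIdeal k hP
  obtain ⟨u, v, hu, hv, hm⟩ :=
    exists_transversal_parameters k hdim hP hPs hΔ₁ hΔ₂ htrans
  have hp₁ := isPrime_idealAt hΔ₁.2.1
  have hp₂ := isPrime_idealAt hΔ₂.2.1
  have hPc := ne_of_coheight_eq_one hΔ₁.1 hΔ₂.1 hΔ₁.2.1 hΔ₂.2.1 htrans.1
  have hne : ∀ z, z ⤳ P → coheight z = 1 → idealAt z P ≠ maximalIdeal (S.presheaf.stalk P) :=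
    fun z hz hz1 h ↦ hPc (eq_of_idealAt_eq_maximalIdeal hz h ▸ hz1)
  have hum : u ∈ maximalIdeal (S.presheaf.stalk P) :=
    hm ▸ Ideal.subset_span (Set.mem_insert _ _)
  have hvm : v ∈ maximalIdeal (S.presheaf.stalk P) :=
    hm ▸ Ideal.subset_span (Set.mem_insert_of_mem _ rfl)
  have hsup : maximalIdeal (S.presheaf.stalk P) = Ideal.span {u} ⊔ Ideal.span {v} := by
    rw [hm, Ideal.span_insert]
  have hd₁ : IsDiscreteValuationRing (S.presheaf.stalk P ⧸ idealAt Δ₁ P) :=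
    isDiscreteValuationRing_quotient (hne _ hΔ₁.2.1 hΔ₁.1) hvm (by rw [hu, hsup])
  have hd₂ : IsDiscreteValuationRing (S.presheaf.stalk P ⧸ idealAt Δ₂ P) :=
    isDiscreteValuationRing_quotient (hne _ hΔ₂.2.1 hΔ₂.1) hum (by rw [hv, hsup, sup_comm])
  have hu0 : u ≠ 0 := by
    rintro rfl
    exact idealAt_ne_bot hΔ₁.2.1 hΔ₁.1 (by rw [hu, Ideal.span_singleton_eq_bot])
  have hv0 : v ≠ 0 := by
    rintro rfl
    exact idealAt_ne_bot hΔ₂.2.1 hΔ₂.1 (by rw [hv, Ideal.span_singleton_eq_bot])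
  have hpu : (Ideal.span {u}).IsPrime := hu ▸ hp₁
  have hdu : IsDiscreteValuationRing (S.presheaf.stalk P ⧸ Ideal.span {u}) := by
    convert hd₁ <;> exact hu.symm
  have hufd : UniqueFactorizationMonoid (S.presheaf.stalk P) :=
    uniqueFactorizationMonoid_of_smooth_curve hu0
  have hprin : ∀ w, w ⤳ P → idealAt w P ≠ maximalIdeal (S.presheaf.stalk P) →
      ∃ g, idealAt w P = Ideal.span {g} := fun w hw hne ↦ by
    have := isPrime_idealAt hw
    exact isPrincipal_of_isPrime (x := u) _ hne
  choose e he using fun z : CurveThrough P ↦ hprin z.1 z.2.1 (hne _ z.2.1 z.2.2)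
  have he0 := localEquation_ne_zero he
  obtain ⟨B, hB, hB0, T₀, hT₀⟩ := ha.exists_eq hf hy he hm hk
  have hord : IsDiscreteOrder k (Y.ord · y) := isDiscreteOrder_ord
  set c : CurveThrough P → ℤ := fun z ↦ Y.ord (rationalPullback f (algebraMap _ _ (e z))) y
  set p := Y.ord (rationalPullback f (algebraMap _ _ u)) y with hp
  set q := Y.ord (rationalPullback f (algebraMap _ _ v)) y with hq
  set β := Y.ord (B (rationalPullback f (algebraMap _ _ u))
    (rationalPullback f (algebraMap _ _ v))) y with hβ
  let δ₁ : CurveThrough P := ⟨Δ₁, hΔ₁.2.1, hΔ₁.1⟩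
  let δ₂ : CurveThrough P := ⟨Δ₂, hΔ₂.2.1, hΔ₂.1⟩
  set T : Finset (CurveThrough P) := T₀ ∪ ({δ₁, δ₂} ∪ (finite_setOf_curveThrough Ω P).toFinset)
  have hTΩ : ∀ z : CurveThrough P, Ω z.1 ≠ 0 → z ∈ T := fun z hz ↦ by simp [T, hz]
  have hT₁ : δ₁ ∈ T := by simp [T]
  have hT₂ : δ₂ ∈ T := by simp [T]
  have hΩ0 : ∀ z, 0 ≤ Ω z := hΩeff
  have hMsum : divisorMult Ω P = ∑ z ∈ T, Ω z.1 * curveMult z.1 P :=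
    finsum_eq_sum_curveThrough hΩ (fun _ ↦ curveMult_eq_zero) hTΩ
  have hNsum : ∀ Δ, divisorInter Ω Δ P = ∑ z ∈ T, Ω z.1 * localInter z.1 Δ P := fun Δ ↦
    finsum_eq_sum_curveThrough hΩ (fun _ ↦ localInter_eq_zero) hTΩ
  have hN0 : ∀ Δ, 0 ≤ divisorInter Ω Δ P := fun Δ ↦ by
    rw [hNsum]
    exact Finset.sum_nonneg fun z _ ↦ mul_nonneg (hΩ0 _) (Nat.cast_nonneg _)
  have hsum : ∑ z ∈ T, (multipleOf a₁ Δ₁ + multipleOf a₂ Δ₂ + Ω) z.1 * (c z : ℚ) =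
      a₁ * c δ₁ + a₂ * c δ₂ + ∑ z ∈ T, Ω z.1 * c z := by
    have h1 : ∀ z : CurveThrough P, z.1 = Δ₁ ↔ z = δ₁ := fun z ↦ ⟨fun h ↦ Subtype.ext h, by rintro rfl; rfl⟩
    have h2 : ∀ z : CurveThrough P, z.1 = Δ₂ ↔ z = δ₂ := fun z ↦ ⟨fun h ↦ Subtype.ext h, by rintro rfl; rfl⟩
    simp only [multipleOf_add_apply, h1, h2, add_mul, Finset.sum_add_distrib, ite_mul, zero_mul,
      Finset.sum_ite_eq', hT₁, hT₂, if_true]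
  have haT := hT₀ T Finset.subset_union_left
  have hβ0 : 0 ≤ β := hB.regular _ _ (ord_rationalPullback_nonneg f hy u)
    (ord_rationalPullback_nonneg f hy v)
  have hβ0' : (0 : ℚ) ≤ β := by exact_mod_cast hβ0
  by_cases hyP : f y = P
  -- The centre is `P`, so both parameters have positive order and the valuative inequality applies
  -- to every component of `Ω`.
  · have hmP : idealAt (f y) P = maximalIdeal (S.presheaf.stalk P) := by rw [hyP, idealAt_self]
    have hp0 : 0 < p := ord_rationalPullback_pos f hy (hmP ▸ hum) hu0
    have hq0 : 0 < q := ord_rationalPullback_pos f hy (hmP ▸ hvm) hv0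
    have hc₁ : c δ₁ = p := ord_rationalPullback_eq_of_span_eq f hy ((he δ₁).symm.trans hu)
    have hc₂ : c δ₂ = q := ord_rationalPullback_eq_of_span_eq f hy ((he δ₂).symm.trans hv)
    have hA : p + q - 1 ≤ β := by
      refine hB.ordGE_add_sub_one hord ?_ ?_ hp0.le hq0.le hB0
      · rintro h
        rw [hp, h, Scheme.ord_zero] at hp0
        exact lt_irrefl _ hp0
      · rintro h
        rw [hq, h, Scheme.ord_zero] at hq0
        exact lt_irrefl _ hq0
    have hle : ∀ z ∈ T, Ω z.1 * (2 * (c z : ℚ)) ≤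
        2 * (1 + β - p - q) * (Ω z.1 * curveMult z.1 P) + q * (Ω z.1 * localInter z.1 Δ₁ P) +
          p * (Ω z.1 * localInter z.1 Δ₂ P) := by
      intro z _
      by_cases hz : Ω z.1 = 0
      · simp [hz]
      have hz₁ : e z ∉ idealAt Δ₁ P := fun h ↦ hz <| by
        rwa [eq_of_idealAt_eq z.2.1 hΔ₁.2.1 (eq_of_localEquation_mem he hu h)]
      have hz₂ : e z ∉ idealAt Δ₂ P := fun h ↦ hz <| by
        rwa [eq_of_idealAt_eq z.2.1 hΔ₂.2.1 (eq_of_localEquation_mem he hv h)]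
      have key : 2 * c z ≤ 2 * (1 + β - p - q) * curveMult z.1 P + q * localInter z.1 Δ₁ P +
          p * localInter z.1 Δ₂ P :=
        two_mul_ord_rationalPullback_le hyP hk hu hv hu0 hv0 hp₁ hp₂ hm hd₁ hd₂ hB hB0
          (he z) (he0 z) hz₁ hz₂
      have key' : 2 * (c z : ℚ) ≤ 2 * (1 + β - p - q) * curveMult z.1 P +
          q * localInter z.1 Δ₁ P + p * localInter z.1 Δ₂ P := by exact_mod_cast key
      calc Ω z.1 * (2 * (c z : ℚ)) ≤ Ω z.1 * _ := mul_le_mul_of_nonneg_left key' (hΩ0 _)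
        _ = _ := by ring
    have hΩc := Finset.sum_le_sum hle
    simp only [Finset.sum_add_distrib, ← Finset.mul_sum, ← hMsum, ← hNsum, mul_left_comm _ (2 : ℚ)]
      at hΩc
    rw [hsum, hc₁, hc₂] at haT
    have hp0' : (0 : ℚ) < p := by exact_mod_cast hp0
    have hq0' : (0 : ℚ) < q := by exact_mod_cast hq0
    have hA' : (0 : ℚ) ≤ 1 + β - p - q := by exact_mod_cast (by omega : 0 ≤ 1 + β - p - q)
    -- Weighted by `1 + β - p - q`, `q` and `p`, the three numerical assumptions add up to `a₁ p +
    -- a₂ q + ord Ω ≤ 1 + β`.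
    have h1 := mul_le_mul_of_nonneg_left hM hA'
    have h2 := mul_le_mul_of_nonneg_left hN₁ hq0'.le
    have h3 := mul_le_mul_of_nonneg_left hN₂ hp0'.le
    linarith
  -- The centre is a curve `z₀`, and the discrepancy is `β` minus its coefficient, with `β ≥ 0`; it
  -- remains to bound the coefficient by one.
  · obtain ⟨g, hg⟩ := hprin _ hy fun h ↦ hyP (eq_of_idealAt_eq_maximalIdeal hy h)
    obtain ⟨z₀, hz₀, huniq⟩ := exists_curveThrough_of_idealAt_eq_span hf hy he hg
    have ha₀ := hT₀ (insert z₀ T₀) (Finset.subset_insert _ _)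
    rw [Finset.sum_eq_single_of_mem z₀ (Finset.mem_insert_self _ _) fun z _ hz ↦ by
      rw [huniq z hz, Int.cast_zero, mul_zero], hz₀, Int.cast_one, mul_one,
      multipleOf_add_apply] at ha₀
    by_contra! hlt
    by_cases h₁ : z₀.1 = Δ₁
    · rw [h₁, if_pos rfl, if_neg htrans.1, hΩ₁] at ha₀
      -- Intersection numbers are non-negative, so `hN₂` gives `a₁ ≤ 1`.
      linarith [hN0 Δ₂]
    by_cases h₂ : z₀.1 = Δ₂
    · rw [h₂, if_neg htrans.1.symm, if_pos rfl, hΩ₂] at ha₀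
      linarith [hN0 Δ₁]
    rw [if_neg h₁, if_neg h₂] at ha₀
    have hΩz : 1 < Ω z₀.1 := by linarith
    have hcm : (1 : ℚ) ≤ curveMult z₀.1 P := by
      exact_mod_cast one_le_curveMult z₀.2.1 (he z₀) (he0 z₀)
    -- A component through `P` has multiplicity at least one, so its coefficient is at most `mult_P
    -- Ω ≤ 1`.
    have h3 : Ω z₀.1 * curveMult z₀.1 P ≤ divisorMult Ω P := by
      rw [hMsum]
      exact Finset.single_le_sum
        (f := fun z : CurveThrough P ↦ Ω z.1 * (curveMult z.1 P : ℚ))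
        (fun z _ ↦ mul_nonneg (hΩ0 _) (Nat.cast_nonneg _)) (hTΩ z₀ (by linarith))
    nlinarith

end Main

end LocalInequality

end

theorem mainTheorem1 (k : Type u) [Field k] [IsAlgClosed k] [CharZero k]
    (S : Scheme.{u}) [IsIntegral S] [S.Over (Spec (.of k))]
    [IsSeparated (S ↘ Spec (.of k))] [LocallyOfFiniteType (S ↘ Spec (.of k))]
    [QuasiCompact (S ↘ Spec (.of k))]
    (hdim : topologicalKrullDim S = 2)
    (P : S) (hP : IsClosed {P}) (hPsmooth : LocalInequality.IsSmoothPoint k S P)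
    (Δ₁ Δ₂ : S)
    (hΔ₁ : LocalInequality.IsSmoothCurveAt Δ₁ P) (hΔ₂ : LocalInequality.IsSmoothCurveAt Δ₂ P)
    (htrans : LocalInequality.MeetTransversallyAt Δ₁ Δ₂ P)
    (a₁ a₂ : ℚ) (ha₁ : 0 ≤ a₁) (ha₂ : 0 ≤ a₂)
    (Ω : AlgebraicCycle S ℚ) (hΩ : LocalInequality.IsQDivisor Ω) (hΩeff : 0 ≤ Ω)
    (hΩ₁ : Ω Δ₁ = 0) (hΩ₂ : Ω Δ₂ = 0)
    (hlc : ¬ LocalInequality.IsLogCanonicalAt k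
      (LocalInequality.multipleOf a₁ Δ₁ + LocalInequality.multipleOf a₂ Δ₂ + Ω) P)
    (hm : LocalInequality.divisorMult Ω P ≤ 1) :
    2 * (1 - a₂) < LocalInequality.divisorInter Ω Δ₁ P ∨
      2 * (1 - a₁) < LocalInequality.divisorInter Ω Δ₂ P := by
  have : IsLocallyNoetherian S := LocallyOfFiniteType.isLocallyNoetherian (S ↘ Spec (.of k))
  by_contra! h
  obtain ⟨hN₁, hN₂⟩ := h
  refine hlc fun Y _ _ f _ _ _ hY hf y hy hyP a ha ↦ ?_
  have : IsLocallyNoetherian Y := LocallyOfFiniteType.isLocallyNoetherian f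
  have : LocallyOfFiniteType (Y ↘ Spec (.of k)) := by
    rw [← comp_over f (Spec (.of k))]
    infer_instance
  have := hY.isDiscreteValuationRing hy
  exact LocalInequality.neg_one_le_of_isDiscrepancy hdim.le hP hPsmooth hΔ₁ hΔ₂ htrans hΩ hΩeff
    hΩ₁ hΩ₂ hm hN₁ hN₂ hf hyP ha
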